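/- **Theorem 3.5.** Let $f:\mathbb R\to\mathbb R$ be locally Lipschitz, $f(0)=0$, strictly decreasing on $(-\infty,0]$, strictly increasing on $[0,+\infty)$, with $f(s)\to+\infty$ as $|s|\to\infty$, and let $0<k_1<k_2$. *Notation.* For $k>0$ put $\Phi_k(x)=\int_0^x f(s)\,ds-kx$ and $E_k(x,y)=\tfrac12y^2+\Phi_k(x)$. Let $x_u(k)<0<x_s(k)$ be the two solutions of $f(x)=k$, and $x_h(k)>x_s(k)$ the solution of $\Phi_k(x)=\Phi_k(x_u(k))$. For a level $\rho$, let $\Phi_k(x)=\rho$ be solved by $x_*(\rho)<x_u(k)$ if $\rho<\Phi_k(x_u(k))$; by $x^*(\rho)>x_h(k)$ if $\rho>\Phi_k(x_u(k))$; and by $x_-(\rho)\in(x_u(k),x_s(k))$ and $x_+(\rho)>x_s(k)$ if $\Phi_k(x_s(k))<\rho<\Phi_k(x_u(k))$. Real numbers $A,B,D$ are called *admissible* if - $A<\Phi_{k_1}(x_u(k_1))$, and $a:=x_*(A)$ (for $k=k_1$) lies in $(x_u(k_2),x_u(k_1))$; - $\Phi_{k_2}(x_s(k_2))<D<\Phi_{k_2}(x_u(k_2))$,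 and $d:=x_-(D)$, $x_+(D)$ (for $k=k_2$) satisfy $x_u(k_2)<d<a$ and $x_s(k_2)<x_+(D)<x_h(k_2)$; - $B>\Phi_{k_1}(x_u(k_1))$, and $b:=x^*(B)$ (for $k=k_1$) satisfies $x_h(k_1)<b<x_+(D)$. For admissible $A,B,D$ and $m\in\mathbb N$, $m\ge1$, put $$\tau_1^*=\max\left\{2\int_{x_u(k_2)}^{a}\frac{ds}{\sqrt{2(A-\Phi_{k_1}(s))}},\ 2\int_{x_u(k_2)}^{b}\frac{ds}{\sqrt{2(B-\Phi_{k_1}(s))}}\right\},$$ $$\tau_2^*=2\int_{d}^{b}\frac{ds}{\sqrt{2(D-\Phi_{k_2}(s))}}+2(m-1)\int_{d}^{x_+(D)}\frac{ds}{\sqrt{2(D-\Phi_{k_2}(s))}}.$$ Let $\mathcal S$ be the union of $\{A\le E_{k_1}\le\Phi_{k_1}(x_u(k_1)),\ x\le x_u(k_1)\}$ and $\{\Phi_{k_1}(x_u(k_1))\le E_{k_1}\le B\}$ (a strip with a hole), let $\mathcal A=\{D\le E_{k_2}\le\Phi_{k_2}(x_u(k_2)),\ x\ge x_u(k_2)\}$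 (an annulus), and let $\mathcal M=\mathcal A\cap\mathcal S\cap\{y>0\}$, $\mathcal N=\mathcal A\cap\mathcal S\cap\{y<0\}$. *Statement.* Admissible triples $A,B,D$ exist. For every admissible triple, every integer $m\ge1$, all $t_1>\tau_1^*$ and $t_2>\tau_2^*$, the following holds. Let $p:\mathbb R\to\mathbb R$ be the $T$-periodic function, $T=t_1+t_2$, with $p=k_1$ on $[0,t_1)$ and $p=k_2$ on $[t_1,t_1+t_2)$. Let $\Psi$ be the Poincaré map of $x'=y$, $y'=-f(x)+p(t)$, which sends $z$ to $\zeta(T)$, where $\zeta$ is the solution (in the sense of Carathéodory) with $\zeta(0)=z$; its domain is the set of those $z$ whose solution exists on $[0,T]$. Let $\Psi_1$ be the analogous map of $x'=y$, $y'=-f(x)+k_1$ for the time interval $[0,t_1]$. Then: 1. $\Psi$ has a topological horseshoe on $2m$ symbols: there are a compact set $\Lambda\subseteq\operatorname{dom}\Psi$ with $\Psi(\Lambda)=\Lambda$, in which the periodic points of $\Psi$ are dense, and a continuous surjection $\Pi:\Lambda\to\{0,\dots,2m-1\}^{\mathbb Z}$ with $\Pi\circ\Psi=\sigma\circ\Pi$,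 $\sigma$ being the shift $(\sigma S)_i=S_{i+1}$, such that for every $l\ge1$ and every $l$-periodic sequence $S$ there is $w\in\Lambda$ with $\Psi^l(w)=w$ and $\Pi(w)=S$. 2. $\Psi$ induces chaotic dynamics on $2\times m$ symbols on the nonempty set $\mathcal D=\{z\in\mathcal M\cap\operatorname{dom}\Psi_1:\Psi_1(z)\in\mathcal N\}\subseteq\operatorname{dom}\Psi$: there are nonempty pairwise disjoint compact sets $\mathcal K_0,\dots,\mathcal K_{2m-1}\subseteq\mathcal D$ such that for every sequence $(s_i)_{i\in\mathbb Z}$ in $\{0,\dots,2m-1\}$ there is a sequence $(w_i)_{i\in\mathbb Z}$ with $w_i\in\mathcal K_{s_i}$ and $w_{i+1}=\Psi(w_i)$ for all $i$; and if $(s_i)$ is $l$-periodic for some $l\ge1$, then $(w_i)$ can be chosen $l$-periodic. -/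

import Mathlib

open Set Filter Topology MeasureTheory

noncomputable section

/-- The standing hypothesis on the nonlinearity. -/
structure HypH0 (f : ℝ → ℝ) : Prop where
  locallyLipschitz : LocallyLipschitz f
  map_zero : f 0 = 0
  strictAntiOn : StrictAntiOn f (Iic 0)
  strictMonoOn : StrictMonoOn f (Ici 0)
  tendsto_atBot : Tendsto f atBot atTop
  tendsto_atTop : Tendsto f atTop atTop

/-! ### Solutions and Poincaré maps -/

/-- `ζ = (x, y)` is a (Carathéodory) solution on `[0, S]` of `x' = y`, `y' = -f(x) + p(t)`, written
as an integral equation, as `p` may be discontinuous. -/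
def IsSolutionOn (f p : ℝ → ℝ) (S : ℝ) (ζ : ℝ → ℝ × ℝ) : Prop :=
  ContinuousOn ζ (Icc 0 S) ∧ ∀ t ∈ Icc (0 : ℝ) S,
    (ζ t).1 = (ζ 0).1 + ∫ s in (0 : ℝ)..t, (ζ s).2 ∧
    (ζ t).2 = (ζ 0).2 + ∫ s in (0 : ℝ)..t, (-f (ζ s).1 + p s)

/-- The domain of the Poincaré map relative to `[0, S]`: the initial points whose solution exists
up to time `S`. -/
def poincareDom (f p : ℝ → ℝ) (S : ℝ) : Set (ℝ × ℝ) :=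
  {z | ∃ ζ, IsSolutionOn f p S ζ ∧ ζ 0 = z}

open Classical in
/-- The Poincaré map relative to `[0, S]`: it sends `z` to `ζ(S)`, where `ζ` is the solution with
`ζ(0) = z`. It is meaningful on `poincareDom f p S` only (the value elsewhere is a dummy);
`poincareMap_eq` below shows that it does not depend on the choice of `ζ`. -/
def poincareMap (f p : ℝ → ℝ) (S : ℝ) (z : ℝ × ℝ) : ℝ × ℝ :=
  if h : ∃ ζ, IsSolutionOn f p S ζ ∧ ζ 0 = z then h.choose S else z

/-- Solutions become classical after subtracting the primitive of `p` from `y`. -/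
theorem IsSolutionOn.hasDerivWithinAt {f p : ℝ → ℝ} {S : ℝ} {ζ : ℝ → ℝ × ℝ} (hf : Continuous f)
    (hp : IntervalIntegrable p volume 0 S) (h : IsSolutionOn f p S ζ) {t : ℝ}
    (ht : t ∈ Ico (0 : ℝ) S) :
    HasDerivWithinAt (fun t => ((ζ t).1, (ζ t).2 - ∫ s in (0 : ℝ)..t, p s))
      ((ζ t).2, -f (ζ t).1) (Ici t) t := by
  obtain ⟨hc, hi⟩ := h
  have h1 : ContinuousOn (fun s => (ζ s).2) (Icc 0 S) := continuous_snd.comp_continuousOn hc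
  have h2 : ContinuousOn (fun s => -f (ζ s).1) (Icc 0 S) :=
    (hf.comp_continuousOn (continuous_fst.comp_continuousOn hc)).neg
  have key : ∀ g : ℝ → ℝ, ContinuousOn g (Icc 0 S) → ∀ c : ℝ,
      HasDerivWithinAt (fun t => c + ∫ s in (0 : ℝ)..t, g s) (g t) (Icc t S) t := by
    intro g hg c
    have hsub : Icc 0 t ⊆ Icc 0 S := Icc_subset_Icc_right ht.2.le
    have : HasDerivWithinAt (fun t => ∫ s in (0 : ℝ)..t, g s) (g t) (Icc 0 S) t := by
      have : Fact (t ∈ Icc 0 S) := ⟨⟨ht.1, ht.2.le⟩⟩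
      refine intervalIntegral.integral_hasDerivWithinAt_right
        ((hg.mono hsub).intervalIntegrable_of_Icc ht.1) ?_ (hg t ⟨ht.1, ht.2.le⟩)
      exact hg.stronglyMeasurableAtFilter_nhdsWithin measurableSet_Icc t
    exact (this.mono (Icc_subset_Icc_left ht.1)).const_add c
  have hIcc : HasDerivWithinAt (fun t => ((ζ t).1, (ζ t).2 - ∫ s in (0 : ℝ)..t, p s))
      ((ζ t).2, -f (ζ t).1) (Icc t S) t := by
    refine ((key _ h1 (ζ 0).1).prodMk (key _ h2 (ζ 0).2)).congr_of_mem (fun u hu => ?_)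
      (left_mem_Icc.2 ht.2.le)
    have hu' : u ∈ Icc 0 S := ⟨ht.1.trans hu.1, hu.2⟩
    obtain ⟨e1, e2⟩ := hi u hu'
    have hsub : Icc 0 u ⊆ Icc 0 S := Icc_subset_Icc_right hu'.2
    have hpu : IntervalIntegrable p volume 0 u := hp.mono_set (by
      rw [uIcc_of_le hu'.1, uIcc_of_le (hu'.1.trans hu'.2)]; exact hsub)
    rw [intervalIntegral.integral_add ((h2.mono hsub).intervalIntegrable_of_Icc hu'.1) hpu] at e2
    refine Prod.ext e1 ?_
    simp only
    rw [e2]; ring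
  exact hIcc.mono_of_mem_nhdsWithin (Icc_mem_nhdsGE ht.2)

/-- The Poincaré map is well defined. -/
theorem poincareMap_eq {f p : ℝ → ℝ} {S : ℝ} {ζ : ℝ → ℝ × ℝ} (hf : LocallyLipschitz f)
    (hS : 0 ≤ S) (hp : IntervalIntegrable p volume 0 S) (h : IsSolutionOn f p S ζ) :
    poincareMap f p S (ζ 0) = ζ S := by
  have hex : ∃ ξ, IsSolutionOn f p S ξ ∧ ξ 0 = ζ 0 := ⟨ζ, h, rfl⟩
  rw [poincareMap, dif_pos hex]
  obtain ⟨h', h0⟩ := hex.choose_spec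
  generalize hex.choose = ξ at h' h0
  have hP : ContinuousOn (fun t => ∫ s in (0 : ℝ)..t, p s) (Icc 0 S) := by
    have := intervalIntegral.continuousOn_primitive_interval' hp (left_mem_uIcc)
    rwa [uIcc_of_le hS] at this
  have hb : IsCompact ((fun t => (ζ t).1) '' Icc 0 S ∪ (fun t => (ξ t).1) '' Icc 0 S) :=
    (isCompact_Icc.image_of_continuousOn (continuous_fst.comp_continuousOn h.1)).union
      (isCompact_Icc.image_of_continuousOn (continuous_fst.comp_continuousOn h'.1))
  set C := (fun t => (ζ t).1) '' Icc 0 S ∪ (fun t => (ξ t).1) '' Icc 0 S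
  obtain ⟨K, hK⟩ := (hf.locallyLipschitzOn (s := C)).exists_lipschitzOnWith_of_compact hb
  have hcont : ∀ χ, IsSolutionOn f p S χ →
      ContinuousOn (fun t => ((χ t).1, (χ t).2 - ∫ s in (0 : ℝ)..t, p s)) (Icc 0 S) :=
    fun χ hχ => (continuous_fst.comp_continuousOn hχ.1).prodMk
      ((continuous_snd.comp_continuousOn hχ.1).sub hP)
  have huniq := ODE_solution_unique_of_mem_Icc_right
    (v := fun t z => (z.2 + ∫ s in (0 : ℝ)..t, p s, -f z.1)) (s := fun _ => C ×ˢ univ)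
    (K := max 1 K) (a := 0) (b := S)
    (fun t _ => by
      refine LipschitzOnWith.prodMk ?_ ?_
      · refine LipschitzOnWith.of_dist_le_mul fun z _ w _ => ?_
        simp only [dist_add_right, NNReal.coe_one, one_mul]
        exact le_max_right _ _
      · refine LipschitzOnWith.of_dist_le_mul fun z hz w hw => ?_
        rw [dist_neg_neg]
        refine (hK.dist_le_mul _ hz.1 _ hw.1).trans ?_
        gcongr
        exact le_max_left _ _)
    (hcont ξ h') (fun t ht => by
      have := h'.hasDerivWithinAt hf.continuous hp ht
      simpa using this)
    (fun t ht => ⟨Or.inr ⟨t, ⟨ht.1, ht.2.le⟩, rfl⟩, mem_univ _⟩)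
    (hcont ζ h) (fun t ht => by
      have := h.hasDerivWithinAt hf.continuous hp ht
      simpa using this)
    (fun t ht => ⟨Or.inl ⟨t, ⟨ht.1, ht.2.le⟩, rfl⟩, mem_univ _⟩)
    (by simp [h0])
  have hfin := huniq (right_mem_Icc.2 hS)
  simp only [Prod.mk.injEq, sub_left_inj] at hfin
  exact Prod.ext hfin.1 hfin.2

/-! ### The autonomous systems `x' = y`, `y' = -f(x) + k` -/

/-- `Φ_k(x) = F(x) - k x`, where `F(x) = ∫₀ˣ f`. -/
def potential (f : ℝ → ℝ) (k x : ℝ) : ℝ := (∫ s in (0 : ℝ)..x, f s) - k * x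

/-- The energy `E_k(x, y) = y² / 2 + F(x) - k x`. -/
def energy (f : ℝ → ℝ) (k : ℝ) (z : ℝ × ℝ) : ℝ := z.2 ^ 2 / 2 + potential f k z.1

/-- Abscissa `x_u(k)` of the saddle: the solution of `f x = k` in `]-∞, 0]`. -/
def xSaddle (f : ℝ → ℝ) (k : ℝ) : ℝ := Function.invFunOn f (Iic 0) k

/-- Abscissa `x_s(k)` of the center: the solution of `f x = k` in `[0, +∞[`. -/
def xCenter (f : ℝ → ℝ) (k : ℝ) : ℝ := Function.invFunOn f (Ici 0) k

/-- `x_h(k)`: the solution `x > x_s(k)` of `Φ_k(x) = Φ_k(x_u(k))`. -/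
def xHom (f : ℝ → ℝ) (k : ℝ) : ℝ :=
  Function.invFunOn (potential f k) (Ioi (xCenter f k)) (potential f k (xSaddle f k))

/-- `x_*(ρ)`, for `ρ < Φ_k(x_u)`: the solution `x < x_u` of `Φ_k(x) = ρ`. -/
def xLower (f : ℝ → ℝ) (k ρ : ℝ) : ℝ :=
  Function.invFunOn (potential f k) (Iio (xSaddle f k)) ρ

/-- `x^*(ρ)`, for `ρ > Φ_k(x_u)`: the solution `x > x_h` of `Φ_k(x) = ρ`. -/
def xUpper (f : ℝ → ℝ) (k ρ : ℝ) : ℝ :=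
  Function.invFunOn (potential f k) (Ioi (xHom f k)) ρ

/-- `x_-(ρ)`, for `Φ_k(x_s) < ρ < Φ_k(x_u)`: the solution `x_u < x < x_s` of `Φ_k(x) = ρ`. -/
def xMinus (f : ℝ → ℝ) (k ρ : ℝ) : ℝ :=
  Function.invFunOn (potential f k) (Ioo (xSaddle f k) (xCenter f k)) ρ

/-- `x_+(ρ)`, for `Φ_k(x_s) < ρ < Φ_k(x_u)`: the solution `x > x_s` of `Φ_k(x) = ρ`. -/
def xPlus (f : ℝ → ℝ) (k ρ : ℝ) : ℝ :=
  Function.invFunOn (potential f k) (Ioi (xCenter f k)) ρ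

/-! ### Time maps -/

/-- The time needed to move from abscissa `x₁` to abscissa `x₂` in the upper half-plane along the
level line of energy `ρ`. -/
def timeMap (f : ℝ → ℝ) (k ρ x₁ x₂ : ℝ) : ℝ :=
  ∫ s in x₁..x₂, 1 / √(2 * (ρ - potential f k s))

/-- Time from `x = r, y > 0` to `x = r, y < 0` on the unbounded orbit through `(x_*(ρ), 0)`. -/
def tauV (f : ℝ → ℝ) (k ρ r : ℝ) : ℝ := 2 * timeMap f k ρ r (xLower f k ρ)

/-- Time from `x = r, y > 0` to `x = r, y < 0` on the unbounded orbit through `(x^*(ρ), 0)`. -/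
def tauU (f : ℝ → ℝ) (k ρ r : ℝ) : ℝ := 2 * timeMap f k ρ r (xUpper f k ρ)

/-- Time from `(x_-(ρ), 0)` to `x = r, y ≥ 0` on the closed orbit of energy `ρ`. -/
def tauO (f : ℝ → ℝ) (k ρ r : ℝ) : ℝ := timeMap f k ρ (xMinus f k ρ) r

/-- The fundamental period of the closed orbit of energy `ρ`. -/
def periodO (f : ℝ → ℝ) (k ρ : ℝ) : ℝ := 2 * tauO f k ρ (xPlus f k ρ)

/-! ### The linked strip and annulus -/

/-- The conditions on the three energy levels `A`, `B` (for `k₁`) and `D` (for `k₂`), where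
`a = x_*(A)`, `b = x^*(B)`, `d = x_-(D)`. -/
structure AdmissibleLevels (f : ℝ → ℝ) (k₁ k₂ A B D : ℝ) : Prop where
  A_lt : A < potential f k₁ (xSaddle f k₁)
  a_mem : xLower f k₁ A ∈ Ioo (xSaddle f k₂) (xSaddle f k₁)
  D_mem : D ∈ Ioo (potential f k₂ (xCenter f k₂)) (potential f k₂ (xSaddle f k₂))
  d_mem : xMinus f k₂ D ∈ Ioo (xSaddle f k₂) (xLower f k₁ A)
  xPlus_mem : xPlus f k₂ D ∈ Ioo (xCenter f k₂) (xHom f k₂)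
  lt_B : potential f k₁ (xSaddle f k₁) < B
  b_mem : xUpper f k₁ B ∈ Ioo (xHom f k₁) (xPlus f k₂ D)

/-- `τ₁* = max (τ_V(A; x_u(k₂))) (τ_U(B; x_u(k₂)))`, for the system with `k = k₁`. -/
def tauStar₁ (f : ℝ → ℝ) (k₁ k₂ A B : ℝ) : ℝ :=
  max (tauV f k₁ A (xSaddle f k₂)) (tauU f k₁ B (xSaddle f k₂))

/-- The time to go from `x = b, y < 0` to `x = b, y > 0` (through `(x_-(D), 0)`) along the closed
orbit of energy `D` of the system with `k = k₂`, plus `m - 1` periods of that orbit. -/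
def tauStar₂ (f : ℝ → ℝ) (k₁ k₂ B D : ℝ) (m : ℕ) : ℝ :=
  2 * tauO f k₂ D (xUpper f k₁ B) + ((m : ℝ) - 1) * periodO f k₂ D

/-- The strip with a hole: the region between the unbounded orbits of energies `A` and `B` of the
system with parameter `k`, minus the part enclosed by the homoclinic orbit. -/
def strip (f : ℝ → ℝ) (k A B : ℝ) : Set (ℝ × ℝ) :=
  {z | A ≤ energy f k z ∧ energy f k z ≤ potential f k (xSaddle f k) ∧ z.1 ≤ xSaddle f k} ∪
  {z | potential f k (xSaddle f k) ≤ energy f k z ∧ energy f k z ≤ B}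

/-- The annulus between the closed orbit of energy `D` and the homoclinic orbit. -/
def annulus (f : ℝ → ℝ) (k D : ℝ) : Set (ℝ × ℝ) :=
  {z | D ≤ energy f k z ∧ energy f k z ≤ potential f k (xSaddle f k) ∧ xSaddle f k ≤ z.1}

/-- The upper component `M` of the intersection of the annulus and the strip. -/
def rectM (f : ℝ → ℝ) (k₁ k₂ A B D : ℝ) : Set (ℝ × ℝ) :=
  annulus f k₂ D ∩ strip f k₁ A B ∩ {z | 0 < z.2}

/-- The lower component `N` of the intersection of the annulus and the strip. -/
def rectN (f : ℝ → ℝ) (k₁ k₂ A B D : ℝ) : Set (ℝ × ℝ) :=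
  annulus f k₂ D ∩ strip f k₁ A B ∩ {z | z.2 < 0}

/-! ### Chaotic dynamics -/

/-- The map `φ`, defined on `dom`, induces chaotic dynamics on `n ≥ 2` symbols on `𝓓 ⊆ dom`. -/
def InducesChaos (dom : Set (ℝ × ℝ)) (φ : ℝ × ℝ → ℝ × ℝ) (n : ℕ) (𝓓 : Set (ℝ × ℝ)) : Prop :=
  2 ≤ n ∧ 𝓓.Nonempty ∧ 𝓓 ⊆ dom ∧
  ∃ K : Fin n → Set (ℝ × ℝ),
    (∀ i, (K i).Nonempty ∧ IsCompact (K i) ∧ K i ⊆ 𝓓) ∧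
    (∀ i j, i ≠ j → Disjoint (K i) (K j)) ∧
    (∀ s : ℤ → Fin n, ∃ w : ℤ → ℝ × ℝ, ∀ i, w i ∈ K (s i) ∧ w (i + 1) = φ (w i)) ∧
    (∀ s : ℤ → Fin n, ∀ l : ℕ, 1 ≤ l → (∀ i, s (i + l) = s i) →
      ∃ w : ℤ → ℝ × ℝ, (∀ i, w i ∈ K (s i) ∧ w (i + 1) = φ (w i)) ∧ ∀ i, w (i + l) = w i)

/-- A topological horseshoe on `n ≥ 2` symbols for the map `φ`, defined on `dom`: there is a
compact invariant set `Λ`, in which the periodic points of `φ` are dense, and a continuous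
surjection `π` of `Λ` onto the space `Fin n ^ ℤ` of two-sided sequences, which semiconjugates `φ`
to the Bernoulli shift, and such that every periodic sequence is the image of a periodic point of
the same period. -/
def HasTopologicalHorseshoe (dom : Set (ℝ × ℝ)) (φ : ℝ × ℝ → ℝ × ℝ) (n : ℕ) : Prop :=
  2 ≤ n ∧ ∃ (Λ : Set (ℝ × ℝ)) (π : ℝ × ℝ → ℤ → Fin n),
    IsCompact Λ ∧ Λ ⊆ dom ∧ φ '' Λ = Λ ∧
    Λ ⊆ closure {w ∈ Λ | ∃ l : ℕ, 1 ≤ l ∧ Function.IsPeriodicPt φ l w} ∧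
    ContinuousOn π Λ ∧ SurjOn π Λ univ ∧
    (∀ w ∈ Λ, ∀ i, π (φ w) i = π w (i + 1)) ∧
    (∀ s : ℤ → Fin n, ∀ l : ℕ, 1 ≤ l → (∀ i, s (i + l) = s i) →
      ∃ w ∈ Λ, Function.IsPeriodicPt φ l w ∧ π w = s)

end

/-! An orbit of the switched system is a chain of arcs of level lines, so finding it amounts to
solving equations between travel times. A level line of `k₁` in the strip is labelled by its turning
point `p`, which lies either left of the saddle (`i = 0`) or right of `x_h(k₁)` (`i = 1`). A closed
orbit of `k₂` in the annulus is labelled by its left turning point `q`. The two energies differ by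
`(k₂ - k₁) x`, so the lines `p` and `q` cross at an explicit abscissa `crossX`, once in M and, by
the symmetry `y ↦ -y`, once in N. The pair `(p, q)` thus serves as a coordinate on M and on N.

One period of the forcing leads from the upper crossing of `(p, q)` along the line `p` to the lower
crossing of `(p, q')`, and then along the line `q'`, with `j` additional turns, to the upper
crossing of `(p', q')`. This happens in times `t₁` and `t₂` exactly when `outerTravel (p, q, q') =
t₁` and `innerTravel j (q', p, p') = t₂`. The symbol is the pair `(i, j)` with `j < m`.

An `l`-periodic itinerary is therefore a cyclic system of `2l` equations in `2l` unknowns. On the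
extreme lines `A`, `B`, `D` the travel times stay below `t₁` and `t₂`, because they are bounded by
`τ₁*` and `τ₂*`. Near the separatrices they exceed any bound, because the line passes close to a
saddle (`LinkedSystem.outerTime_blowup`, `LinkedSystem.innerTime_blowup`). The bounds are uniform in
the other unknowns, so the Poincaré-Miranda theorem (`exists_eq_zero_of_box`, in the form
`exists_cyclic_solution`) yields a solution.

The rest is soft. Uniqueness for the differential equation makes the Poincaré map injective on the
sets `K n` and these sets disjoint. Compactness then passes from periodic to arbitrary itineraries
and produces the horseshoe (`exists_horseshoe_of_periodic`).

The Poincaré-Miranda theorem is proved analytically. The integral of a polynomial pulled back by `x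
+ t h(x)` is a polynomial in `t` that is constant for small `t`, hence also at `t = 1`. If `x +
h(x)` had no zero, high powers of a bump centred at the origin would contradict this. -/

noncomputable section

/-! ### The Poincaré-Miranda theorem -/

section PoincareMiranda

variable {ι : Type*} [Fintype ι]

/-- The determinant of `1 + t A` is a polynomial in `t`. -/
theorem exists_polynomial_eval_det (A : (ι → ℝ) →L[ℝ] (ι → ℝ)) :
    ∃ P : Polynomial ℝ, P.natDegree ≤ Fintype.card ι ∧
      ∀ t : ℝ, P.eval t = (1 + t • A : (ι → ℝ) →L[ℝ] (ι → ℝ)).det := by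
  classical
  set M := LinearMap.toMatrix' (A : (ι → ℝ) →ₗ[ℝ] (ι → ℝ))
  refine ⟨(Polynomial.X • M.map Polynomial.C + (1 : Matrix ι ι ℝ).map Polynomial.C).det,
    Polynomial.natDegree_det_X_add_C_le _ _, fun t => ?_⟩
  rw [← Polynomial.coe_evalRingHom, RingHom.map_det, ContinuousLinearMap.det,
    ← LinearMap.det_toMatrix']
  congr 1
  ext i j
  by_cases h : i = j <;>
    simp [h, M, LinearMap.toMatrix'_apply] <;> ring

/-- The square of the Euclidean norm. -/
def sqNorm (y : ι → ℝ) : ℝ := ∑ i, y i ^ 2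

theorem continuous_sqNorm : Continuous (sqNorm : (ι → ℝ) → ℝ) := by
  unfold sqNorm; fun_prop

theorem sqNorm_nonneg (y : ι → ℝ) : 0 ≤ sqNorm y := Finset.sum_nonneg fun _ _ => sq_nonneg _

theorem sqNorm_pos {y : ι → ℝ} (hy : y ≠ 0) : 0 < sqNorm y := by
  obtain ⟨i, hi⟩ := Function.ne_iff.1 hy
  exact Finset.sum_pos' (fun _ _ => sq_nonneg _) ⟨i, Finset.mem_univ _, by
    have : y i ≠ 0 := hi
    positivity⟩

theorem exists_polynomial_eval_sqNorm (x v : ι → ℝ) :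
    ∃ P : Polynomial ℝ, P.natDegree ≤ 2 ∧ ∀ t : ℝ, P.eval t = sqNorm (x + t • v) := by
  refine ⟨∑ i, (Polynomial.C (x i) + Polynomial.C (v i) * Polynomial.X) ^ 2, ?_, fun t => ?_⟩
  · refine Polynomial.natDegree_sum_le_of_forall_le _ _ fun i _ => ?_
    compute_degree
  · simp only [sqNorm, Polynomial.eval_finsetSum, Polynomial.eval_pow, Polynomial.eval_add,
      Polynomial.eval_mul, Polynomial.eval_C, Polynomial.eval_X, Pi.add_apply, Pi.smul_apply,
      smul_eq_mul, mul_comm]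

/-- The degree bound does not depend on `x`, so a single interpolation formula in `t` serves all
points and can be integrated over `x`. -/
theorem exists_polynomial_eval_integrand (R : ℝ) (N : ℕ) (x v : ι → ℝ)
    (A : (ι → ℝ) →L[ℝ] (ι → ℝ)) :
    ∃ P : Polynomial ℝ, P.natDegree ≤ N * 2 + Fintype.card ι ∧ ∀ t : ℝ, P.eval t =
      (1 - sqNorm (x + t • v) / R) ^ N * (1 + t • A : (ι → ℝ) →L[ℝ] (ι → ℝ)).det := by
  obtain ⟨P, hP, hP'⟩ := exists_polynomial_eval_det A
  obtain ⟨Q, hQ, hQ'⟩ := exists_polynomial_eval_sqNorm x v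
  refine ⟨(1 - Q * Polynomial.C R⁻¹) ^ N * P, ?_, fun t => by simp [hP', hQ', div_eq_mul_inv]⟩
  refine Polynomial.natDegree_mul_le.trans (add_le_add ?_ hP)
  refine Polynomial.natDegree_pow_le.trans (Nat.mul_le_mul_left _ ?_)
  refine (Polynomial.natDegree_sub_le _ _).trans (max_le (by simp) ?_)
  exact (Polynomial.natDegree_mul_C_le _ _).trans hQ

/-- A small perturbation of the identity preserves integrals over a ball that contains the support
of the perturbation. -/
theorem exists_forall_setIntegral_comp_mul_det {h : (ι → ℝ) → (ι → ℝ)} (hd : ContDiff ℝ 1 h)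
    (hs : HasCompactSupport h) {r : ℝ} (hr : tsupport h ⊆ Metric.closedBall 0 r) :
    ∃ t₀ > 0, ∀ t : ℝ, |t| < t₀ → ∀ g : (ι → ℝ) → ℝ,
      ∫ x in Metric.closedBall 0 r,
        g (x + t • h x) * (1 + t • fderiv ℝ h x : (ι → ℝ) →L[ℝ] (ι → ℝ)).det
        = ∫ x in Metric.closedBall 0 r, g x := by
  obtain ⟨L, hL⟩ := hd.lipschitzWith_of_hasCompactSupport hs one_ne_zero
  -- Positivity of the determinant near the identity removes the absolute value from the change of
  -- variables formula.
  obtain ⟨ε, hε, hdet⟩ : ∃ ε > 0, ∀ A : (ι → ℝ) →L[ℝ] (ι → ℝ), dist A 1 < ε → 0 < A.det := by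
    have : ∀ᶠ A : (ι → ℝ) →L[ℝ] (ι → ℝ) in 𝓝 1, 0 < A.det := by
      refine ContinuousLinearMap.continuous_det.continuousAt.eventually_const_lt ?_
      simp [ContinuousLinearMap.det]
    exact Metric.eventually_nhds_iff.1 this
  refine ⟨min (1 / 2) ε / (L + 1), by positivity, fun t ht g => ?_⟩
  have htL : |t| * (L + 1) < min (1 / 2) ε := (lt_div_iff₀ (by positivity)).1 ht
  have htL' : |t| * L ≤ |t| * (L + 1) := by gcongr; linarith
  set c : NNReal := ‖t‖₊ * L
  have hc : (c : ℝ) = |t| * L := by simp [c]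
  -- The perturbation `t • h` has Lipschitz constant below `1/2`, so `x + t • h x` is a bijection of
  -- the whole space.
  have happ : ApproximatesLinearOn (fun x => x + t • h x)
      ((ContinuousLinearEquiv.refl ℝ (ι → ℝ) : (ι → ℝ) ≃L[ℝ] (ι → ℝ)) : (ι → ℝ) →L[ℝ] (ι → ℝ))
      univ c := by
    intro x _ y _
    have := hL.norm_sub_le x y
    have e : x + t • h x - (y + t • h y) -
        ((ContinuousLinearEquiv.refl ℝ (ι → ℝ) : (ι → ℝ) ≃L[ℝ] (ι → ℝ)) :
          (ι → ℝ) →L[ℝ] (ι → ℝ)) (x - y) = t • (h x - h y) := by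
      simp only [ContinuousLinearEquiv.coe_refl, ContinuousLinearMap.id_apply, smul_sub]; abel
    rw [e, norm_smul, hc, Real.norm_eq_abs, mul_assoc]
    gcongr
  have hc1 : Subsingleton (ι → ℝ) ∨
      c < ‖((ContinuousLinearEquiv.refl ℝ (ι → ℝ)).symm : (ι → ℝ) →L[ℝ] (ι → ℝ))‖₊⁻¹ := by
    rcases subsingleton_or_nontrivial (ι → ℝ) with h1 | h1
    · exact Or.inl h1
    · right
      rw [← NNReal.coe_lt_coe, hc]
      have : min (1 / 2 : ℝ) ε ≤ 1 / 2 := min_le_left _ _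
      have e : ‖((ContinuousLinearEquiv.refl ℝ (ι → ℝ)).symm : (ι → ℝ) →L[ℝ] (ι → ℝ))‖₊ = 1 := by
        simp only [ContinuousLinearEquiv.refl_symm, ContinuousLinearEquiv.coe_refl]
        exact ContinuousLinearMap.nnnorm_id
      rw [e]; simp; linarith
  set B := Metric.closedBall (0 : ι → ℝ) r
  have hinj : Function.Injective fun x => x + t • h x := (happ.toHomeomorph _ hc1).injective
  have hsurj : Function.Surjective fun x => x + t • h x := happ.surjective hc1
  have hout : ∀ x ∉ B, x + t • h x = x := fun x hx => by
    rw [image_eq_zero_of_notMem_tsupport fun h' => hx (hr h')]; simp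
  -- A bijection that is the identity outside `B` maps `B` onto itself.
  have himage : (fun x => x + t • h x) '' B = B := by
    refine Subset.antisymm ?_ fun y hy => ?_
    · rintro _ ⟨x, hx, rfl⟩
      by_contra hy
      have := hout _ hy
      have := hinj this
      exact hy (by simpa only [this] using hx)
    · obtain ⟨x, hx⟩ := hsurj y
      by_cases hxB : x ∈ B
      · exact ⟨x, hxB, hx⟩
      · simp only [hout x hxB] at hx
        exact absurd (hx ▸ hy) hxB
  have key := integral_image_eq_integral_abs_det_fderiv_smul volume
    (s := B) (f := fun x => x + t • h x) (f' := fun x => 1 + t • fderiv ℝ h x)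
    Metric.isClosed_closedBall.measurableSet
    (fun x _ => by
      have := (hd.differentiable one_ne_zero x).hasFDerivAt
      exact ((hasFDerivAt_id x).add (this.const_smul t)).hasFDerivWithinAt)
    hinj.injOn g
  rw [himage] at key
  rw [key]
  refine integral_congr_ae (Eventually.of_forall fun x => ?_)
  have hpos : 0 < (1 + t • fderiv ℝ h x : (ι → ℝ) →L[ℝ] (ι → ℝ)).det := by
    refine hdet _ ?_
    rw [dist_eq_norm, add_sub_cancel_left, norm_smul, Real.norm_eq_abs]
    have : ‖fderiv ℝ h x‖ ≤ L := norm_fderiv_le_of_lipschitz ℝ hL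
    have : |t| * ‖fderiv ℝ h x‖ ≤ |t| * L := by gcongr
    have := min_le_right (1 / 2 : ℝ) ε
    linarith
  simp only [abs_of_pos hpos, smul_eq_mul]
  ring

/-- By interpolation, the integral identity for small perturbations extends to all of them. -/
theorem setIntegral_pow_mul_det {h : (ι → ℝ) → (ι → ℝ)} (hd : ContDiff ℝ 1 h)
    (hs : HasCompactSupport h) {r : ℝ} (hr : tsupport h ⊆ Metric.closedBall 0 r) (R : ℝ) (N : ℕ) :
    ∫ x in Metric.closedBall 0 r, (1 - sqNorm (x + h x) / R) ^ N *
        (1 + fderiv ℝ h x : (ι → ℝ) →L[ℝ] (ι → ℝ)).det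
      = ∫ x in Metric.closedBall (0 : ι → ℝ) r, (1 - sqNorm x / R) ^ N := by
  obtain ⟨t₀, ht₀, H⟩ := exists_forall_setIntegral_comp_mul_det hd hs hr
  set n := N * 2 + Fintype.card ι + 1
  set s := Finset.range n
  -- The `n` nodes lie in `[0, t₀)`, where the identity is known, and `n` exceeds the degree by one.
  -- The weights `lam` extrapolate from them to `t = 1`.
  set v : ℕ → ℝ := fun j => t₀ * (j / n)
  have hv : ∀ j ∈ s, |v j| < t₀ := fun j hj => by
    have hj' : j < n := Finset.mem_range.1 hj
    have : (j : ℝ) / n < 1 := (div_lt_one (by positivity)).2 (by exact_mod_cast hj')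
    rw [abs_of_nonneg (by positivity)]
    calc t₀ * (j / n) < t₀ * 1 := by gcongr
      _ = t₀ := mul_one _
  have hvi : InjOn v s := by
    intro i _ j _ hij
    have h1 : (i : ℝ) / n = j / n := mul_left_cancel₀ ht₀.ne' hij
    have hn : (n : ℝ) ≠ 0 := by positivity
    have := (div_left_inj' hn).1 h1
    exact_mod_cast this
  set lam : ℕ → ℝ := fun j => (Lagrange.basis s v j).eval 1
  have interp : ∀ P : Polynomial ℝ, P.natDegree ≤ N * 2 + Fintype.card ι →
      P.eval 1 = ∑ j ∈ s, P.eval (v j) * lam j := fun P hP => by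
    conv_lhs => rw [Lagrange.eq_interpolate (f := P) hvi (by
      refine (Polynomial.degree_le_natDegree).trans_lt ?_
      have h1 : P.natDegree < n := Nat.lt_succ_of_le hP
      simpa [s] using h1)]
    simp [Lagrange.interpolate_apply, Polynomial.eval_finsetSum, lam]
  have hlam : ∑ j ∈ s, lam j = 1 := by simpa using (interp 1 (by simp)).symm
  set F : ℝ → (ι → ℝ) → ℝ := fun t x => (1 - sqNorm (x + t • h x) / R) ^ N *
    (1 + t • fderiv ℝ h x : (ι → ℝ) →L[ℝ] (ι → ℝ)).det
  have hF : ∀ x, F 1 x = ∑ j ∈ s, F (v j) x * lam j := fun x => by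
    obtain ⟨P, hP, hP'⟩ := exists_polynomial_eval_integrand R N x (h x) (fderiv ℝ h x)
    simp only [F, ← hP']
    exact interp P hP
  have hFc : ∀ t, Continuous (F t) := fun t => by
    have h1 : Continuous fun x => fderiv ℝ h x := hd.continuous_fderiv one_ne_zero
    have h2 := hd.continuous
    refine ((continuous_const.sub ((continuous_sqNorm.comp
      (continuous_id.add (h2.const_smul t))).div_const R)).pow N).mul ?_
    exact ContinuousLinearMap.continuous_det.comp (continuous_const.add (h1.const_smul t))
  have hFi : ∀ t, IntegrableOn (F t) (Metric.closedBall 0 r) := fun t =>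
    (hFc t).continuousOn.integrableOn_compact (isCompact_closedBall _ _)
  calc _ = ∫ x in Metric.closedBall 0 r, F 1 x := by simp only [F, one_smul]
    _ = ∫ x in Metric.closedBall 0 r, ∑ j ∈ s, F (v j) x * lam j := by simp only [hF]
    _ = ∑ j ∈ s, (∫ x in Metric.closedBall 0 r, F (v j) x) * lam j := by
        rw [integral_finsetSum _ fun j _ => (hFi (v j)).mul_const _]
        simp only [integral_mul_const]
    _ = ∑ j ∈ s, (∫ x in Metric.closedBall 0 r, (1 - sqNorm x / R) ^ N) * lam j :=
        Finset.sum_congr rfl fun j hj => by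
          rw [H (v j) (hv j hj) fun y => (1 - sqNorm y / R) ^ N]
    _ = _ := by rw [← Finset.mul_sum, hlam, mul_one]

/-- A `C¹` compactly supported perturbation of the identity has a zero. -/
theorem exists_add_eq_zero_of_contDiff {h : (ι → ℝ) → (ι → ℝ)} (hd : ContDiff ℝ 1 h)
    (hs : HasCompactSupport h) : ∃ x, x + h x = 0 := by
  by_contra! hne
  obtain ⟨r, hr0, hr⟩ : ∃ r : ℝ, 0 < r ∧ tsupport h ⊆ Metric.closedBall 0 r := by
    obtain ⟨r, hr⟩ := hs.isCompact.isBounded.subset_closedBall 0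
    exact ⟨max r 1, by positivity, hr.trans (Metric.closedBall_subset_closedBall (le_max_left _ _))⟩
  set B := Metric.closedBall (0 : ι → ℝ) r
  have hBc : IsCompact B := isCompact_closedBall _ _
  have hB0 : (0 : ι → ℝ) ∈ B := Metric.mem_closedBall_self hr0.le
  have hc1 : Continuous fun x => sqNorm (x + h x) :=
    continuous_sqNorm.comp (continuous_id.add hd.continuous)
  obtain ⟨x₀, -, hx₀⟩ := hBc.exists_isMinOn ⟨0, hB0⟩ hc1.continuousOn
  obtain ⟨x₁, -, hx₁⟩ := hBc.exists_isMaxOn ⟨0, hB0⟩ hc1.continuousOn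
  obtain ⟨x₂, -, hx₂⟩ := hBc.exists_isMaxOn ⟨0, hB0⟩ continuous_sqNorm.continuousOn
  set δ := sqNorm (x₀ + h x₀)
  have hδ : 0 < δ := sqNorm_pos (hne x₀)
  -- With this `R` both `1 - |x + h x|² / R` and `1 - |x|² / R` are nonnegative on `B`.
  set R := max (sqNorm (x₁ + h x₁)) (sqNorm x₂) + δ
  have hRδ : δ ≤ R := by
    have := (sqNorm_nonneg (x₂)).trans (le_max_right (sqNorm (x₁ + h x₁)) (sqNorm x₂))
    simp only [R]; linarith
  have hR : 0 < R := hδ.trans_le hRδ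
  have hxR : ∀ x ∈ B, sqNorm (x + h x) ≤ R := fun x hx => by
    have h1 : sqNorm (x + h x) ≤ sqNorm (x₁ + h x₁) := hx₁ hx
    have := h1.trans (le_max_left _ (sqNorm x₂))
    simp only [R]; linarith
  have hxR' : ∀ x ∈ B, sqNorm x ≤ R := fun x hx => by
    have h1 : sqNorm x ≤ sqNorm x₂ := hx₂ hx
    have := h1.trans (le_max_right (sqNorm (x₁ + h x₁)) _)
    simp only [R]; linarith
  have hxδ : ∀ x ∈ B, δ ≤ sqNorm (x + h x) := fun x hx => hx₀ hx
  set D : (ι → ℝ) → ℝ := fun x => (1 + fderiv ℝ h x : (ι → ℝ) →L[ℝ] (ι → ℝ)).det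
  have hDc : Continuous D :=
    ContinuousLinearMap.continuous_det.comp
      (continuous_const.add (hd.continuous_fderiv one_ne_zero))
  set C := ∫ x in B, |D x|
  -- `lo` bounds the base of the power in the pulled-back integral from above, since `|x + h x|² ≥
  -- δ`. `hi` bounds the base in the other integral from below on the neighbourhood `V` of the
  -- origin. As `lo < hi`, the two integrals cannot agree for large `N`.
  set lo := 1 - δ / R
  set hi := 1 - δ / 2 / R
  have hlo : 0 ≤ lo := by
    have : δ / R ≤ 1 := (div_le_one hR).2 hRδ
    simp only [lo]; linarith
  have hlohi : lo < hi := by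
    have : δ / 2 / R < δ / R := by gcongr; linarith
    simp only [lo, hi]; linarith
  have hhi : 0 < hi := hlo.trans_lt hlohi
  set V := B ∩ {y | sqNorm y ≤ δ / 2}
  have hVm : MeasurableSet V := Metric.isClosed_closedBall.measurableSet.inter
    (isClosed_le continuous_sqNorm continuous_const).measurableSet
  have hVfin : volume V ≠ ⊤ := ((measure_mono inter_subset_left).trans_lt hBc.measure_lt_top).ne
  have hVpos : 0 < volume.real V := by
    refine ENNReal.toReal_pos ?_ hVfin
    refine (Measure.measure_pos_of_mem_nhds volume (x := 0) ?_).ne'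
    refine inter_mem (Metric.closedBall_mem_nhds _ hr0) ?_
    refine (continuous_sqNorm.continuousAt.eventually_lt_const
      (?_ : sqNorm (0 : ι → ℝ) < δ / 2)).mono fun _ => le_of_lt
    simpa [sqNorm] using hδ
  have key : ∀ N : ℕ, volume.real V * hi ^ N ≤ C * lo ^ N := fun N => by
    have e := setIntegral_pow_mul_det hd hs hr R N
    have hqc : Continuous fun x : ι → ℝ => (1 - sqNorm x / R) ^ N :=
      (continuous_const.sub (continuous_sqNorm.div_const R)).pow N
    have hq0 : ∀ x ∈ B, 0 ≤ 1 - sqNorm x / R := fun x hx => by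
      have : sqNorm x / R ≤ 1 := (div_le_one hR).2 (hxR' x hx)
      linarith
    calc volume.real V * hi ^ N = ∫ _ in V, hi ^ N := by simp [mul_comm]
      _ ≤ ∫ x in V, (1 - sqNorm x / R) ^ N := by
          refine setIntegral_mono_on (integrableOn_const hVfin)
            ((hqc.continuousOn.integrableOn_compact hBc).mono_set inter_subset_left) hVm
            fun x hx => ?_
          have : sqNorm x / R ≤ δ / 2 / R := by have := hx.2; gcongr; exact this
          refine pow_le_pow_left₀ hhi.le ?_ N
          simp only [hi]; linarith
      _ ≤ ∫ x in B, (1 - sqNorm x / R) ^ N := by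
          refine setIntegral_mono_set (hqc.continuousOn.integrableOn_compact hBc) ?_
            inter_subset_left.eventuallyLE
          filter_upwards [ae_restrict_mem Metric.isClosed_closedBall.measurableSet] with x hx
          exact pow_nonneg (hq0 x hx) N
      _ = ∫ x in B, (1 - sqNorm (x + h x) / R) ^ N * D x := e.symm
      _ ≤ ∫ x in B, |D x| * lo ^ N := by
          refine setIntegral_mono_on ?_ ?_ Metric.isClosed_closedBall.measurableSet fun x hx => ?_
          · exact (Continuous.continuousOn (((continuous_const.sub
              (hc1.div_const R)).pow N).mul hDc)).integrableOn_compact hBc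
          · exact (hDc.abs.mul continuous_const).continuousOn.integrableOn_compact hBc
          · have h0 : sqNorm (x + h x) / R ≤ 1 := (div_le_one hR).2 (hxR x hx)
            have h1 : δ / R ≤ sqNorm (x + h x) / R := by have := hxδ x hx; gcongr
            have h2 : (1 - sqNorm (x + h x) / R) ^ N ≤ lo ^ N :=
              pow_le_pow_left₀ (by linarith) (by simp only [lo]; linarith) N
            have h3 : 0 ≤ (1 - sqNorm (x + h x) / R) ^ N := pow_nonneg (by linarith) N
            calc _ ≤ (1 - sqNorm (x + h x) / R) ^ N * |D x| := by gcongr; exact le_abs_self _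
              _ ≤ lo ^ N * |D x| := by gcongr
              _ = _ := mul_comm _ _
      _ = C * lo ^ N := by rw [integral_mul_const]
  have hlim : Tendsto (fun N : ℕ => C * (lo / hi) ^ N) atTop (𝓝 (C * 0)) :=
    (tendsto_pow_atTop_nhds_zero_of_lt_one (by positivity) ((div_lt_one hhi).2 hlohi)).const_mul C
  rw [mul_zero] at hlim
  obtain ⟨N, hN⟩ := (hlim.eventually_lt_const hVpos).exists
  have hp : 0 < hi ^ N := pow_pos hhi N
  have := key N
  rw [div_pow, ← mul_div_assoc, div_lt_iff₀ hp] at hN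
  linarith

/-- Smooth approximations supported inside the support of `h` have zeros in one fixed compact set,
and a limit point of these is the required zero. The point `0` is added to that set because an
approximation vanishes off the support, where the only possible zero is the origin. -/
theorem exists_add_eq_zero_of_continuous {h : (ι → ℝ) → (ι → ℝ)} (hc : Continuous h)
    (hs : HasCompactSupport h) : ∃ x, x + h x = 0 := by
  have approx : ∀ n : ℕ, ∃ x ∈ insert 0 (tsupport h), ‖x + h x‖ ≤ 1 / ((n : ℝ) + 1) := fun n => by
    obtain ⟨g, hg, hgh, hsupp⟩ := hc.exists_contDiff_approx (ε := fun _ => 1 / ((n : ℝ) + 1)) 1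
      continuous_const (fun _ => by positivity)
    obtain ⟨x, hx⟩ := exists_add_eq_zero_of_contDiff hg (hs.mono hsupp)
    refine ⟨x, ?_, ?_⟩
    · by_cases h0 : x ∈ tsupport h
      · exact Or.inr h0
      · left
        have : g x = 0 := by
          by_contra h1
          exact h0 (subset_tsupport h (hsupp h1))
        simpa [this] using hx
    · have := (hgh x).le
      rw [dist_comm, dist_eq_norm] at this
      have e : x + h x = h x - g x := by
        rw [eq_sub_iff_add_eq, add_right_comm, hx, zero_add]
      rwa [e]
  have hcomp : IsCompact (insert 0 (tsupport h)) := hs.isCompact.insert 0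
  choose x hx hx' using approx
  obtain ⟨a, -, φ, hφ, hlim⟩ := hcomp.tendsto_subseq hx
  refine ⟨a, ?_⟩
  have h1 : Tendsto (fun n => x (φ n) + h (x (φ n))) atTop (𝓝 (a + h a)) :=
    hlim.add ((hc.tendsto a).comp hlim)
  have h2 : Tendsto (fun n => x (φ n) + h (x (φ n))) atTop (𝓝 0) :=
    squeeze_zero_norm (fun n => hx' (φ n))
      (tendsto_one_div_add_atTop_nhds_zero_nat.comp hφ.tendsto_atTop)
  exact tendsto_nhds_unique h1 h2

/-- **Poincaré-Miranda theorem**. -/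
theorem exists_eq_zero_of_box {l u : ι → ℝ} (hlu : ∀ i, l i ≤ u i) {F : (ι → ℝ) → ι → ℝ}
    (hF : ContinuousOn F (Icc l u)) (hl : ∀ x ∈ Icc l u, ∀ i, x i = l i → F x i ≤ 0)
    (hu : ∀ x ∈ Icc l u, ∀ i, x i = u i → 0 ≤ F x i) : ∃ x ∈ Icc l u, F x = 0 := by
  set clip : (ι → ℝ) → (ι → ℝ) := fun x i => max (l i) (min (u i) (x i))
  have hclip : Continuous clip := by unfold clip; fun_prop
  have hclipm : ∀ x, clip x ∈ Icc l u := fun x =>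
    ⟨fun i => le_max_left _ _, fun i => max_le (hlu i) (min_le_left _ _)⟩
  have hclipid : ∀ x ∈ Icc l u, clip x = x := fun x hx => funext fun i => by
    simp only [clip]; rw [min_eq_right (hx.2 i), max_eq_right (hx.1 i)]
  -- The zeros of `F` are sought as fixed points of the step `x - F x` followed by the projection to
  -- the box.
  set G : (ι → ℝ) → (ι → ℝ) := fun x => clip (clip x - F (clip x))
  have hG : Continuous G :=
    hclip.comp (hclip.sub (hF.comp_continuous hclip hclipm))
  have hcI : IsCompact (Icc l u) := isCompact_Icc
  obtain ⟨r, hr⟩ := hcI.isBounded.subset_closedBall 0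
  set χ : (ι → ℝ) → ℝ := fun x => max 0 (r + 1 - ‖x‖)
  have hχ : Continuous χ := by unfold χ; fun_prop
  -- a point with `x = c • G x`, where `c = 1` for `‖x‖ ≤ r` and `c = 0` far away
  obtain ⟨x, hx⟩ := exists_add_eq_zero_of_continuous (h := fun x => -(min 1 (χ x) • G x))
    (by fun_prop) (by
      refine HasCompactSupport.intro (isCompact_closedBall 0 (r + 1)) fun x hx => ?_
      have : χ x = 0 := max_eq_left (by
        have : r + 1 < ‖x‖ := by simpa using hx
        linarith)
      simp [this])
  have hxG : x = min 1 (χ x) • G x := by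
    have := eq_neg_of_add_eq_zero_left hx
    simpa using this
  have hGr : ‖G x‖ ≤ r := by simpa using hr (hclipm _)
  have hxr : ‖x‖ ≤ r := by
    have h0 : 0 ≤ min 1 (χ x) := le_min zero_le_one (le_max_left _ _)
    calc ‖x‖ = min 1 (χ x) * ‖G x‖ := by
          conv_lhs => rw [hxG]
          rw [norm_smul, Real.norm_eq_abs, abs_of_nonneg h0]
      _ ≤ 1 * ‖G x‖ := by gcongr; exact min_le_left _ _
      _ ≤ r := by simpa using hGr
  have hχ1 : min 1 (χ x) = 1 :=
    min_eq_left ((by linarith : (1 : ℝ) ≤ r + 1 - ‖x‖).trans (le_max_right _ _))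
  rw [hχ1, one_smul] at hxG
  have hxI : x ∈ Icc l u := hxG ▸ hclipm _
  refine ⟨x, hxI, funext fun i => ?_⟩
  have hi : x i = max (l i) (min (u i) (x i - F x i)) := by
    have := congrFun hxG i
    simp only [G, hclipid x hxI] at this
    exact this
  have h1 := hxI.1 i
  have h2 := hxI.2 i
  have h3 := hl x hxI i
  have h4 := hu x hxI i
  simp only [Pi.zero_apply]
  -- A nonzero `F x i` would move the coordinate: the sign conditions exclude the face towards which
  -- the step `-F x i` points, so the projection cannot undo it completely.
  rcases lt_trichotomy (F x i) 0 with h | h | h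
  · have : x i < u i := by
      rcases h2.lt_or_eq with h' | h'
      · exact h'
      · linarith [h4 h']
    have : x i < min (u i) (x i - F x i) := lt_min this (by linarith)
    have := this.trans_le (le_max_right (l i) _)
    linarith
  · exact h
  · have : l i < x i := by
      rcases h1.lt_or_eq with h' | h'
      · exact h'
      · linarith [h3 h'.symm]
    have : max (l i) (min (u i) (x i - F x i)) < x i :=
      max_lt this ((min_le_right _ _).trans_lt (by linarith))
    linarith

end PoincareMiranda

/-! ### From periodic itineraries to a topological horseshoe -/

section SymbolicDynamics

variable {X : Type*} {n : ℕ}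

/-- The full orbits of `φ` that stay in the union of the sets `K j`. -/
def orbitSpace (φ : X → X) (K : Fin n → Set X) : Set (ℤ → X) :=
  {w | ∀ i, w i ∈ ⋃ j, K j ∧ w (i + 1) = φ (w i)}

/-- The future of an orbit is determined by `φ`, its past by the injectivity of `φ` on the union. -/
theorem injOn_eval_zero_orbitSpace {φ : X → X} {K : Fin n → Set X}
    (hinj : InjOn φ (⋃ j, K j)) : InjOn (fun w : ℤ → X => w 0) (orbitSpace φ K) := by
  intro w hw w' hw' h0
  funext i
  induction i with
  | zero => exact h0
  | succ i ih => rw [(hw _).2, (hw' _).2, ih]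
  | pred i ih =>
    refine hinj (hw _).1 (hw' _).1 ?_
    rw [← (hw _).2, ← (hw' _).2]
    simpa using ih

/-- The shift on two-sided sequences. -/
def shiftHomeomorph (X : Type*) [TopologicalSpace X] : (ℤ → X) ≃ₜ (ℤ → X) where
  toFun w i := w (i + 1)
  invFun w i := w (i - 1)
  left_inv w := by funext i; simp
  right_inv w := by funext i; simp
  continuous_toFun := by fun_prop
  continuous_invFun := by fun_prop

/-- The periodic elements of `orbitSpace`. -/
def periodicOrbits (φ : X → X) (K : Fin n → Set X) : Set (ℤ → X) :=
  {w | w ∈ orbitSpace φ K ∧ ∃ l : ℕ, 1 ≤ l ∧ ∀ i, w (i + l) = w i}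

theorem orbitSpace_iterate {φ : X → X} {K : Fin n → Set X} {w : ℤ → X} (hw : w ∈ orbitSpace φ K)
    (l : ℕ) : φ^[l] (w 0) = w l := by
  induction l with
  | zero => rfl
  | succ l ih => rw [Function.iterate_succ_apply', ih, ← (hw l).2]; norm_cast

variable [TopologicalSpace X] [T2Space X]

/-- Being an orbit means that consecutive entries lie on the graph of `φ`, a closed condition in a
product of compact sets. Assuming compact graphs, not continuity of `φ`, fits the Poincaré map,
whose graph over `K j` is parametrized explicitly; continuous dependence on initial data is then not
needed. -/
theorem isCompact_orbitSpace {φ : X → X} {K : Fin n → Set X} (hK : ∀ j, IsCompact (K j))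
    (hG : ∀ j, IsCompact ((fun z => (z, φ z)) '' K j)) : IsCompact (orbitSpace φ K) := by
  have hU : IsCompact (⋃ j, K j) := isCompact_iUnion hK
  have hGU : IsClosed (⋃ j, (fun z => (z, φ z)) '' K j) := (isCompact_iUnion hG).isClosed
  have e : orbitSpace φ K = ⋂ i : ℤ, (fun w : ℤ → X => (w i, w (i + 1))) ⁻¹'
      (⋃ j, (fun z => (z, φ z)) '' K j) := by
    ext w
    simp only [orbitSpace, mem_ofPred_eq, mem_iInter, mem_preimage, mem_iUnion, mem_image,
      Prod.mk.injEq]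
    refine forall_congr' fun i => ⟨?_, ?_⟩
    · rintro ⟨⟨j, hj⟩, h⟩
      exact ⟨j, w i, hj, rfl, h.symm⟩
    · rintro ⟨j, z, hz, rfl, h⟩
      exact ⟨⟨j, hz⟩, h.symm⟩
  refine (isCompact_univ_pi fun _ : ℤ => hU).of_isClosed_subset ?_ fun w hw i _ => (hw i).1
  rw [e]
  exact isClosed_iInter fun i => hGU.preimage (by fun_prop)

/-- Let `Z` be the closure of the periodic orbits in the sequence space. The itinerary is continuous
on `Z`, because the `K j` are disjoint and closed, so its image is compact; it contains the dense
set of periodic sequences and is therefore everything. Evaluation at `0` is continuous and injective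
on the compact `Z`, hence a homeomorphism onto its image `Λ`, and it carries the shift to `φ`.
Taking the closure of periodic orbits, not all orbits, is what makes periodic points dense in `Λ`.
-/
theorem exists_horseshoe_of_periodic (hn : 0 < n) {φ : X → X} {K : Fin n → Set X}
    (hK : ∀ j, IsCompact (K j)) (hdisj : ∀ i j, i ≠ j → Disjoint (K i) (K j))
    (hG : ∀ j, IsCompact ((fun z => (z, φ z)) '' K j)) (hinj : InjOn φ (⋃ j, K j))
    (hper : ∀ s : ℤ → Fin n, ∀ l : ℕ, 1 ≤ l → (∀ i, s (i + l) = s i) →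
      ∃ w : ℤ → X, (∀ i, w i ∈ K (s i) ∧ w (i + 1) = φ (w i)) ∧ ∀ i, w (i + l) = w i) :
    (∀ s : ℤ → Fin n, ∃ w : ℤ → X, ∀ i, w i ∈ K (s i) ∧ w (i + 1) = φ (w i)) ∧
    ∃ (Λ : Set X) (π : X → ℤ → Fin n),
      IsCompact Λ ∧ Λ ⊆ ⋃ j, K j ∧ φ '' Λ = Λ ∧
      Λ ⊆ closure {w ∈ Λ | ∃ l : ℕ, 1 ≤ l ∧ Function.IsPeriodicPt φ l w} ∧
      ContinuousOn π Λ ∧ SurjOn π Λ univ ∧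
      (∀ w ∈ Λ, ∀ i, π (φ w) i = π w (i + 1)) ∧
      (∀ s : ℤ → Fin n, ∀ l : ℕ, 1 ≤ l → (∀ i, s (i + l) = s i) →
        ∃ w ∈ Λ, Function.IsPeriodicPt φ l w ∧ π w = s) := by
  classical
  set idx : X → Fin n := fun z => if h : ∃ j, z ∈ K j then h.choose else ⟨0, hn⟩
  have hidx : ∀ j, ∀ z ∈ K j, idx z = j := fun j z hz => by
    have h : ∃ j, z ∈ K j := ⟨j, hz⟩
    simp only [idx, dif_pos h]
    by_contra hne
    exact disjoint_left.1 (hdisj _ _ hne) h.choose_spec hz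
  have hidx' : ∀ z ∈ ⋃ j, K j, z ∈ K (idx z) := fun z hz => by
    obtain ⟨j, hj⟩ := mem_iUnion.1 hz
    rwa [hidx j z hj]
  have hidxc : ContinuousOn idx (⋃ j, K j) :=
    (locallyFinite_of_finite K).continuousOn_iUnion (fun j => (hK j).isClosed) fun j =>
      continuousOn_const.congr (hidx j)
  set Y := orbitSpace φ K
  have hYc : IsCompact Y := isCompact_orbitSpace hK hG
  set itin : (ℤ → X) → ℤ → Fin n := fun w i => idx (w i)
  have hitin : ContinuousOn itin Y := continuousOn_pi.2 fun i =>
    hidxc.comp (continuous_apply i).continuousOn fun w hw => (hw i).1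
  set P := periodicOrbits φ K
  have hPY : P ⊆ Y := fun w hw => hw.1
  set Z := closure P
  have hZY : Z ⊆ Y := closure_minimal hPY hYc.isClosed
  have hZc : IsCompact Z := hYc.of_isClosed_subset isClosed_closure hZY
  have hperP : ∀ s : ℤ → Fin n, ∀ l : ℕ, 1 ≤ l → (∀ i, s (i + l) = s i) →
      ∃ w ∈ P, itin w = s ∧ ∀ i, w (i + l) = w i := fun s l hl hs => by
    obtain ⟨w, hw, hwl⟩ := hper s l hl hs
    exact ⟨w, ⟨fun i => ⟨mem_iUnion.2 ⟨_, (hw i).1⟩, (hw i).2⟩, l, hl, hwl⟩,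
      funext fun i => hidx _ _ (hw i).1, hwl⟩
  have hsurj : ∀ s : ℤ → Fin n, ∃ w ∈ Z, itin w = s := fun s => by
    have hcl : IsClosed (itin '' Z) := (hZc.image_of_continuousOn (hitin.mono hZY)).isClosed
    -- The sequence of period `2N + 1` that agrees with `s` on `[-N, N]`.
    set u : ℕ → ℤ → Fin n := fun N i => s ((i + N) % ((2 * N + 1 : ℕ) : ℤ) - N)
    have hu : ∀ N, u N ∈ itin '' Z := fun N => by
      obtain ⟨w, hw, hws, -⟩ := hperP (u N) (2 * N + 1) (by omega) fun i => by
        simp only [u]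
        rw [add_right_comm, Int.add_emod_right]
      exact ⟨w, subset_closure hw, hws⟩
    change s ∈ itin '' Z
    refine hcl.mem_of_tendsto (f := u) (b := atTop) (tendsto_pi_nhds.2 fun i => ?_)
      (Eventually.of_forall hu)
    refine tendsto_const_nhds.congr' ?_
    filter_upwards [eventually_ge_atTop i.natAbs] with N hN
    simp only [u]
    rw [Int.emod_eq_of_lt (by omega) (by push_cast; omega)]
    congr 1
    omega
  have hshiftP : shiftHomeomorph X '' P = P := by
    ext w
    constructor
    · rintro ⟨w, ⟨hw, l, hl, hwl⟩, rfl⟩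
      refine ⟨fun i => hw (i + 1), l, hl, fun i => ?_⟩
      change w (i + l + 1) = w (i + 1)
      rw [add_right_comm, hwl]
    · rintro ⟨hw, l, hl, hwl⟩
      refine ⟨(shiftHomeomorph X).symm w, ⟨fun i => ⟨(hw (i - 1)).1, ?_⟩, l, hl, fun i => ?_⟩,
        (shiftHomeomorph X).apply_symm_apply w⟩
      · have := (hw (i - 1)).2
        rwa [show i - 1 + 1 = i + 1 - 1 by ring] at this
      · change w (i + l - 1) = w (i - 1)
        rw [add_sub_right_comm, hwl]
  have hshiftZ : shiftHomeomorph X '' Z = Z := by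
    rw [(shiftHomeomorph X).image_closure, hshiftP]
  set ev : (ℤ → X) → X := fun w => w 0
  have hev : Continuous ev := continuous_apply 0
  have hevinj : InjOn ev Z := (injOn_eval_zero_orbitSpace hinj).mono hZY
  have : CompactSpace Z := isCompact_iff_compactSpace.1 hZc
  set e : Z ≃ₜ ev '' Z := Continuous.homeoOfEquivCompactToT2
    (f := Equiv.Set.imageOfInjOn ev Z hevinj)
    (Continuous.subtype_mk (hev.comp continuous_subtype_val) _)
  have he : ∀ w (hw : w ∈ Z), e.symm ⟨ev w, mem_image_of_mem ev hw⟩ = ⟨w, hw⟩ := fun w hw => by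
    rw [Homeomorph.symm_apply_eq]; rfl
  set π : X → ℤ → Fin n := fun z => if h : z ∈ ev '' Z then itin (e.symm ⟨z, h⟩) else
    fun _ => ⟨0, hn⟩
  have hπ : ∀ w ∈ Z, π (ev w) = itin w := fun w hw => by
    simp only [π, dif_pos (mem_image_of_mem ev hw), he w hw]
  have hφev : ∀ w ∈ Y, φ (ev w) = ev (shiftHomeomorph X w) := fun w hw => ((hw 0).2).symm
  have hPper : ∀ w ∈ P, ∀ l : ℕ, (∀ i, w (i + l) = w i) → Function.IsPeriodicPt φ l (ev w) :=
    fun w hw l hl => by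
      have h1 := orbitSpace_iterate (hPY hw) l
      have h2 := hl 0
      rw [zero_add] at h2
      rw [Function.IsPeriodicPt, Function.IsFixedPt]
      exact h1.trans h2
  refine ⟨fun s => ?_, ev '' Z, π, hZc.image hev, ?_, ?_, ?_, ?_, ?_, ?_, ?_⟩
  · obtain ⟨w, hw, rfl⟩ := hsurj s
    exact ⟨w, fun i => ⟨hidx' _ (hZY hw i).1, (hZY hw i).2⟩⟩
  · rintro _ ⟨w, hw, rfl⟩
    exact (hZY hw 0).1
  · conv_rhs => rw [← hshiftZ]
    rw [image_image, image_image]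
    exact image_congr fun w hw => hφev w (hZY hw)
  · refine (image_closure_subset_closure_image hev).trans (closure_mono ?_)
    rintro _ ⟨w, hw, rfl⟩
    obtain ⟨-, l, hl, hwl⟩ := id hw
    exact ⟨mem_image_of_mem _ (subset_closure hw), l, hl, hPper w hw l hwl⟩
  · rw [continuousOn_iff_continuous_domRestrict]
    have e1 : (ev '' Z).domRestrict π = Z.domRestrict itin ∘ e.symm := by
      funext ⟨z, hz⟩
      simp only [Set.domRestrict_apply, Function.comp_apply, π, dif_pos hz]
    rw [e1]
    exact (continuousOn_iff_continuous_domRestrict.1 (hitin.mono hZY)).comp e.symm.continuous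
  · intro s _
    obtain ⟨w, hw, rfl⟩ := hsurj s
    exact ⟨ev w, mem_image_of_mem _ hw, hπ w hw⟩
  · rintro _ ⟨w, hw, rfl⟩ i
    have hw' : shiftHomeomorph X w ∈ Z := hshiftZ ▸ mem_image_of_mem _ hw
    rw [hφev w (hZY hw), hπ _ hw', hπ w hw]
    rfl
  · intro s l hl hs
    obtain ⟨w, hw, rfl, hwl⟩ := hperP s l hl hs
    exact ⟨ev w, mem_image_of_mem _ (subset_closure hw), hPper w hw l hwl,
      hπ w (subset_closure hw)⟩

end SymbolicDynamics

/-! ### Concatenation and reversal of solutions -/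

/-- Agreement on open intervals suffices, so the values of the forcing at the switching time and at
the final time play no role. -/
theorem intervalIntegral_glue {g g₁ g₂ : ℝ → ℝ} {S₁ S₂ : ℝ} (hS₁ : 0 ≤ S₁)
    (h₁ : ContinuousOn g₁ (Icc 0 S₁)) (h₂ : ContinuousOn g₂ (Icc 0 S₂))
    (e₁ : ∀ t ∈ Ioo 0 S₁, g t = g₁ t) (e₂ : ∀ t ∈ Ioo S₁ (S₁ + S₂), g t = g₂ (t - S₁)) :
    (∀ t ∈ Icc 0 S₁, ∫ s in (0 : ℝ)..t, g s = ∫ s in (0 : ℝ)..t, g₁ s) ∧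
    ∀ t ∈ Icc S₁ (S₁ + S₂), ∫ s in (0 : ℝ)..t, g s =
      (∫ s in (0 : ℝ)..S₁, g₁ s) + ∫ s in (0 : ℝ)..(t - S₁), g₂ s := by
  have H₁ : ∀ t ∈ Icc 0 S₁, ∫ s in (0 : ℝ)..t, g s = ∫ s in (0 : ℝ)..t, g₁ s := fun t ht =>
    intervalIntegral.integral_congr_Ioo_of_le ht.1 fun s hs => e₁ s ⟨hs.1, hs.2.trans_le ht.2⟩
  refine ⟨H₁, fun t ht => ?_⟩
  have i₁ : IntervalIntegrable g volume 0 S₁ :=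
    (h₁.intervalIntegrable_of_Icc hS₁).congr_uIoo fun s hs => by
      rw [uIoo_of_le hS₁] at hs; exact (e₁ s hs).symm
  have h₂' : ContinuousOn (fun s => g₂ (s - S₁)) (Icc S₁ t) :=
    h₂.comp (by fun_prop) fun s hs => ⟨by linarith [hs.1], by linarith [hs.2, ht.2]⟩
  have e₂' : EqOn (fun s => g₂ (s - S₁)) g (Ioo S₁ t) := fun s hs =>
    (e₂ s ⟨hs.1, hs.2.trans_le ht.2⟩).symm
  have i₂ : IntervalIntegrable g volume S₁ t :=
    (h₂'.intervalIntegrable_of_Icc ht.1).congr_uIoo (uIoo_of_le ht.1 ▸ e₂')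
  rw [← intervalIntegral.integral_add_adjacent_intervals i₁ i₂, H₁ S₁ ⟨hS₁, le_rfl⟩,
    ← intervalIntegral.integral_congr_Ioo_of_le ht.1 e₂', intervalIntegral.integral_comp_sub_right,
    sub_self]

theorem IsSolutionOn.concat {f p : ℝ → ℝ} {k₁ k₂ S₁ S₂ : ℝ} {ζ₁ ζ₂ : ℝ → ℝ × ℝ}
    (hf : Continuous f) (hS₁ : 0 ≤ S₁) (hS₂ : 0 ≤ S₂) (h₁ : IsSolutionOn f (fun _ => k₁) S₁ ζ₁)
    (h₂ : IsSolutionOn f (fun _ => k₂) S₂ ζ₂) (h : ζ₁ S₁ = ζ₂ 0)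
    (hp₁ : ∀ t ∈ Ico 0 S₁, p t = k₁) (hp₂ : ∀ t ∈ Ico S₁ (S₁ + S₂), p t = k₂) :
    ∃ ζ, IsSolutionOn f p (S₁ + S₂) ζ ∧ ζ 0 = ζ₁ 0 ∧ ζ (S₁ + S₂) = ζ₂ S₂ := by
  set ζ : ℝ → ℝ × ℝ := fun t => if t ≤ S₁ then ζ₁ t else ζ₂ (t - S₁)
  have hζ₁ : ∀ t ≤ S₁, ζ t = ζ₁ t := fun t ht => if_pos ht
  have hζ₂ : ∀ t, S₁ ≤ t → ζ t = ζ₂ (t - S₁) := fun t ht => by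
    rcases ht.eq_or_lt with rfl | ht
    · rw [hζ₁ _ le_rfl, h, sub_self]
    · exact if_neg ht.not_ge
  have hc : ContinuousOn ζ (Icc 0 (S₁ + S₂)) := by
    rw [← Icc_union_Icc_eq_Icc hS₁ (le_add_of_nonneg_right hS₂)]
    refine ContinuousOn.union_of_isClosed (h₁.1.congr fun t ht => hζ₁ t ht.2) ?_ isClosed_Icc
      isClosed_Icc
    refine ContinuousOn.congr (h₂.1.comp (continuous_sub_right S₁).continuousOn fun t ht =>
      ⟨by linarith [ht.1], by linarith [ht.2]⟩) fun t ht => hζ₂ t ht.1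
  refine ⟨ζ, ⟨hc, ?_⟩, hζ₁ 0 hS₁, by rw [hζ₂ _ (le_add_of_nonneg_right hS₂), add_sub_cancel_left]⟩
  have cy : ∀ {S : ℝ} {χ : ℝ → ℝ × ℝ}, ContinuousOn χ (Icc 0 S) →
      ContinuousOn (fun s => (χ s).2) (Icc 0 S) := fun hχ => continuous_snd.comp_continuousOn hχ
  have cx : ∀ {S k : ℝ} {χ : ℝ → ℝ × ℝ}, ContinuousOn χ (Icc 0 S) →
      ContinuousOn (fun s => -f (χ s).1 + k) (Icc 0 S) := fun hχ =>
    ((hf.comp_continuousOn (continuous_fst.comp_continuousOn hχ)).neg).add continuousOn_const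
  obtain ⟨x₁, x₂⟩ := intervalIntegral_glue (g := fun s => (ζ s).2) hS₁ (cy h₁.1) (cy h₂.1)
    (fun t ht => by rw [hζ₁ t ht.2.le]) (fun t ht => by rw [hζ₂ t ht.1.le])
  obtain ⟨y₁, y₂⟩ := intervalIntegral_glue (g := fun s => -f (ζ s).1 + p s) hS₁
    (cx (k := k₁) h₁.1) (cx (k := k₂) h₂.1)
    (fun t ht => by rw [hζ₁ t ht.2.le, hp₁ t ⟨ht.1.le, ht.2⟩])
    (fun t ht => by rw [hζ₂ t ht.1.le, hp₂ t ⟨ht.1.le, ht.2⟩])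
  intro t ht
  rw [hζ₁ 0 hS₁]
  rcases le_total t S₁ with hle | hle
  · rw [x₁ t ⟨ht.1, hle⟩, y₁ t ⟨ht.1, hle⟩, hζ₁ t hle]
    exact h₁.2 t ⟨ht.1, hle⟩
  · have ht' : t ∈ Icc S₁ (S₁ + S₂) := ⟨hle, ht.2⟩
    obtain ⟨a1, a2⟩ := h₁.2 S₁ ⟨hS₁, le_rfl⟩
    obtain ⟨b1, b2⟩ := h₂.2 (t - S₁) ⟨by linarith, by linarith [ht.2]⟩
    rw [x₂ t ht', y₂ t ht', hζ₂ t hle, b1, b2, ← h, a1, a2, add_assoc, add_assoc]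
    exact ⟨rfl, rfl⟩

/-- The solution of `x' = y`, `y' = -f x + k` that starts at `z` is at `w` at the time `τ`. -/
def Reaches (f : ℝ → ℝ) (k : ℝ) (z w : ℝ × ℝ) (τ : ℝ) : Prop :=
  0 ≤ τ ∧ ∃ ζ, IsSolutionOn f (fun _ => k) τ ζ ∧ ζ 0 = z ∧ ζ τ = w

namespace Reaches

variable {f : ℝ → ℝ} {k τ τ' : ℝ} {z w v : ℝ × ℝ}

theorem trans (hf : Continuous f) (h₁ : Reaches f k z w τ) (h₂ : Reaches f k w v τ') :
    Reaches f k z v (τ + τ') := by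
  obtain ⟨hτ, ζ, hζ, rfl, rfl⟩ := h₁
  obtain ⟨hτ', ξ, hξ, e, rfl⟩ := h₂
  obtain ⟨χ, hχ, h0, h1⟩ := IsSolutionOn.concat (p := fun _ => k) hf hτ hτ' hζ hξ e.symm
    (fun _ _ => rfl) fun _ _ => rfl
  exact ⟨add_nonneg hτ hτ', χ, hχ, h0, h1⟩

theorem refl (f : ℝ → ℝ) (k : ℝ) (z : ℝ × ℝ) : Reaches f k z z 0 := by
  refine ⟨le_rfl, fun _ => z, ⟨continuousOn_const, fun t ht => ?_⟩, rfl, rfl⟩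
  obtain rfl : t = 0 := le_antisymm ht.2 ht.1
  simp

theorem iterate (hf : Continuous f) (h : Reaches f k z z τ) (n : ℕ) :
    Reaches f k z z (n * τ) := by
  induction n with
  | zero => simpa using refl f k z
  | succ n ih =>
    have := ih.trans hf h
    rwa [show ((n + 1 : ℕ) : ℝ) * τ = n * τ + τ by push_cast; ring]

/-- Time reversal. -/
theorem reverse (hf : Continuous f) (h : Reaches f k z w τ) :
    Reaches f k (w.1, -w.2) (z.1, -z.2) τ := by
  obtain ⟨hτ, ζ, ⟨hc, hi⟩, rfl, rfl⟩ := h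
  have hmaps : MapsTo (fun t => τ - t) (Icc 0 τ) (Icc 0 τ) := fun t ht =>
    ⟨by linarith [ht.2], by linarith [ht.1]⟩
  have cy : ContinuousOn (fun s => (ζ s).2) (Icc 0 τ) := continuous_snd.comp_continuousOn hc
  have cx : ContinuousOn (fun s => -f (ζ s).1 + k) (Icc 0 τ) :=
    ((hf.comp_continuousOn (continuous_fst.comp_continuousOn hc)).neg).add continuousOn_const
  have key : ∀ g : ℝ → ℝ, ContinuousOn g (Icc 0 τ) → ∀ t ∈ Icc 0 τ,
      ∫ s in (0 : ℝ)..t, g (τ - s) = (∫ s in (0 : ℝ)..τ, g s) - ∫ s in (0 : ℝ)..(τ - t), g s := by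
    intro g hg t ht
    have i₁ : IntervalIntegrable g volume 0 (τ - t) :=
      (hg.mono (Icc_subset_Icc_right (hmaps ht).2)).intervalIntegrable_of_Icc (hmaps ht).1
    have i₂ : IntervalIntegrable g volume (τ - t) τ :=
      (hg.mono (Icc_subset_Icc_left (hmaps ht).1)).intervalIntegrable_of_Icc (hmaps ht).2
    rw [intervalIntegral.integral_comp_sub_left, sub_zero,
      ← intervalIntegral.integral_add_adjacent_intervals i₁ i₂]
    ring
  refine ⟨hτ, fun t => ((ζ (τ - t)).1, -(ζ (τ - t)).2), ⟨?_, fun t ht => ?_⟩, by simp, by simp⟩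
  · have : ContinuousOn (fun t => ζ (τ - t)) (Icc 0 τ) := hc.comp (by fun_prop) hmaps
    exact (continuous_fst.comp_continuousOn this).prodMk
      (continuous_snd.comp_continuousOn this).neg
  · obtain ⟨a1, a2⟩ := hi τ ⟨hτ, le_rfl⟩
    obtain ⟨b1, b2⟩ := hi (τ - t) (hmaps ht)
    have e1 := key _ cy t ht
    have e2 := key _ cx t ht
    simp only [sub_zero, intervalIntegral.integral_neg]
    constructor <;> linarith

theorem restrict (h : Reaches f k z w τ) (hτ' : 0 ≤ τ') (hle : τ' ≤ τ) :
    ∃ v, Reaches f k z v τ' := by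
  obtain ⟨-, ζ, hζ, h0, -⟩ := h
  have hsub : Icc 0 τ' ⊆ Icc 0 τ := Icc_subset_Icc_right hle
  exact ⟨ζ τ', hτ', ζ, ⟨hζ.1.mono hsub, fun t ht => hζ.2 t (hsub ht)⟩, h0, rfl⟩

theorem of_mem_poincareDom (hf : LocallyLipschitz f) (hτ : 0 ≤ τ)
    (h : z ∈ poincareDom f (fun _ => k) τ) :
    Reaches f k z (poincareMap f (fun _ => k) τ z) τ := by
  obtain ⟨ζ, hζ, rfl⟩ := h
  exact ⟨hτ, ζ, hζ, rfl, (_root_.poincareMap_eq hf hτ intervalIntegrable_const hζ).symm⟩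

theorem mem_poincareDom (h : Reaches f k z w τ) : z ∈ poincareDom f (fun _ => k) τ := by
  obtain ⟨-, ζ, hζ, h0, -⟩ := h
  exact ⟨ζ, hζ, h0⟩

theorem poincareMap_eq (hf : LocallyLipschitz f) (h : Reaches f k z w τ) :
    poincareMap f (fun _ => k) τ z = w := by
  obtain ⟨hτ, ζ, hζ, rfl, rfl⟩ := h
  exact _root_.poincareMap_eq hf hτ intervalIntegrable_const hζ

theorem right_unique (hf : LocallyLipschitz f) (h : Reaches f k z w τ)
    (h' : Reaches f k z v τ) : w = v :=
  (h.poincareMap_eq hf).symm.trans (h'.poincareMap_eq hf)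

/-- Backward uniqueness is forward uniqueness of the reversed orbits. -/
theorem left_unique (hf : LocallyLipschitz f) (h : Reaches f k z w τ)
    (h' : Reaches f k v w τ) : z = v := by
  have := (h.reverse hf.continuous).right_unique hf (h'.reverse hf.continuous)
  simp only [Prod.mk.injEq, neg_inj] at this
  exact Prod.ext this.1 this.2

/-- The Poincaré map of the switched system. -/
theorem switch {p : ℝ → ℝ} {k₁ k₂ t₁ t₂ : ℝ} (hf : LocallyLipschitz f)
    (hp₁ : ∀ t ∈ Ico 0 t₁, p t = k₁) (hp₂ : ∀ t ∈ Ico t₁ (t₁ + t₂), p t = k₂)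
    (h₁ : Reaches f k₁ z w t₁) (h₂ : Reaches f k₂ w v t₂) :
    z ∈ poincareDom f p (t₁ + t₂) ∧ poincareMap f p (t₁ + t₂) z = v := by
  obtain ⟨ht₁, ζ, hζ, rfl, rfl⟩ := h₁
  obtain ⟨ht₂, ξ, hξ, e, rfl⟩ := h₂
  obtain ⟨χ, hχ, h0, h1⟩ := IsSolutionOn.concat (p := p) hf.continuous ht₁ ht₂ hζ hξ e.symm hp₁ hp₂
  refine ⟨⟨χ, hχ, h0⟩, ?_⟩
  have hpi : IntervalIntegrable p volume 0 (t₁ + t₂) := by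
    refine IntervalIntegrable.trans (b := t₁) ?_ ?_
    · refine (intervalIntegrable_const (c := k₁)).congr_uIoo fun t ht => ?_
      rw [uIoo_of_le ht₁] at ht
      exact (hp₁ t ⟨ht.1.le, ht.2⟩).symm
    · refine (intervalIntegrable_const (c := k₂)).congr_uIoo fun t ht => ?_
      rw [uIoo_of_le (by linarith)] at ht
      exact (hp₂ t ⟨ht.1.le, ht.2⟩).symm
  rw [← h0, ← h1]
  exact _root_.poincareMap_eq hf (add_nonneg ht₁ ht₂) hpi hχ

end Reaches

/-! ### Solutions by quadrature -/

/-- The inverse of a strictly monotone function on an interval is continuous. This gives the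
continuity of the abscissa as a function of time and of the right turning point as a function of the
left one. -/
theorem StrictMonoOn.continuousWithinAt_of_comp {α : Type*} [TopologicalSpace α] {Ψ : ℝ → ℝ}
    {s : Set ℝ} (hs : OrdConnected s) (hΨ : StrictMonoOn Ψ s) {r : α → ℝ} {t : Set α} {a : α}
    (hr : MapsTo r t s) (ha : a ∈ t) (h : ContinuousWithinAt (fun x => Ψ (r x)) t a) :
    ContinuousWithinAt r t a := by
  refine tendsto_order.2 ⟨fun v hv => ?_, fun v hv => ?_⟩
  · by_cases hvs : v ∈ s
    · filter_upwards [h.eventually_const_lt (hΨ hvs (hr ha) hv), self_mem_nhdsWithin] with x hx hxt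
      exact (hΨ.lt_iff_lt hvs (hr hxt)).1 hx
    · filter_upwards [self_mem_nhdsWithin] with x hxt
      by_contra! hle
      exact hvs (hs.out (hr hxt) (hr ha) ⟨hle, hv.le⟩)
  · by_cases hvs : v ∈ s
    · filter_upwards [h.eventually_lt_const (hΨ (hr ha) hvs hv), self_mem_nhdsWithin] with x hx hxt
      exact (hΨ.lt_iff_lt (hr hxt) hvs).1 hx
    · filter_upwards [self_mem_nhdsWithin] with x hxt
      by_contra! hle
      exact hvs (hs.out (hr ha) (hr hxt) ⟨hv.le, hle⟩)

theorem hasDerivAt_potential {f : ℝ → ℝ} (hf : Continuous f) (k x : ℝ) :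
    HasDerivAt (potential f k) (f x - k) x := by
  have h := intervalIntegral.integral_hasDerivAt_right (hf.intervalIntegrable 0 x)
    hf.stronglyMeasurable.stronglyMeasurableAtFilter hf.continuousAt
  exact (h.sub ((hasDerivAt_id x).const_mul k)).congr_deriv (by simp)

theorem continuous_potential {f : ℝ → ℝ} (hf : Continuous f) (k : ℝ) :
    Continuous (potential f k) :=
  continuous_iff_continuousAt.2 fun x => (hasDerivAt_potential hf k x).continuousAt

/-- A level line of the energy in the upper half-plane is an orbit, run through in the time
`timeMap`. -/
theorem reaches_of_level {f : ℝ → ℝ} (hf : Continuous f) {k ρ x₀ x₁ : ℝ} (hx : x₀ < x₁)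
    (hlt : ∀ s ∈ Ioo x₀ x₁, potential f k s < ρ)
    (hint : IntervalIntegrable (fun s => 1 / √(2 * (ρ - potential f k s))) volume x₀ x₁) :
    0 < timeMap f k ρ x₀ x₁ ∧
    Reaches f k (x₀, √(2 * (ρ - potential f k x₀))) (x₁, √(2 * (ρ - potential f k x₁)))
      (timeMap f k ρ x₀ x₁) := by
  have hΦ := continuous_potential hf k
  set v : ℝ → ℝ := fun s => √(2 * (ρ - potential f k s))
  have hv : Continuous v := by fun_prop
  have hvpos : ∀ s ∈ Ioo x₀ x₁, 0 < v s := fun s hs =>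
    Real.sqrt_pos.2 (by linarith [hlt s hs])
  set g : ℝ → ℝ := fun s => 1 / v s
  have hgpos : ∀ s ∈ Ioo x₀ x₁, 0 < g s := fun s hs => one_div_pos.2 (hvpos s hs)
  -- `T` is the time as a function of the abscissa; the solution is its inverse `X`, with velocity
  -- `v (X t)`.
  set T : ℝ → ℝ := fun x => ∫ s in x₀..x, g s
  set τ := T x₁
  have hτ : 0 < τ := intervalIntegral.intervalIntegral_pos_of_pos_on hint hgpos hx
  have hTc : ContinuousOn T (Icc x₀ x₁) := by
    have := intervalIntegral.continuousOn_primitive_interval' hint left_mem_uIcc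
    rwa [uIcc_of_le hx.le] at this
  have hsubint : ∀ {u w : ℝ}, x₀ ≤ u → u ≤ w → w ≤ x₁ → IntervalIntegrable g volume u w :=
    fun h1 h2 h3 => hint.mono_set (by
      rw [uIcc_of_le h2, uIcc_of_le hx.le]; exact Icc_subset_Icc h1 h3)
  have hTm : StrictMonoOn T (Icc x₀ x₁) := by
    intro u hu w hw huw
    have i := hsubint hu.1 huw.le hw.2
    have e : T u + ∫ s in u..w, g s = T w :=
      intervalIntegral.integral_add_adjacent_intervals (hsubint le_rfl hu.1 hu.2) i
    have := intervalIntegral.intervalIntegral_pos_of_pos_on i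
      (fun s hs => hgpos s ⟨hu.1.trans_lt hs.1, hs.2.trans_le hw.2⟩) huw
    linarith
  have hTd : ∀ x ∈ Ioo x₀ x₁, HasDerivAt T (g x) x := fun x hx' => by
    have hgc : ContinuousOn g (Ioo x₀ x₁) := fun s hs =>
      ((continuousAt_const).div hv.continuousAt (hvpos s hs).ne').continuousWithinAt
    exact intervalIntegral.integral_hasDerivAt_right (hsubint le_rfl hx'.1.le hx'.2.le)
      (hgc.stronglyMeasurableAtFilter isOpen_Ioo x hx')
      (hgc.continuousAt (isOpen_Ioo.mem_nhds hx'))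
  have hT0 : T x₀ = 0 := intervalIntegral.integral_same
  have hTsurj : ∀ t ∈ Icc 0 τ, ∃ x ∈ Icc x₀ x₁, T x = t := fun t ht =>
    intermediate_value_Icc hx.le hTc (by rwa [hT0])
  choose! X hXm hTX using hTsurj
  have hXc : ContinuousOn X (Icc 0 τ) := fun t ht =>
    hTm.continuousWithinAt_of_comp ordConnected_Icc hXm ht
      (continuousWithinAt_id.congr hTX (hTX t ht))
  have hX0 : X 0 = x₀ := hTm.injOn (hXm 0 ⟨le_rfl, hτ.le⟩) (left_mem_Icc.2 hx.le) (by
    rw [hTX 0 ⟨le_rfl, hτ.le⟩, hT0])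
  have hX1 : X τ = x₁ := hTm.injOn (hXm τ ⟨hτ.le, le_rfl⟩) (right_mem_Icc.2 hx.le)
    (hTX τ ⟨hτ.le, le_rfl⟩)
  have hXo : ∀ t ∈ Ioo 0 τ, X t ∈ Ioo x₀ x₁ := fun t ht => by
    have hm := hXm t ⟨ht.1.le, ht.2.le⟩
    have hT := hTX t ⟨ht.1.le, ht.2.le⟩
    constructor
    · refine lt_of_le_of_ne hm.1 fun h => ?_
      rw [← h, hT0] at hT; exact ht.1.ne hT
    · refine lt_of_le_of_ne hm.2 fun h => ?_
      rw [h] at hT; exact ht.2.ne' hT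
  have hXd : ∀ t ∈ Ioo 0 τ, HasDerivAt X (v (X t)) t := fun t ht => by
    have hnhds : Icc 0 τ ∈ 𝓝 t := Icc_mem_nhds ht.1 ht.2
    have := HasDerivAt.of_local_left_inverse (hXc.continuousAt hnhds) (hTd _ (hXo t ht))
      (hgpos _ (hXo t ht)).ne' (by filter_upwards [hnhds] with y hy using hTX y hy)
    simpa [g] using this
  have hvXd : ∀ t ∈ Ioo 0 τ, HasDerivAt (fun t => v (X t)) (-f (X t) + k) t := fun t ht => by
    have hv0 := hvpos _ (hXo t ht)
    have h1 := (hasDerivAt_potential hf k (X t)).comp t (hXd t ht)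
    have h2 := ((h1.const_sub ρ).const_mul 2).sqrt (Real.sqrt_pos.1 hv0).ne'
    refine h2.congr_deriv ?_
    change 2 * -((f (X t) - k) * v (X t)) / (2 * v (X t)) = _
    field_simp
    ring
  have hvXc : ContinuousOn (fun t => v (X t)) (Icc 0 τ) := hv.comp_continuousOn hXc
  have hfXc : ContinuousOn (fun t => -f (X t) + k) (Icc 0 τ) :=
    (hf.comp_continuousOn hXc).neg.add continuousOn_const
  -- The speed may vanish at both ends, where `T` need not be differentiable. Derivatives in the
  -- open interval and continuity up to the ends are enough for the integral equations.
  have ftc : ∀ G G' : ℝ → ℝ, ContinuousOn G (Icc 0 τ) → ContinuousOn G' (Icc 0 τ) →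
      (∀ t ∈ Ioo 0 τ, HasDerivAt G (G' t) t) → ∀ t ∈ Icc 0 τ,
      G t = G 0 + ∫ s in (0 : ℝ)..t, G' s := by
    intro G G' hG hG' hd t ht
    have hsub : Icc 0 t ⊆ Icc 0 τ := Icc_subset_Icc_right ht.2
    rw [intervalIntegral.integral_eq_sub_of_hasDerivAt_of_le ht.1 (hG.mono hsub)
      (fun s hs => hd s ⟨hs.1, hs.2.trans_le ht.2⟩)
      ((hG'.mono hsub).intervalIntegrable_of_Icc ht.1)]
    ring
  refine ⟨hτ, hτ.le, fun t => (X t, v (X t)), ⟨hXc.prodMk hvXc, fun t ht => ⟨?_, ?_⟩⟩, ?_, ?_⟩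
  · exact ftc X _ hXc hvXc hXd t ht
  · exact ftc _ _ hvXc hfXc hvXd t ht
  · change (X 0, v (X 0)) = _
    rw [hX0]
  · change (X τ, v (X τ)) = _
    rw [hX1]

/-! ### The time map between a turning point and a regular point -/

/-- The integral mean of `k - f` that represents `(Φ p - Φ (p + θ (x - p))) / θ`, where
`Φ = potential f k`. -/
def turnSlope (f : ℝ → ℝ) (k p x θ : ℝ) : ℝ :=
  (x - p) * ∫ u in (0 : ℝ)..1, (k - f (p + u * (θ * (x - p))))

theorem continuous_turnSlope {f : ℝ → ℝ} (hf : Continuous f) (k : ℝ) :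
    Continuous fun z : (ℝ × ℝ) × ℝ => turnSlope f k z.1.1 z.1.2 z.2 := by
  unfold turnSlope
  refine Continuous.mul (by fun_prop) ?_
  refine intervalIntegral.continuous_parametric_intervalIntegral_of_continuous'
    (f := fun (z : (ℝ × ℝ) × ℝ) u => k - f (z.1.1 + u * (z.2 * (z.1.2 - z.1.1)))) ?_ 0 1
  simp only [Function.uncurry_def]
  fun_prop

theorem turnSlope_mul {f : ℝ → ℝ} (hf : Continuous f) (k p x θ : ℝ) :
    turnSlope f k p x θ * θ = potential f k p - potential f k (p + θ * (x - p)) := by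
  set c := θ * (x - p)
  have hd : ∀ u ∈ uIcc (0 : ℝ) 1, HasDerivAt (fun u => -potential f k (p + u * c))
      ((k - f (p + u * c)) * c) u := fun u _ => by
    have h1 : HasDerivAt (fun u => p + u * c) c u := by
      simpa using ((hasDerivAt_id u).mul_const c).const_add p
    refine ((hasDerivAt_potential hf k (p + u * c)).comp u h1).neg.congr_deriv ?_
    ring
  have hc : Continuous fun u => (k - f (p + u * c)) * c := by fun_prop
  have := intervalIntegral.integral_eq_sub_of_hasDerivAt hd (hc.intervalIntegrable 0 1)
  rw [intervalIntegral.integral_mul_const] at this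
  rw [turnSlope, mul_right_comm, mul_comm, mul_comm (x - p) θ, this]
  simp
  ring

/-- `p` is a turning point on its level line, and the level line extends over the segment from `p`
to `x`. -/
structure IsTurning (f : ℝ → ℝ) (k p x : ℝ) : Prop where
  slope : 0 < (x - p) * (k - f p)
  lt : ∀ θ ∈ Ioc (0 : ℝ) 1, potential f k (p + θ * (x - p)) < potential f k p

theorem IsTurning.of_lt {f : ℝ → ℝ} {k p x : ℝ} (hpx : p < x) (hf : f p < k)
    (h : ∀ s ∈ Ioc p x, potential f k s < potential f k p) : IsTurning f k p x :=
  ⟨mul_pos (sub_pos.2 hpx) (sub_pos.2 hf), fun θ hθ => h _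
    ⟨by nlinarith [hθ.1], by nlinarith [hθ.2]⟩⟩

theorem IsTurning.of_gt {f : ℝ → ℝ} {k p x : ℝ} (hpx : x < p) (hf : k < f p)
    (h : ∀ s ∈ Ico x p, potential f k s < potential f k p) : IsTurning f k p x :=
  ⟨mul_pos_of_neg_of_neg (sub_neg.2 hpx) (sub_neg.2 hf), fun θ hθ => h _
    ⟨by nlinarith [hθ.2], by nlinarith [hθ.1]⟩⟩

theorem timeMap_eq_integral_unit (f : ℝ → ℝ) (k ρ p x : ℝ) : timeMap f k ρ p x =
    (x - p) * ∫ θ in (0 : ℝ)..1, 1 / √(2 * (ρ - potential f k (p + (x - p) * θ))) := by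
  have := intervalIntegral.smul_integral_comp_add_mul (a := 0) (b := 1)
    (fun s => 1 / √(2 * (ρ - potential f k s))) (x - p) p
  simp only [mul_zero, add_zero, mul_one, add_sub_cancel, smul_eq_mul] at this
  exact this.symm

namespace IsTurning

variable {f : ℝ → ℝ} {k p x : ℝ}

/-- The quotient `turnSlope` is positive at `θ = 0` because the force does not vanish at the turning
point, and for `θ > 0` because the level line extends to `x`. Compactness in `θ` makes this uniform
near `(p, x)`. The singular integrand is then dominated by a multiple of `θ ^ (-1/2)`. -/
theorem exists_bound (hf : Continuous f) (h : IsTurning f k p x) :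
    ∃ μ > 0, ∀ᶠ z : ℝ × ℝ in 𝓝 (p, x), ∀ θ ∈ Icc (0 : ℝ) 1, μ < turnSlope f k z.1 z.2 θ := by
  have hc := continuous_turnSlope hf k
  have hpos : ∀ θ ∈ Icc (0 : ℝ) 1, 0 < turnSlope f k p x θ := by
    intro θ hθ
    rcases hθ.1.eq_or_lt with rfl | h0
    · simpa [turnSlope] using h.slope
    · have h1 := turnSlope_mul hf k p x θ
      have h2 := h.lt θ ⟨h0, hθ.2⟩
      exact pos_of_mul_pos_left (by rw [h1]; linarith) h0.le
  obtain ⟨θ₀, hθ₀, hmin⟩ := (isCompact_Icc (a := (0 : ℝ)) (b := 1)).exists_isMinOn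
    ⟨0, by simp⟩ (hc.comp (Continuous.prodMk_right (p, x))).continuousOn
  have hμ := hpos θ₀ hθ₀
  refine ⟨turnSlope f k p x θ₀ / 2, half_pos hμ, ?_⟩
  refine isCompact_Icc.eventually_forall_of_forall_eventually fun θ hθ => ?_
  refine hc.continuousAt.eventually_const_lt ?_
  have : turnSlope f k p x θ₀ ≤ turnSlope f k p x θ := hmin hθ
  change _ < turnSlope f k p x θ
  linarith

theorem norm_integrand_le (hf : Continuous f) {μ : ℝ} (hμ : 0 < μ)
    (h : ∀ θ ∈ Icc (0 : ℝ) 1, μ < turnSlope f k p x θ) :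
    ∀ θ ∈ uIoc (0 : ℝ) 1,
      ‖1 / √(2 * (potential f k p - potential f k (p + (x - p) * θ)))‖
        ≤ 1 / √(2 * μ) * θ ^ (-(1 / 2) : ℝ) := by
  intro θ hθ
  rw [uIoc_of_le zero_le_one] at hθ
  have e : 1 / √(2 * μ) * θ ^ (-(1 / 2) : ℝ) = 1 / √(2 * (μ * θ)) := by
    rw [Real.rpow_neg hθ.1.le, ← Real.sqrt_eq_rpow, ← mul_assoc,
      Real.sqrt_mul (by positivity : 0 ≤ 2 * μ) θ, one_div, one_div, mul_inv]
  have hpos : 0 < μ * θ := mul_pos hμ hθ.1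
  rw [Real.norm_of_nonneg (by positivity), e, mul_comm (x - p), ← turnSlope_mul hf]
  have h1 := h θ ⟨hθ.1.le, hθ.2⟩
  have hθ0 := hθ.1
  gcongr

theorem intervalIntegrable_bound (C : ℝ) :
    IntervalIntegrable (fun θ : ℝ => C * θ ^ (-(1 / 2) : ℝ)) volume 0 1 :=
  (intervalIntegral.intervalIntegrable_rpow' (by norm_num)).const_mul C

theorem measurable_integrand (hf : Continuous f) (k ρ p x : ℝ) :
    Measurable fun θ => 1 / √(2 * (ρ - potential f k (p + (x - p) * θ))) := by
  have := continuous_potential hf k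
  have h : Continuous fun θ => √(2 * (ρ - potential f k (p + (x - p) * θ))) := by fun_prop
  exact h.measurable.const_div 1

theorem intervalIntegrable (hf : Continuous f) (h : IsTurning f k p x) :
    IntervalIntegrable (fun s => 1 / √(2 * (potential f k p - potential f k s))) volume p x := by
  obtain ⟨μ, hμ, hev⟩ := h.exists_bound hf
  have hxp : x - p ≠ 0 := fun h0 => by simpa [h0] using h.slope
  have h1 : IntervalIntegrable
      (fun θ => 1 / √(2 * (potential f k p - potential f k (p + (x - p) * θ)))) volume 0 1 := by
    refine (intervalIntegrable_bound (1 / √(2 * μ))).mono_fun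
      (measurable_integrand hf k _ p x).aestronglyMeasurable ?_
    filter_upwards [ae_restrict_mem measurableSet_uIoc] with θ hθ
    exact (norm_integrand_le hf hμ hev.self_of_nhds θ hθ).trans (le_abs_self _)
  have h2 := (h1.comp_mul_left (c := (x - p)⁻¹)).comp_sub_right p
  simp only [zero_div, zero_add, one_div, inv_inv, sub_add_cancel] at h2
  refine h2.congr fun s _ => ?_
  have e : p + (x - p) * ((x - p)⁻¹ * (s - p)) = s := by field_simp; ring
  simp only [e, one_div]

/-- Rescaling to `[0, 1]` fixes the singularity at `θ = 0` while `p`, `x` and the level vary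
together; dominated convergence does the rest. -/
theorem continuousAt_timeMap (hf : Continuous f) (h : IsTurning f k p x) :
    ContinuousAt (fun z : ℝ × ℝ => timeMap f k (potential f k z.1) z.1 z.2) (p, x) := by
  have hΦ := continuous_potential hf k
  obtain ⟨μ, hμ, hev⟩ := h.exists_bound hf
  simp only [timeMap_eq_integral_unit]
  refine ContinuousAt.mul (by fun_prop) ?_
  refine intervalIntegral.continuousAt_of_dominated_interval
    (bound := fun θ => 1 / √(2 * μ) * θ ^ (-(1 / 2) : ℝ)) ?_ ?_ (intervalIntegrable_bound _) ?_
  · exact Eventually.of_forall fun z => (measurable_integrand hf k _ z.1 z.2).aestronglyMeasurable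
  · filter_upwards [hev] with z hz
    exact Eventually.of_forall (norm_integrand_le hf hμ hz)
  · refine Eventually.of_forall fun θ hθ => ?_
    rw [uIoc_of_le zero_le_one] at hθ
    have h1 := h.lt θ hθ
    refine ContinuousAt.div continuousAt_const (Continuous.continuousAt (by fun_prop))
      (Real.sqrt_pos.2 ?_).ne'
    simp only [mul_comm (x - p)]
    linarith

end IsTurning

/-! ### The time map blows up near a saddle -/

theorem timeMap_integrand_nonneg (f : ℝ → ℝ) (k ρ s : ℝ) :
    0 ≤ 1 / √(2 * (ρ - potential f k s)) := by positivity

theorem timeMap_mono {f : ℝ → ℝ} {k ρ u v u' v' : ℝ} (hu : u' ≤ u) (huv : u ≤ v) (hv : v ≤ v')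
    (h : IntervalIntegrable (fun s => 1 / √(2 * (ρ - potential f k s))) volume u' v') :
    timeMap f k ρ u v ≤ timeMap f k ρ u' v' :=
  intervalIntegral.integral_mono_interval hu huv hv
    (Eventually.of_forall fun s => timeMap_integrand_nonneg f k ρ s) h

theorem intervalIntegrable_of_lt {f : ℝ → ℝ} (hf : Continuous f) {k ρ u v : ℝ} (huv : u ≤ v)
    (h : ∀ s ∈ Icc u v, potential f k s < ρ) :
    IntervalIntegrable (fun s => 1 / √(2 * (ρ - potential f k s))) volume u v := by
  have hΦ := continuous_potential hf k
  refine ContinuousOn.intervalIntegrable_of_Icc huv fun s hs => ?_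
  have hc : Continuous fun s => √(2 * (ρ - potential f k s)) := by fun_prop
  exact (continuousAt_const.div hc.continuousAt
    (Real.sqrt_pos.2 (by linarith [h s hs])).ne').continuousWithinAt

/-- The derivative `f - k` vanishes at the equilibrium and is Lipschitz, so the potential deviates
at most quadratically. This makes the approach time logarithmically divergent. -/
theorem exists_potential_sub_le {f : ℝ → ℝ} (hf : LocallyLipschitz f) {k x₀ x₁ : ℝ}
    (hk : f x₀ = k) (hx : x₁ ≤ x₀) :
    ∃ C > 0, ∀ s ∈ Icc x₁ x₀, potential f k x₀ - potential f k s ≤ C * (x₀ - s) ^ 2 := by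
  obtain ⟨L, hL⟩ := (hf.locallyLipschitzOn (s := Icc x₁ x₀)).exists_lipschitzOnWith_of_compact
    isCompact_Icc
  refine ⟨L + 1, by positivity, fun s hs => ?_⟩
  have h := Convex.norm_image_sub_le_of_norm_hasDerivWithin_le (s := Icc s x₀)
    (f := potential f k) (f' := fun r => f r - k) (C := L * (x₀ - s))
    (fun r _ => (hasDerivAt_potential hf.continuous k r).hasDerivWithinAt)
    (fun r hr => by
      have h1 := hL.dist_le_mul r ⟨hs.1.trans hr.1, hr.2⟩ x₀ (right_mem_Icc.2 hx)
      rw [Real.dist_eq, Real.dist_eq, hk] at h1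
      rw [Real.norm_eq_abs]
      refine h1.trans ?_
      rw [abs_sub_comm, abs_of_nonneg (by linarith [hr.2])]
      gcongr
      exact hr.1)
    (convex_Icc s x₀) (left_mem_Icc.2 hs.2) (right_mem_Icc.2 hs.2)
  rw [Real.norm_eq_abs, Real.norm_eq_abs, abs_of_nonneg (sub_nonneg.2 hs.2)] at h
  nlinarith [le_abs_self (potential f k x₀ - potential f k s), sq_nonneg (x₀ - s)]

theorem exists_lt_timeMap_left {f : ℝ → ℝ} (hf : LocallyLipschitz f) {k x₀ x₁ y : ℝ}
    (hk : f x₀ = k) (hx : x₁ < x₀) (hy : y < x₀) (τ : ℝ) :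
    ∃ x₂ ∈ Ioo x₁ x₀, y < x₂ ∧ ∃ ε > 0, ∀ ρ ≤ potential f k x₀ + ε,
      (∀ s ∈ Icc x₁ x₂, potential f k s < ρ) → τ < timeMap f k ρ x₁ x₂ := by
  obtain ⟨C, hC, hCb⟩ := exists_potential_sub_le hf hk hx.le
  -- For `ρ ≤ Φ(x₀) + C η²` and `x₀ - s ≥ η` one has `ρ - Φ(s) ≤ 2 C (x₀ - s)²`, so the speed is at
  -- most `c (x₀ - s)`. Integrating gives a time of at least `(log (x₀ - x₁) - log η) / c`. The
  -- margin `ε = C η²` admits levels slightly above that of the saddle.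
  set c := √(4 * C)
  have hc : 0 < c := Real.sqrt_pos.2 (by positivity)
  have hc2 : c ^ 2 = 4 * C := Real.sq_sqrt (by positivity)
  obtain ⟨η, hη0, hηx, hηy, hη⟩ : ∃ η > 0, η < x₀ - x₁ ∧ η < x₀ - y ∧
      τ * c < Real.log (x₀ - x₁) - Real.log η := by
    have h1 : ∀ᶠ η in 𝓝[>] (0 : ℝ), Real.log η < Real.log (x₀ - x₁) - τ * c :=
      Real.tendsto_log_nhdsGT_zero.eventually_lt_atBot _
    have h2 : ∀ᶠ η in 𝓝[>] (0 : ℝ), η < x₀ - x₁ :=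
      nhdsWithin_le_nhds (eventually_lt_nhds (by linarith))
    have h3 : ∀ᶠ η in 𝓝[>] (0 : ℝ), η < x₀ - y :=
      nhdsWithin_le_nhds (eventually_lt_nhds (by linarith))
    obtain ⟨η, a1, a2, a3, a4⟩ := (h1.and (h2.and (h3.and self_mem_nhdsWithin))).exists
    exact ⟨η, a4, a2, a3, by linarith⟩
  refine ⟨x₀ - η, ⟨by linarith, by linarith⟩, by linarith, C * η ^ 2, by positivity,
    fun ρ hρ hlt => ?_⟩
  have hle : x₁ ≤ x₀ - η := by linarith
  have hint : ∫ s in x₁..(x₀ - η), c⁻¹ * (x₀ - s)⁻¹ =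
      c⁻¹ * (Real.log (x₀ - x₁) - Real.log η) := by
    rw [intervalIntegral.integral_const_mul,
      intervalIntegral.integral_comp_sub_left (fun s => s⁻¹) x₀, sub_sub_cancel,
      integral_inv_of_pos hη0 (by linarith), Real.log_div (by linarith) hη0.ne']
  calc τ < c⁻¹ * (Real.log (x₀ - x₁) - Real.log η) := by
        rw [inv_mul_eq_div]; exact (lt_div_iff₀ hc).2 hη
    _ = ∫ s in x₁..(x₀ - η), c⁻¹ * (x₀ - s)⁻¹ := hint.symm
    _ ≤ timeMap f k ρ x₁ (x₀ - η) := by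
      refine intervalIntegral.integral_mono_on hle ?_
        (intervalIntegrable_of_lt hf.continuous hle hlt)
        fun s hs => ?_
      · refine ContinuousOn.intervalIntegrable_of_Icc hle fun s hs => ?_
        have : x₀ - s ≠ 0 := by linarith [hs.2]
        exact (ContinuousAt.mul continuousAt_const
          (ContinuousAt.inv₀ (by fun_prop) this)).continuousWithinAt
      · have hs0 : η ≤ x₀ - s := by linarith [hs.2]
        have h1 := hCb s ⟨hs.1, by linarith⟩
        have h2 := hlt s hs
        have h3 : η ^ 2 ≤ (x₀ - s) ^ 2 := pow_le_pow_left₀ hη0.le hs0 2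
        rw [← mul_inv, inv_eq_one_div]
        have hpos : 0 < √(2 * (ρ - potential f k s)) := Real.sqrt_pos.2 (by linarith)
        refine one_div_le_one_div_of_le hpos ?_
        refine Real.sqrt_le_iff.2 ⟨mul_nonneg hc.le (by linarith), ?_⟩
        rw [mul_pow, hc2]
        nlinarith

theorem potential_reflect (f : ℝ → ℝ) (k x : ℝ) :
    potential (fun s => -f (-s)) (-k) x = potential f k (-x) := by
  have := intervalIntegral.integral_comp_neg (a := 0) (b := x) f
  rw [potential, potential, intervalIntegral.integral_neg, this, intervalIntegral.integral_symm]
  simp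

theorem timeMap_reflect (f : ℝ → ℝ) (k ρ x y : ℝ) :
    timeMap (fun s => -f (-s)) (-k) ρ x y = timeMap f k ρ (-y) (-x) := by
  simp only [timeMap, potential_reflect]
  exact intervalIntegral.integral_comp_neg (fun s => 1 / √(2 * (ρ - potential f k s)))

/-- The mirror image of `exists_lt_timeMap_left` under `x ↦ -x`, which replaces `f` by `-f(-·)` and
`k` by `-k`. -/
theorem exists_lt_timeMap_right {f : ℝ → ℝ} (hf : LocallyLipschitz f) {k x₀ x₁ y : ℝ}
    (hk : f x₀ = k) (hx : x₀ < x₁) (hy : x₀ < y) (τ : ℝ) :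
    ∃ x₂ ∈ Ioo x₀ x₁, x₂ < y ∧ ∀ ρ ≤ potential f k x₀,
      (∀ s ∈ Icc x₂ x₁, potential f k s < ρ) → τ < timeMap f k ρ x₂ x₁ := by
  have hf' : LocallyLipschitz fun s => -f (-s) :=
    (hf.comp (LipschitzWith.id.neg.locallyLipschitz)).neg
  obtain ⟨x₂, hx₂, hy₂, ε, hε, H⟩ := exists_lt_timeMap_left (x₀ := -x₀) (x₁ := -x₁) (y := -y)
    hf' (k := -k) (by simp [hk]) (by linarith) (by linarith) τ
  refine ⟨-x₂, ⟨by linarith [hx₂.2], by linarith [hx₂.1]⟩, by linarith, fun ρ hρ hlt => ?_⟩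
  have := H ρ (by rw [potential_reflect, neg_neg]; linarith) fun s hs => by
    rw [potential_reflect]
    exact hlt _ ⟨by linarith [hs.2], by linarith [hs.1]⟩
  rwa [timeMap_reflect, neg_neg] at this

/-! ### The shape of the potential -/

namespace HypH0

variable {f : ℝ → ℝ} {k ρ x : ℝ}

theorem continuous (hf : HypH0 f) : Continuous f := hf.locallyLipschitz.continuous

theorem xSaddle_spec (hf : HypH0 f) (hk : 0 < k) : xSaddle f k < 0 ∧ f (xSaddle f k) = k := by
  have hex : ∃ x ∈ Iic (0 : ℝ), f x = k := by
    obtain ⟨u, hu0, hu⟩ := ((eventually_le_atBot (0 : ℝ)).and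
      (hf.tendsto_atBot.eventually_ge_atTop k)).exists
    obtain ⟨x, hx, hxk⟩ := intermediate_value_Icc' hu0 hf.continuous.continuousOn
      (show k ∈ Icc (f 0) (f u) from ⟨hf.map_zero.trans_le hk.le, hu⟩)
    exact ⟨x, hx.2, hxk⟩
  have h2 : f (xSaddle f k) = k := Function.invFunOn_eq hex
  refine ⟨lt_of_le_of_ne (Function.invFunOn_mem hex) fun h => ?_, h2⟩
  rw [show xSaddle f k = 0 from h, hf.map_zero] at h2
  exact hk.ne h2

theorem xCenter_spec (hf : HypH0 f) (hk : 0 < k) : 0 < xCenter f k ∧ f (xCenter f k) = k := by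
  have hex : ∃ x ∈ Ici (0 : ℝ), f x = k := by
    obtain ⟨u, hu0, hu⟩ := ((eventually_ge_atTop (0 : ℝ)).and
      (hf.tendsto_atTop.eventually_ge_atTop k)).exists
    obtain ⟨x, hx, hxk⟩ := intermediate_value_Icc hu0 hf.continuous.continuousOn
      (show k ∈ Icc (f 0) (f u) from ⟨hf.map_zero.trans_le hk.le, hu⟩)
    exact ⟨x, hx.1, hxk⟩
  have h2 : f (xCenter f k) = k := Function.invFunOn_eq hex
  refine ⟨lt_of_le_of_ne (Function.invFunOn_mem hex) fun h => ?_, h2⟩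
  rw [show xCenter f k = 0 from h.symm, hf.map_zero] at h2
  exact hk.ne h2

theorem xSaddle_lt_xCenter (hf : HypH0 f) (hk : 0 < k) : xSaddle f k < xCenter f k :=
  (hf.xSaddle_spec hk).1.trans (hf.xCenter_spec hk).1

theorem lt_apply_of_lt_xSaddle (hf : HypH0 f) (hk : 0 < k) (hx : x < xSaddle f k) : k < f x := by
  obtain ⟨h1, h2⟩ := hf.xSaddle_spec hk
  have := hf.strictAntiOn (mem_Iic.2 (hx.trans h1).le) (mem_Iic.2 h1.le) hx
  rwa [h2] at this

theorem lt_apply_of_xCenter_lt (hf : HypH0 f) (hk : 0 < k) (hx : xCenter f k < x) : k < f x := by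
  obtain ⟨h1, h2⟩ := hf.xCenter_spec hk
  have := hf.strictMonoOn (mem_Ici.2 h1.le) (mem_Ici.2 (h1.trans hx).le) hx
  rwa [h2] at this

theorem apply_lt (hf : HypH0 f) (hk : 0 < k) (hx : x ∈ Ioo (xSaddle f k) (xCenter f k)) :
    f x < k := by
  obtain ⟨h1, h2⟩ := hf.xSaddle_spec hk
  obtain ⟨h3, h4⟩ := hf.xCenter_spec hk
  rcases le_total x 0 with h0 | h0
  · have := hf.strictAntiOn (mem_Iic.2 h1.le) (mem_Iic.2 h0) hx.1
    rwa [h2] at this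
  · have := hf.strictMonoOn (mem_Ici.2 h0) (mem_Ici.2 h3.le) hx.2
    rwa [h4] at this

theorem xSaddle_lt_xSaddle {k₁ k₂ : ℝ} (hf : HypH0 f) (hk₁ : 0 < k₁) (hk : k₁ < k₂) :
    xSaddle f k₂ < xSaddle f k₁ := by
  obtain ⟨h1, h2⟩ := hf.xSaddle_spec hk₁
  obtain ⟨h3, h4⟩ := hf.xSaddle_spec (hk₁.trans hk)
  rw [← hf.strictAntiOn.lt_iff_gt (mem_Iic.2 h1.le) (mem_Iic.2 h3.le), h2, h4]
  exact hk

theorem deriv_potential (hf : HypH0 f) (k x : ℝ) : deriv (potential f k) x = f x - k :=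
  (hasDerivAt_potential hf.continuous k x).deriv

theorem strictMonoOn_potential_Iic (hf : HypH0 f) (hk : 0 < k) :
    StrictMonoOn (potential f k) (Iic (xSaddle f k)) := by
  refine strictMonoOn_of_deriv_pos (convex_Iic _)
    (continuous_potential hf.continuous k).continuousOn fun x hx => ?_
  rw [interior_Iic] at hx
  rw [hf.deriv_potential]
  exact sub_pos.2 (hf.lt_apply_of_lt_xSaddle hk hx)

theorem strictAntiOn_potential (hf : HypH0 f) (hk : 0 < k) :
    StrictAntiOn (potential f k) (Icc (xSaddle f k) (xCenter f k)) := by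
  refine strictAntiOn_of_deriv_neg (convex_Icc _ _)
    (continuous_potential hf.continuous k).continuousOn fun x hx => ?_
  rw [interior_Icc] at hx
  rw [hf.deriv_potential]
  exact sub_neg.2 (hf.apply_lt hk hx)

theorem strictMonoOn_potential_Ici (hf : HypH0 f) (hk : 0 < k) :
    StrictMonoOn (potential f k) (Ici (xCenter f k)) := by
  refine strictMonoOn_of_deriv_pos (convex_Ici _)
    (continuous_potential hf.continuous k).continuousOn fun x hx => ?_
  rw [interior_Ici] at hx
  rw [hf.deriv_potential]
  exact sub_pos.2 (hf.lt_apply_of_xCenter_lt hk hx)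

theorem potential_xCenter_lt (hf : HypH0 f) (hk : 0 < k) :
    potential f k (xCenter f k) < potential f k (xSaddle f k) :=
  hf.strictAntiOn_potential hk (left_mem_Icc.2 (hf.xSaddle_lt_xCenter hk).le)
    (right_mem_Icc.2 (hf.xSaddle_lt_xCenter hk).le) (hf.xSaddle_lt_xCenter hk)

theorem exists_gt_potential_eq (hf : HypH0 f) (hρ : potential f k (xCenter f k) < ρ) :
    ∃ x ∈ Ioi (xCenter f k), potential f k x = ρ := by
  obtain ⟨u, hu⟩ := (hf.tendsto_atTop.eventually_ge_atTop (k + 1)).exists_forall_of_atTop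
  set v := max u (xCenter f k)
  -- Beyond `v` the potential has slope at least `1`, so it has reached `ρ` at `w`.
  set w := v + |ρ - potential f k v|
  have hΦ := continuous_potential hf.continuous k
  have h := Convex.mul_sub_le_image_sub_of_le_deriv (convex_Ici v) (f := potential f k) (C := 1)
    hΦ.continuousOn
    (fun x _ => (hasDerivAt_potential hf.continuous k x).differentiableAt.differentiableWithinAt)
    (fun x hx => by
      rw [interior_Ici] at hx
      rw [hf.deriv_potential]
      linarith [hu x ((le_max_left _ _).trans hx.le)])
    v self_mem_Ici w (mem_Ici.2 (le_add_of_nonneg_right (abs_nonneg _)))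
    (le_add_of_nonneg_right (abs_nonneg _))
  have hw : ρ ≤ potential f k w := by
    have := le_abs_self (ρ - potential f k v)
    simp only [w, add_sub_cancel_left] at h ⊢
    linarith
  have hcw : xCenter f k ≤ w := (le_max_right _ _).trans (le_add_of_nonneg_right (abs_nonneg _))
  obtain ⟨x, hx, hxρ⟩ := intermediate_value_Icc hcw hΦ.continuousOn ⟨hρ.le, hw⟩
  exact ⟨x, lt_of_le_of_ne hx.1 fun h => by rw [h, hxρ] at hρ; exact hρ.false, hxρ⟩

theorem exists_lt_potential_eq (hf : HypH0 f) (hρ : ρ < potential f k (xSaddle f k)) :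
    ∃ x ∈ Iio (xSaddle f k), potential f k x = ρ := by
  obtain ⟨u, hu⟩ := (hf.tendsto_atBot.eventually_ge_atTop (k + 1)).exists_forall_of_atBot
  set v := min u (xSaddle f k)
  set w := v - |potential f k v - ρ|
  have hΦ := continuous_potential hf.continuous k
  have h := Convex.mul_sub_le_image_sub_of_le_deriv (convex_Iic v) (f := potential f k) (C := 1)
    hΦ.continuousOn
    (fun x _ => (hasDerivAt_potential hf.continuous k x).differentiableAt.differentiableWithinAt)
    (fun x hx => by
      rw [interior_Iic] at hx
      rw [hf.deriv_potential]
      linarith [hu x (hx.le.trans (min_le_left _ _))])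
    w (mem_Iic.2 (sub_le_self _ (abs_nonneg _))) v self_mem_Iic (sub_le_self _ (abs_nonneg _))
  have hw : potential f k w ≤ ρ := by
    have := le_abs_self (potential f k v - ρ)
    simp only [w, sub_sub_cancel] at h ⊢
    linarith
  have hcw : w ≤ xSaddle f k := (sub_le_self _ (abs_nonneg _)).trans (min_le_right _ _)
  obtain ⟨x, hx, hxρ⟩ := intermediate_value_Icc hcw hΦ.continuousOn ⟨hw, hρ.le⟩
  exact ⟨x, lt_of_le_of_ne hx.2 fun h => by rw [← h, hxρ] at hρ; exact hρ.false, hxρ⟩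

theorem xHom_spec (hf : HypH0 f) (hk : 0 < k) :
    xCenter f k < xHom f k ∧ potential f k (xHom f k) = potential f k (xSaddle f k) := by
  have hex := hf.exists_gt_potential_eq (hf.potential_xCenter_lt hk)
  exact ⟨Function.invFunOn_mem hex, Function.invFunOn_eq hex⟩

theorem xLower_spec (hf : HypH0 f) (hρ : ρ < potential f k (xSaddle f k)) :
    xLower f k ρ < xSaddle f k ∧ potential f k (xLower f k ρ) = ρ := by
  have hex := hf.exists_lt_potential_eq hρ
  exact ⟨Function.invFunOn_mem hex, Function.invFunOn_eq hex⟩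

theorem xUpper_spec (hf : HypH0 f) (hk : 0 < k) (hρ : potential f k (xSaddle f k) < ρ) :
    xHom f k < xUpper f k ρ ∧ potential f k (xUpper f k ρ) = ρ := by
  have hex : ∃ x ∈ Ioi (xHom f k), potential f k x = ρ := by
    obtain ⟨x, hx, hxρ⟩ := hf.exists_gt_potential_eq ((hf.potential_xCenter_lt hk).trans hρ)
    obtain ⟨h1, h2⟩ := hf.xHom_spec hk
    refine ⟨x, ?_, hxρ⟩
    rw [mem_Ioi, ← (hf.strictMonoOn_potential_Ici hk).lt_iff_lt (mem_Ici.2 h1.le)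
      (mem_Ici.2 (mem_Ioi.1 hx).le), h2, hxρ]
    exact hρ
  exact ⟨Function.invFunOn_mem hex, Function.invFunOn_eq hex⟩

theorem xMinus_spec (hf : HypH0 f) (hk : 0 < k)
    (hρ : ρ ∈ Ioo (potential f k (xCenter f k)) (potential f k (xSaddle f k))) :
    xMinus f k ρ ∈ Ioo (xSaddle f k) (xCenter f k) ∧ potential f k (xMinus f k ρ) = ρ := by
  have hex : ∃ x ∈ Ioo (xSaddle f k) (xCenter f k), potential f k x = ρ :=
    intermediate_value_Ioo' (hf.xSaddle_lt_xCenter hk).le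
      (continuous_potential hf.continuous k).continuousOn hρ
  exact ⟨Function.invFunOn_mem hex, Function.invFunOn_eq hex⟩

theorem xPlus_spec (hf : HypH0 f) (hρ : potential f k (xCenter f k) < ρ) :
    xCenter f k < xPlus f k ρ ∧ potential f k (xPlus f k ρ) = ρ := by
  have hex := hf.exists_gt_potential_eq hρ
  exact ⟨Function.invFunOn_mem hex, Function.invFunOn_eq hex⟩

end HypH0

/-! ### Existence of admissible levels -/

theorem potential_sub_potential (f : ℝ → ℝ) (k₁ k₂ x : ℝ) :
    potential f k₁ x - potential f k₂ x = (k₂ - k₁) * x := by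
  simp only [potential]; ring

/-- Choose `a` between the saddles, then `D` close enough to the homoclinic level of `k₂` that its
closed orbit encloses both `a` and `x_h(k₁)`, then `b` between `x_h(k₁)` and `x_+(D)`. -/
theorem exists_admissibleLevels {f : ℝ → ℝ} (hf : HypH0 f) {k₁ k₂ : ℝ} (hk₁ : 0 < k₁)
    (hk : k₁ < k₂) : ∃ A B D : ℝ, AdmissibleLevels f k₁ k₂ A B D := by
  have hk₂ := hk₁.trans hk
  have huu := hf.xSaddle_lt_xSaddle hk₁ hk
  obtain ⟨hu0, -⟩ := hf.xSaddle_spec hk₁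
  obtain ⟨hs0, -⟩ := hf.xCenter_spec hk₁
  obtain ⟨hs0', -⟩ := hf.xCenter_spec hk₂
  obtain ⟨hh, hhe⟩ := hf.xHom_spec hk₁
  obtain ⟨hh', hhe'⟩ := hf.xHom_spec hk₂
  obtain ⟨a, ha⟩ := exists_between huu
  have hanti := hf.strictAntiOn_potential hk₂
  have hu₂ := left_mem_Icc.2 (hf.xSaddle_lt_xCenter hk₂).le
  have ha₂ : a ∈ Icc (xSaddle f k₂) (xCenter f k₂) := ⟨ha.1.le, by linarith [ha.2]⟩
  have hA : potential f k₁ a < potential f k₁ (xSaddle f k₁) :=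
    hf.strictMonoOn_potential_Iic hk₁ (mem_Iic.2 ha.2.le) (mem_Iic.2 le_rfl) ha.2
  have hAspec := hf.xLower_spec hA
  have hAa : xLower f k₁ (potential f k₁ a) = a :=
    (hf.strictMonoOn_potential_Iic hk₁).injOn (mem_Iic.2 hAspec.1.le) (mem_Iic.2 ha.2.le) hAspec.2
  -- `Φ_{k₁}` agrees at `x_h(k₁)` and `x_u(k₁)`, and subtracting `(k₂ - k₁) x` lowers the value more
  -- at the right point. Hence `Φ_{k₂}(x_h(k₁)) < Φ_{k₂}(x_u(k₁)) < Φ_{k₂}(x_u(k₂))`.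
  have hlt : potential f k₂ (xHom f k₁) < potential f k₂ (xSaddle f k₂) := by
    have h1 := hanti hu₂ (⟨huu.le, by linarith⟩ : xSaddle f k₁ ∈ Icc _ _) huu
    have h2 := potential_sub_potential f k₁ k₂ (xHom f k₁)
    have h3 := potential_sub_potential f k₁ k₂ (xSaddle f k₁)
    nlinarith
  obtain ⟨D, hD1, hD2⟩ := exists_between (max_lt (max_lt (hanti hu₂ ha₂ ha.1) hlt)
    (hf.potential_xCenter_lt hk₂))
  obtain ⟨hD1, hDc⟩ := max_lt_iff.1 hD1
  obtain ⟨hDa, hDh⟩ := max_lt_iff.1 hD1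
  obtain ⟨hd, hde⟩ := hf.xMinus_spec hk₂ ⟨hDc, hD2⟩
  obtain ⟨hp, hpe⟩ := hf.xPlus_spec hDc
  have hmono := hf.strictMonoOn_potential_Ici hk₂
  have hda : xMinus f k₂ D < a :=
    (hanti.lt_iff_gt ha₂ (Ioo_subset_Icc_self hd)).1 (by rwa [hde])
  have hpH : xPlus f k₂ D < xHom f k₂ :=
    (hmono.lt_iff_lt (mem_Ici.2 hp.le) (mem_Ici.2 hh'.le)).1 (by rwa [hpe, hhe'])
  have hpH' : xHom f k₁ < xPlus f k₂ D := by
    by_contra! hle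
    have := (hmono.le_iff_le (mem_Ici.2 hp.le) (mem_Ici.2 (hp.le.trans hle))).2 hle
    rw [hpe] at this
    exact this.not_gt hDh
  obtain ⟨b, hb⟩ := exists_between hpH'
  have hmono₁ := hf.strictMonoOn_potential_Ici hk₁
  have hB : potential f k₁ (xSaddle f k₁) < potential f k₁ b := by
    rw [← hhe]
    exact hmono₁ (mem_Ici.2 hh.le) (mem_Ici.2 (hh.trans hb.1).le) hb.1
  have hBspec := hf.xUpper_spec hk₁ hB
  have hBb : xUpper f k₁ (potential f k₁ b) = b :=
    hmono₁.injOn (mem_Ici.2 (hh.trans hBspec.1).le) (mem_Ici.2 (hh.trans hb.1).le) hBspec.2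
  exact ⟨_, _, D, hA, hAa.symm ▸ ha, ⟨hDc, hD2⟩, ⟨hd.1, hAa.symm ▸ hda⟩, ⟨hp, hpH⟩, hB,
    hBb.symm ▸ hb⟩

/-! ### Crossing points of the level lines of the two systems -/

/-- The abscissa of the points where the level line of `k₁` with turning point `p` and the level
line of `k₂` with turning point `q` cross. -/
def crossX (f : ℝ → ℝ) (k₁ k₂ p q : ℝ) : ℝ := (potential f k₁ p - potential f k₂ q) / (k₂ - k₁)

/-- The crossing point in the upper half-plane. -/
def crossPt (f : ℝ → ℝ) (k₁ k₂ p q : ℝ) : ℝ × ℝ :=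
  (crossX f k₁ k₂ p q, √(2 * (potential f k₁ p - potential f k₁ (crossX f k₁ k₂ p q))))

/-- The time from the crossing point to the turning point `p` along the level line of `k₁`. -/
def outerTime (f : ℝ → ℝ) (k₁ k₂ p q : ℝ) : ℝ :=
  timeMap f k₁ (potential f k₁ p) (crossX f k₁ k₂ p q) p

/-- The time from the turning point `q` to the crossing point along the level line of `k₂`. -/
def innerTime (f : ℝ → ℝ) (k₁ k₂ p q : ℝ) : ℝ :=
  timeMap f k₂ (potential f k₂ q) q (crossX f k₁ k₂ p q)

/-- Half the period of the closed orbit of `k₂` with left turning point `q`. -/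
def halfPeriod (f : ℝ → ℝ) (k₂ q : ℝ) : ℝ :=
  timeMap f k₂ (potential f k₂ q) q (xPlus f k₂ (potential f k₂ q))

/-- The turning points of the level lines of `k₁` in the strip. -/
def outerArc (f : ℝ → ℝ) (k₁ A B : ℝ) : Set ℝ :=
  Ico (xLower f k₁ A) (xSaddle f k₁) ∪ Ioc (xHom f k₁) (xUpper f k₁ B)

/-- The left turning points of the level lines of `k₂` in the annulus. -/
def innerArc (f : ℝ → ℝ) (k₂ D : ℝ) : Set ℝ := Ioc (xSaddle f k₂) (xMinus f k₂ D)

/-- The hypotheses on the two systems and the three energy levels. -/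
structure LinkedSystem (f : ℝ → ℝ) (k₁ k₂ A B D : ℝ) : Prop where
  hyp : HypH0 f
  pos : 0 < k₁
  lt : k₁ < k₂
  adm : AdmissibleLevels f k₁ k₂ A B D

namespace LinkedSystem

variable {f : ℝ → ℝ} {k₁ k₂ A B D p q p' q' x : ℝ}

theorem pos₂ (h : LinkedSystem f k₁ k₂ A B D) : 0 < k₂ := h.pos.trans h.lt

theorem gap_pos (h : LinkedSystem f k₁ k₂ A B D) : 0 < k₂ - k₁ := sub_pos.2 h.lt

theorem lower_spec (h : LinkedSystem f k₁ k₂ A B D) : potential f k₁ (xLower f k₁ A) = A :=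
  (h.hyp.xLower_spec h.adm.A_lt).2

theorem upper_spec (h : LinkedSystem f k₁ k₂ A B D) : potential f k₁ (xUpper f k₁ B) = B :=
  (h.hyp.xUpper_spec h.pos h.adm.lt_B).2

theorem minus_spec (h : LinkedSystem f k₁ k₂ A B D) : xMinus f k₂ D < xCenter f k₂ ∧
    potential f k₂ (xMinus f k₂ D) = D :=
  ⟨(h.hyp.xMinus_spec h.pos₂ h.adm.D_mem).1.2, (h.hyp.xMinus_spec h.pos₂ h.adm.D_mem).2⟩

theorem plus_spec (h : LinkedSystem f k₁ k₂ A B D) : potential f k₂ (xPlus f k₂ D) = D :=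
  (h.hyp.xPlus_spec h.adm.D_mem.1).2

theorem lower_mem_outerArc (h : LinkedSystem f k₁ k₂ A B D) : xLower f k₁ A ∈ outerArc f k₁ A B :=
  Or.inl ⟨le_rfl, h.adm.a_mem.2⟩

theorem upper_mem_outerArc (h : LinkedSystem f k₁ k₂ A B D) : xUpper f k₁ B ∈ outerArc f k₁ A B :=
  Or.inr ⟨h.adm.b_mem.1, le_rfl⟩

theorem minus_mem_innerArc (h : LinkedSystem f k₁ k₂ A B D) : xMinus f k₂ D ∈ innerArc f k₂ D :=
  ⟨h.adm.d_mem.1, le_rfl⟩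

theorem innerArc_subset (h : LinkedSystem f k₁ k₂ A B D) (hq : q ∈ innerArc f k₂ D) :
    q ∈ Ioo (xSaddle f k₂) (xCenter f k₂) :=
  ⟨hq.1, hq.2.trans_lt h.minus_spec.1⟩

theorem saddle_lt_hom (h : LinkedSystem f k₁ k₂ A B D) : xSaddle f k₁ < xHom f k₁ :=
  (h.hyp.xSaddle_lt_xCenter h.pos).trans (h.hyp.xHom_spec h.pos).1

/-- Every level line of the strip extends to the left of its turning point. -/
theorem potential_lt (h : LinkedSystem f k₁ k₂ A B D) (hp : p ∈ outerArc f k₁ A B) (hx : x < p) :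
    potential f k₁ x < potential f k₁ p := by
  have hmono := h.hyp.strictMonoOn_potential_Iic h.pos
  have hmono' := h.hyp.strictMonoOn_potential_Ici h.pos
  have hanti := h.hyp.strictAntiOn_potential h.pos
  obtain ⟨hh, hhe⟩ := h.hyp.xHom_spec h.pos
  have hus := h.hyp.xSaddle_lt_xCenter h.pos
  rcases hp with hp | hp
  · exact hmono (mem_Iic.2 (hx.trans hp.2).le) (mem_Iic.2 hp.2.le) hx
  · rcases le_total (xCenter f k₁) x with hs | hs
    · exact hmono' (mem_Ici.2 hs) (mem_Ici.2 (hs.trans hx.le)) hx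
    · have h1 := hmono' (mem_Ici.2 hh.le) (mem_Ici.2 (hh.trans hp.1).le) hp.1
      rw [hhe] at h1
      refine lt_of_le_of_lt ?_ h1
      rcases le_total x (xSaddle f k₁) with hu | hu
      · exact hmono.monotoneOn (mem_Iic.2 hu) (mem_Iic.2 le_rfl) hu
      · exact hanti.antitoneOn (left_mem_Icc.2 hus.le) ⟨hu, hs⟩ hu

theorem lt_apply (h : LinkedSystem f k₁ k₂ A B D) (hp : p ∈ outerArc f k₁ A B) : k₁ < f p := by
  rcases hp with hp | hp
  · exact h.hyp.lt_apply_of_lt_xSaddle h.pos hp.2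
  · exact h.hyp.lt_apply_of_xCenter_lt h.pos ((h.hyp.xHom_spec h.pos).1.trans hp.1)

theorem isTurning_outer (h : LinkedSystem f k₁ k₂ A B D) (hp : p ∈ outerArc f k₁ A B)
    (hx : x < p) : IsTurning f k₁ p x :=
  .of_gt hx (h.lt_apply hp) fun _ hs => h.potential_lt hp hs.2

theorem outer_level_mem (h : LinkedSystem f k₁ k₂ A B D) (hp : p ∈ outerArc f k₁ A B) :
    potential f k₁ p ∈ Icc A B := by
  have hAB := h.adm.A_lt.trans h.adm.lt_B
  rcases hp with hp' | hp'
  · have h1 := (h.hyp.strictMonoOn_potential_Iic h.pos).monotoneOn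
      (mem_Iic.2 (hp'.1.trans hp'.2.le)) (mem_Iic.2 hp'.2.le) hp'.1
    have h2 := h.hyp.strictMonoOn_potential_Iic h.pos (mem_Iic.2 hp'.2.le) (mem_Iic.2 le_rfl) hp'.2
    rw [h.lower_spec] at h1
    exact ⟨h1, h2.le.trans h.adm.lt_B.le⟩
  · have h1 := h.potential_lt (Or.inr hp') (h.adm.a_mem.2.trans (h.saddle_lt_hom.trans hp'.1))
    rw [h.lower_spec] at h1
    refine ⟨h1.le, ?_⟩
    rcases hp'.2.eq_or_lt with rfl | hlt
    · exact h.upper_spec.le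
    · have h2 := h.potential_lt h.upper_mem_outerArc hlt
      rw [h.upper_spec] at h2
      exact h2.le

theorem inner_level_mem (h : LinkedSystem f k₁ k₂ A B D) (hq : q ∈ innerArc f k₂ D) :
    potential f k₂ q ∈ Ico D (potential f k₂ (xSaddle f k₂)) := by
  have hanti := h.hyp.strictAntiOn_potential h.pos₂
  have hq' := h.innerArc_subset hq
  have hd' := h.innerArc_subset h.minus_mem_innerArc
  have h1 := hanti.antitoneOn (Ioo_subset_Icc_self hq') (Ioo_subset_Icc_self hd') hq.2
  rw [h.minus_spec.2] at h1
  exact ⟨h1, hanti (left_mem_Icc.2 (hq'.1.trans hq'.2).le) (Ioo_subset_Icc_self hq') hq'.1⟩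

/-- The abscissas at which the closed orbit of energy `D` encloses the `x`-axis. -/
theorem potential_lt_level (h : LinkedSystem f k₁ k₂ A B D)
    (hx : x ∈ Ioo (xMinus f k₂ D) (xPlus f k₂ D)) : potential f k₂ x < D := by
  have hd' := h.innerArc_subset h.minus_mem_innerArc
  rcases le_total x (xCenter f k₂) with hs | hs
  · have := h.hyp.strictAntiOn_potential h.pos₂ (Ioo_subset_Icc_self hd')
      ⟨(hd'.1.trans hx.1).le, hs⟩ hx.1
    rwa [h.minus_spec.2] at this
  · have := h.hyp.strictMonoOn_potential_Ici h.pos₂ (mem_Ici.2 hs)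
      (mem_Ici.2 (hs.trans hx.2.le)) hx.2
    rwa [h.plus_spec] at this

theorem crossX_le (h : LinkedSystem f k₁ k₂ A B D) (hp : potential f k₁ p ≤ potential f k₁ p')
    (hq : potential f k₂ q' ≤ potential f k₂ q) : crossX f k₁ k₂ p q ≤ crossX f k₁ k₂ p' q' := by
  have := h.gap_pos
  unfold crossX
  gcongr

/-- Both level lines have the same `y² / 2` at this abscissa, which is why they meet there. -/
theorem potential_sub_crossX (h : LinkedSystem f k₁ k₂ A B D) (p q : ℝ) :
    potential f k₁ p - potential f k₁ (crossX f k₁ k₂ p q) =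
      potential f k₂ q - potential f k₂ (crossX f k₁ k₂ p q) := by
  have h1 := potential_sub_potential f k₁ k₂ (crossX f k₁ k₂ p q)
  have h2 : (k₂ - k₁) * crossX f k₁ k₂ p q = potential f k₁ p - potential f k₂ q :=
    mul_div_cancel₀ _ h.gap_pos.ne'
  linarith

theorem lt_crossX_iff (h : LinkedSystem f k₁ k₂ A B D) : x < crossX f k₁ k₂ p q ↔
    potential f k₁ x - potential f k₂ x < potential f k₁ p - potential f k₂ q := by
  rw [crossX, lt_div_iff₀ h.gap_pos, potential_sub_potential, mul_comm]

theorem crossX_lt_iff (h : LinkedSystem f k₁ k₂ A B D) : crossX f k₁ k₂ p q < x ↔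
    potential f k₁ p - potential f k₂ q < potential f k₁ x - potential f k₂ x := by
  rw [crossX, div_lt_iff₀ h.gap_pos, potential_sub_potential, mul_comm]

theorem saddle_lt_crossX_lower (h : LinkedSystem f k₁ k₂ A B D) :
    xSaddle f k₂ < crossX f k₁ k₂ (xLower f k₁ A) (xSaddle f k₂) := by
  rw [h.lt_crossX_iff]
  have := h.potential_lt h.lower_mem_outerArc h.adm.a_mem.1
  linarith

theorem crossX_lower_le (h : LinkedSystem f k₁ k₂ A B D) (hp : p ∈ outerArc f k₁ A B)
    (hq : q ∈ innerArc f k₂ D) :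
    crossX f k₁ k₂ (xLower f k₁ A) (xSaddle f k₂) ≤ crossX f k₁ k₂ p q :=
  h.crossX_le (by rw [h.lower_spec]; exact (h.outer_level_mem hp).1) (h.inner_level_mem hq).2.le

theorem saddle_lt_crossX (h : LinkedSystem f k₁ k₂ A B D) (hp : p ∈ outerArc f k₁ A B)
    (hq : q ∈ innerArc f k₂ D) : xSaddle f k₂ < crossX f k₁ k₂ p q :=
  h.saddle_lt_crossX_lower.trans_le (h.crossX_lower_le hp hq)

theorem lower_lt_upper (h : LinkedSystem f k₁ k₂ A B D) : xLower f k₁ A < xUpper f k₁ B :=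
  (h.adm.a_mem.2.trans h.saddle_lt_hom).trans h.adm.b_mem.1

theorem crossX_lt_upper (h : LinkedSystem f k₁ k₂ A B D) (hp : p ∈ outerArc f k₁ A B)
    (hq : q ∈ innerArc f k₂ D) : crossX f k₁ k₂ p q < xUpper f k₁ B := by
  rw [h.crossX_lt_iff, h.upper_spec]
  have := h.potential_lt_level ⟨h.adm.d_mem.2.trans h.lower_lt_upper, h.adm.b_mem.2⟩
  linarith [(h.outer_level_mem hp).2, (h.inner_level_mem hq).1]

/-- This is where the linking enters: the crossing stays off the `x`-axis. To the right of `d` the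
closed orbit of energy `D` encloses the axis up to `x_+(D) > b`; to the left of `d < a` the
potential of `k₁` is already below `A`. Either bound suffices, as the two kinetic energies coincide.
-/
theorem potential_crossX_lt (h : LinkedSystem f k₁ k₂ A B D) (hp : p ∈ outerArc f k₁ A B)
    (hq : q ∈ innerArc f k₂ D) :
    potential f k₁ (crossX f k₁ k₂ p q) < potential f k₁ p := by
  rcases lt_or_ge (xMinus f k₂ D) (crossX f k₁ k₂ p q) with hlt | hle
  · have h1 := h.potential_lt_level ⟨hlt, (h.crossX_lt_upper hp hq).trans h.adm.b_mem.2⟩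
    have h2 := h.potential_sub_crossX p q
    linarith [(h.inner_level_mem hq).1]
  · have h1 := h.potential_lt h.lower_mem_outerArc (hle.trans_lt h.adm.d_mem.2)
    rw [h.lower_spec] at h1
    exact h1.trans_le (h.outer_level_mem hp).1

theorem potential_crossX_lt' (h : LinkedSystem f k₁ k₂ A B D) (hp : p ∈ outerArc f k₁ A B)
    (hq : q ∈ innerArc f k₂ D) :
    potential f k₂ (crossX f k₁ k₂ p q) < potential f k₂ q := by
  linarith [h.potential_crossX_lt hp hq, h.potential_sub_crossX p q]

/-- This crossing abscissa bounds from above those of all lines with turning point left of the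
saddle. A gap to the saddle remains, and lines close to the separatrix must cross it slowly. -/
theorem crossX_saddle_lt (h : LinkedSystem f k₁ k₂ A B D) :
    crossX f k₁ k₂ (xSaddle f k₁) (xMinus f k₂ D) < xSaddle f k₁ := by
  rw [h.crossX_lt_iff, h.minus_spec.2]
  have := h.potential_lt_level ⟨h.adm.d_mem.2.trans h.adm.a_mem.2,
    (h.saddle_lt_hom.trans h.adm.b_mem.1).trans h.adm.b_mem.2⟩
  linarith

theorem crossX_lt_saddle (h : LinkedSystem f k₁ k₂ A B D)
    (hp : p ∈ Ico (xLower f k₁ A) (xSaddle f k₁))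
    (hq : q ∈ innerArc f k₂ D) : crossX f k₁ k₂ p q < xSaddle f k₁ := by
  refine lt_of_le_of_lt (h.crossX_le ?_ ?_) h.crossX_saddle_lt
  · exact (h.hyp.strictMonoOn_potential_Iic h.pos (mem_Iic.2 hp.2.le) (mem_Iic.2 le_rfl) hp.2).le
  · rw [h.minus_spec.2]
    exact (h.inner_level_mem hq).1

theorem crossX_lt (h : LinkedSystem f k₁ k₂ A B D) (hp : p ∈ outerArc f k₁ A B)
    (hq : q ∈ innerArc f k₂ D) : crossX f k₁ k₂ p q < p := by
  by_contra! hle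
  refine (h.potential_crossX_lt hp hq).not_ge ?_
  rcases hp with hp' | hp'
  · exact (h.hyp.strictMonoOn_potential_Iic h.pos).monotoneOn (mem_Iic.2 hp'.2.le)
      (mem_Iic.2 (h.crossX_lt_saddle hp' hq).le) hle
  · have := ((h.hyp.xHom_spec h.pos).1.trans hp'.1).le
    exact (h.hyp.strictMonoOn_potential_Ici h.pos).monotoneOn (mem_Ici.2 this)
      (mem_Ici.2 (this.trans hle)) hle

theorem lt_crossX (h : LinkedSystem f k₁ k₂ A B D) (hp : p ∈ outerArc f k₁ A B)
    (hq : q ∈ innerArc f k₂ D) : q < crossX f k₁ k₂ p q := by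
  by_contra! hle
  have hq' := h.innerArc_subset hq
  exact (h.potential_crossX_lt' hp hq).not_ge <| (h.hyp.strictAntiOn_potential h.pos₂).antitoneOn
    ⟨(h.saddle_lt_crossX hp hq).le, hle.trans hq'.2.le⟩ (Ioo_subset_Icc_self hq') hle

theorem potential_lt_inner (h : LinkedSystem f k₁ k₂ A B D) (hq : q ∈ innerArc f k₂ D)
    (hx : potential f k₂ x < potential f k₂ q) :
    ∀ s ∈ Ioc q x, potential f k₂ s < potential f k₂ q := by
  intro s hs
  have hq' := h.innerArc_subset hq
  rcases le_total s (xCenter f k₂) with hc | hc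
  · exact h.hyp.strictAntiOn_potential h.pos₂ (Ioo_subset_Icc_self hq') ⟨(hq'.1.trans hs.1).le, hc⟩
      hs.1
  · exact ((h.hyp.strictMonoOn_potential_Ici h.pos₂).monotoneOn (mem_Ici.2 hc)
      (mem_Ici.2 (hc.trans hs.2)) hs.2).trans_lt hx

theorem isTurning_inner (h : LinkedSystem f k₁ k₂ A B D) (hq : q ∈ innerArc f k₂ D) (hqx : q < x)
    (hx : potential f k₂ x < potential f k₂ q) : IsTurning f k₂ q x :=
  .of_lt hqx (h.hyp.apply_lt h.pos₂ (h.innerArc_subset hq)) (h.potential_lt_inner hq hx)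

theorem isTurning_outer_crossX (h : LinkedSystem f k₁ k₂ A B D) (hp : p ∈ outerArc f k₁ A B)
    (hq : q ∈ innerArc f k₂ D) : IsTurning f k₁ p (crossX f k₁ k₂ p q) :=
  h.isTurning_outer hp (h.crossX_lt hp hq)

theorem isTurning_inner_crossX (h : LinkedSystem f k₁ k₂ A B D) (hp : p ∈ outerArc f k₁ A B)
    (hq : q ∈ innerArc f k₂ D) : IsTurning f k₂ q (crossX f k₁ k₂ p q) :=
  h.isTurning_inner hq (h.lt_crossX hp hq) (h.potential_crossX_lt' hp hq)

theorem potential_center_lt (h : LinkedSystem f k₁ k₂ A B D) (hq : q ∈ innerArc f k₂ D) :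
    potential f k₂ (xCenter f k₂) < potential f k₂ q :=
  h.adm.D_mem.1.trans_le (h.inner_level_mem hq).1

theorem isTurning_inner_center (h : LinkedSystem f k₁ k₂ A B D) (hq : q ∈ innerArc f k₂ D) :
    IsTurning f k₂ q (xCenter f k₂) :=
  h.isTurning_inner hq (h.innerArc_subset hq).2 (h.potential_center_lt hq)

theorem isTurning_plus_center (h : LinkedSystem f k₁ k₂ A B D) (hq : q ∈ innerArc f k₂ D) :
    IsTurning f k₂ (xPlus f k₂ (potential f k₂ q)) (xCenter f k₂) := by
  obtain ⟨h1, -⟩ := h.hyp.xPlus_spec (h.potential_center_lt hq)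
  exact .of_gt h1 (h.hyp.lt_apply_of_xCenter_lt h.pos₂ h1) fun s hs =>
    h.hyp.strictMonoOn_potential_Ici h.pos₂ (mem_Ici.2 hs.1) (mem_Ici.2 h1.le) hs.2

/-! ### Integrability and continuity of the times -/

theorem intervalIntegrable_outer (h : LinkedSystem f k₁ k₂ A B D) (hp : p ∈ outerArc f k₁ A B)
    (hx : x < p) : IntervalIntegrable
      (fun s => 1 / √(2 * (potential f k₁ p - potential f k₁ s))) volume x p :=
  ((h.isTurning_outer hp hx).intervalIntegrable h.hyp.continuous).symm

/-- Splitting at the center leaves one turning point in each integral, so that `IsTurning` applies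
to both. The minus sign comes from orienting the second one from its turning point. -/
theorem halfPeriod_eq (h : LinkedSystem f k₁ k₂ A B D) (hq : q ∈ innerArc f k₂ D) :
    halfPeriod f k₂ q = timeMap f k₂ (potential f k₂ q) q (xCenter f k₂) -
      timeMap f k₂ (potential f k₂ (xPlus f k₂ (potential f k₂ q)))
        (xPlus f k₂ (potential f k₂ q)) (xCenter f k₂) := by
  have i₁ := (h.isTurning_inner_center hq).intervalIntegrable h.hyp.continuous
  have i₂ := (h.isTurning_plus_center hq).intervalIntegrable h.hyp.continuous
  rw [(h.hyp.xPlus_spec (h.potential_center_lt hq)).2] at i₂ ⊢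
  rw [halfPeriod, timeMap, timeMap, timeMap,
    ← intervalIntegral.integral_add_adjacent_intervals i₁ i₂.symm, intervalIntegral.integral_symm
      (xPlus f k₂ (potential f k₂ q)), sub_eq_add_neg]

theorem intervalIntegrable_period (h : LinkedSystem f k₁ k₂ A B D) (hq : q ∈ innerArc f k₂ D) :
    IntervalIntegrable (fun s => 1 / √(2 * (potential f k₂ q - potential f k₂ s))) volume q
      (xPlus f k₂ (potential f k₂ q)) := by
  have i₁ := (h.isTurning_inner_center hq).intervalIntegrable h.hyp.continuous
  have i₂ := (h.isTurning_plus_center hq).intervalIntegrable h.hyp.continuous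
  rw [(h.hyp.xPlus_spec (h.potential_center_lt hq)).2] at i₂
  exact i₁.trans i₂.symm

theorem continuous_crossX (h : LinkedSystem f k₁ k₂ A B D) :
    Continuous fun z : ℝ × ℝ => crossX f k₁ k₂ z.1 z.2 := by
  have h1 := continuous_potential h.hyp.continuous k₁
  have h2 := continuous_potential h.hyp.continuous k₂
  unfold crossX
  fun_prop

theorem continuous_crossPt (h : LinkedSystem f k₁ k₂ A B D) :
    Continuous fun z : ℝ × ℝ => crossPt f k₁ k₂ z.1 z.2 := by
  have h1 := continuous_potential h.hyp.continuous k₁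
  have h2 := h.continuous_crossX
  unfold crossPt
  fun_prop

theorem continuousOn_outerTime (h : LinkedSystem f k₁ k₂ A B D) :
    ContinuousOn (fun z : ℝ × ℝ => outerTime f k₁ k₂ z.1 z.2)
      (outerArc f k₁ A B ×ˢ innerArc f k₂ D) := fun z hz => by
  have h1 := (h.isTurning_outer_crossX hz.1 hz.2).continuousAt_timeMap h.hyp.continuous
  have h2 : ContinuousAt (fun z : ℝ × ℝ => (z.1, crossX f k₁ k₂ z.1 z.2)) z :=
    (continuous_fst.prodMk h.continuous_crossX).continuousAt
  have h3 := (ContinuousAt.comp (f := fun z : ℝ × ℝ => (z.1, crossX f k₁ k₂ z.1 z.2)) h1 h2).neg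
  refine h3.continuousWithinAt.congr (fun w _ => ?_) ?_ <;>
    exact intervalIntegral.integral_symm _ _

theorem continuousOn_innerTime (h : LinkedSystem f k₁ k₂ A B D) :
    ContinuousOn (fun z : ℝ × ℝ => innerTime f k₁ k₂ z.1 z.2)
      (outerArc f k₁ A B ×ˢ innerArc f k₂ D) := fun z hz => by
  have h1 := (h.isTurning_inner_crossX hz.1 hz.2).continuousAt_timeMap h.hyp.continuous
  have h2 : ContinuousAt (fun z : ℝ × ℝ => (z.2, crossX f k₁ k₂ z.1 z.2)) z :=
    (continuous_snd.prodMk h.continuous_crossX).continuousAt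
  exact (ContinuousAt.comp (f := fun z : ℝ × ℝ => (z.2, crossX f k₁ k₂ z.1 z.2)) h1
    h2).continuousWithinAt

theorem continuousOn_halfPeriod (h : LinkedSystem f k₁ k₂ A B D) :
    ContinuousOn (halfPeriod f k₂) (innerArc f k₂ D) := fun q hq => by
  have hplus : ContinuousWithinAt (fun q => xPlus f k₂ (potential f k₂ q)) (innerArc f k₂ D) q := by
    refine (h.hyp.strictMonoOn_potential_Ici h.pos₂).continuousWithinAt_of_comp ordConnected_Ici
      (fun r hr => mem_Ici.2 (h.hyp.xPlus_spec (h.potential_center_lt hr)).1.le) hq ?_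
    exact (continuous_potential h.hyp.continuous k₂).continuousWithinAt.congr
      (fun r hr => (h.hyp.xPlus_spec (h.potential_center_lt hr)).2)
      (h.hyp.xPlus_spec (h.potential_center_lt hq)).2
  have h1 := (h.isTurning_inner_center hq).continuousAt_timeMap h.hyp.continuous
  have h2 := (h.isTurning_plus_center hq).continuousAt_timeMap h.hyp.continuous
  have h3 : ContinuousWithinAt (fun q => timeMap f k₂ (potential f k₂ q) q (xCenter f k₂))
      (innerArc f k₂ D) q :=
    (ContinuousAt.comp (f := fun q : ℝ => (q, xCenter f k₂)) h1
      (by fun_prop)).continuousWithinAt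
  have h4 : ContinuousWithinAt (fun q => timeMap f k₂
      (potential f k₂ (xPlus f k₂ (potential f k₂ q))) (xPlus f k₂ (potential f k₂ q))
      (xCenter f k₂)) (innerArc f k₂ D) q :=
    ContinuousAt.comp_continuousWithinAt
      (f := fun q : ℝ => (xPlus f k₂ (potential f k₂ q), xCenter f k₂)) h2
      (hplus.prodMk continuousWithinAt_const)
  exact (h3.sub h4).congr (fun r hr => h.halfPeriod_eq hr) (h.halfPeriod_eq hq)

/-! ### The orbit arcs -/

theorem crossPt_snd_pos (h : LinkedSystem f k₁ k₂ A B D) (hp : p ∈ outerArc f k₁ A B)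
    (hq : q ∈ innerArc f k₂ D) : 0 < (crossPt f k₁ k₂ p q).2 :=
  Real.sqrt_pos.2 (by linarith [h.potential_crossX_lt hp hq])

theorem energy_crossPt (h : LinkedSystem f k₁ k₂ A B D) (hp : p ∈ outerArc f k₁ A B)
    (hq : q ∈ innerArc f k₂ D) :
    energy f k₁ (crossPt f k₁ k₂ p q) = potential f k₁ p ∧
      energy f k₂ (crossPt f k₁ k₂ p q) = potential f k₂ q := by
  have h1 := h.potential_crossX_lt hp hq
  have h2 := h.potential_sub_crossX p q
  have h3 := Real.sq_sqrt (show 0 ≤ 2 * (potential f k₁ p -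
    potential f k₁ (crossX f k₁ k₂ p q)) by linarith)
  simp only [energy, crossPt, h3]
  constructor <;> linarith

/-- Both regions depend on `y` only through `y²`, which treats the upper and the lower crossing at
once. -/
theorem mem_annulus_inter_strip (h : LinkedSystem f k₁ k₂ A B D) (hp : p ∈ outerArc f k₁ A B)
    (hq : q ∈ innerArc f k₂ D) {z : ℝ × ℝ} (hz : z.1 = (crossPt f k₁ k₂ p q).1)
    (hz' : z.2 ^ 2 = (crossPt f k₁ k₂ p q).2 ^ 2) :
    z ∈ annulus f k₂ D ∩ strip f k₁ A B := by
  obtain ⟨e1, e2⟩ := h.energy_crossPt hp hq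
  have hE : ∀ k, energy f k z = energy f k (crossPt f k₁ k₂ p q) := fun k => by
    simp only [energy, hz, hz']
  have hi := h.inner_level_mem hq
  have ho := h.outer_level_mem hp
  refine ⟨?_, ?_⟩
  · simp only [annulus, mem_ofPred_eq, hE, e2, hz]
    exact ⟨hi.1, hi.2.le, (h.saddle_lt_crossX hp hq).le⟩
  · simp only [strip, mem_union, mem_ofPred_eq, hE, e1, hz]
    rcases hp with hp' | hp'
    · exact Or.inl ⟨ho.1, (h.hyp.strictMonoOn_potential_Iic h.pos (mem_Iic.2 hp'.2.le)
        (mem_Iic.2 le_rfl) hp'.2).le, (h.crossX_lt_saddle hp' hq).le⟩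
    · refine Or.inr ⟨?_, ho.2⟩
      exact (h.potential_lt (Or.inr hp') (h.saddle_lt_hom.trans hp'.1)).le

theorem crossPt_mem_rectM (h : LinkedSystem f k₁ k₂ A B D) (hp : p ∈ outerArc f k₁ A B)
    (hq : q ∈ innerArc f k₂ D) : crossPt f k₁ k₂ p q ∈ rectM f k₁ k₂ A B D :=
  ⟨h.mem_annulus_inter_strip hp hq rfl rfl, h.crossPt_snd_pos hp hq⟩

theorem crossPt_mem_rectN (h : LinkedSystem f k₁ k₂ A B D) (hp : p ∈ outerArc f k₁ A B)
    (hq : q ∈ innerArc f k₂ D) :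
    ((crossPt f k₁ k₂ p q).1, -(crossPt f k₁ k₂ p q).2) ∈ rectN f k₁ k₂ A B D :=
  ⟨h.mem_annulus_inter_strip hp hq rfl (neg_sq _), neg_neg_of_pos (h.crossPt_snd_pos hp hq)⟩

theorem reaches_outer (h : LinkedSystem f k₁ k₂ A B D) (hp : p ∈ outerArc f k₁ A B)
    (hq : q ∈ innerArc f k₂ D) :
    Reaches f k₁ (crossPt f k₁ k₂ p q) (p, 0) (outerTime f k₁ k₂ p q) := by
  have hx := h.crossX_lt hp hq
  have := (reaches_of_level h.hyp.continuous hx (fun s hs => h.potential_lt hp hs.2)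
    (h.intervalIntegrable_outer hp hx)).2
  simp only [sub_self, mul_zero, Real.sqrt_zero] at this
  exact this

theorem reaches_inner (h : LinkedSystem f k₁ k₂ A B D) (hp : p ∈ outerArc f k₁ A B)
    (hq : q ∈ innerArc f k₂ D) :
    Reaches f k₂ (q, 0) (crossPt f k₁ k₂ p q) (innerTime f k₁ k₂ p q) := by
  have hx := h.lt_crossX hp hq
  have := (reaches_of_level h.hyp.continuous hx
    (fun s hs => h.potential_lt_inner hq (h.potential_crossX_lt' hp hq) s ⟨hs.1, hs.2.le⟩)
    ((h.isTurning_inner_crossX hp hq).intervalIntegrable h.hyp.continuous)).2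
  simp only [sub_self, mul_zero, Real.sqrt_zero, ← h.potential_sub_crossX] at this
  exact this

theorem reaches_halfPeriod (h : LinkedSystem f k₁ k₂ A B D) (hq : q ∈ innerArc f k₂ D) :
    0 < halfPeriod f k₂ q ∧ Reaches f k₂ (q, 0) (xPlus f k₂ (potential f k₂ q), 0)
      (halfPeriod f k₂ q) := by
  obtain ⟨h1, h2⟩ := h.hyp.xPlus_spec (h.potential_center_lt hq)
  have hc := (h.innerArc_subset hq).2
  have := reaches_of_level h.hyp.continuous (hc.trans h1) (fun s hs => by
    rcases le_total s (xCenter f k₂) with hsc | hsc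
    · exact h.potential_lt_inner hq (h.potential_center_lt hq) s ⟨hs.1, hsc⟩
    · have := h.hyp.strictMonoOn_potential_Ici h.pos₂ (mem_Ici.2 hsc) (mem_Ici.2 h1.le) hs.2
      rwa [h2] at this) (h.intervalIntegrable_period hq)
  simp only [h2, sub_self, mul_zero, Real.sqrt_zero] at this
  exact this

/-- From the upper to the lower crossing point along a level line of `k₁`. -/
theorem reaches_upper_lower (h : LinkedSystem f k₁ k₂ A B D) (hp : p ∈ outerArc f k₁ A B)
    (hq : q ∈ innerArc f k₂ D) (hq' : q' ∈ innerArc f k₂ D) :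
    Reaches f k₁ (crossPt f k₁ k₂ p q) ((crossPt f k₁ k₂ p q').1, -(crossPt f k₁ k₂ p q').2)
      (outerTime f k₁ k₂ p q + outerTime f k₁ k₂ p q') := by
  have := (h.reaches_outer hp hq').reverse h.hyp.continuous
  simp only [neg_zero] at this
  exact (h.reaches_outer hp hq).trans h.hyp.continuous this

/-- From the lower to the upper crossing point along a level line of `k₂`, with `j` additional
turns. -/
theorem reaches_lower_upper (h : LinkedSystem f k₁ k₂ A B D) (hp : p ∈ outerArc f k₁ A B)
    (hp' : p' ∈ outerArc f k₁ A B) (hq : q ∈ innerArc f k₂ D) (j : ℕ) :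
    Reaches f k₂ ((crossPt f k₁ k₂ p q).1, -(crossPt f k₁ k₂ p q).2) (crossPt f k₁ k₂ p' q)
      (innerTime f k₁ k₂ p q + innerTime f k₁ k₂ p' q + j * (2 * halfPeriod f k₂ q)) := by
  have hc := h.hyp.continuous
  have h1 := (h.reaches_inner hp hq).reverse hc
  have h2 := (h.reaches_halfPeriod hq).2
  have h3 := h2.reverse hc
  simp only [neg_zero] at h1 h3
  have h4 := (h1.trans hc ((h2.trans hc h3).iterate hc j)).trans hc (h.reaches_inner hp' hq)
  convert h4 using 1
  ring

/-! ### Bounds of the times -/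

/-- `x_u(k₂)` lies left of every crossing, so the time measured from there is an upper bound that no
longer depends on `q`. -/
theorem outerTime_lower_le (h : LinkedSystem f k₁ k₂ A B D) (hq : q ∈ innerArc f k₂ D) :
    2 * outerTime f k₁ k₂ (xLower f k₁ A) q ≤ tauStar₁ f k₁ k₂ A B := by
  have hp := h.lower_mem_outerArc
  have i := h.intervalIntegrable_outer hp h.adm.a_mem.1
  have := timeMap_mono (h.saddle_lt_crossX hp hq).le (h.crossX_lt hp hq).le le_rfl i
  rw [h.lower_spec] at this
  refine le_trans ?_ (le_max_left _ _)
  rw [tauV, outerTime, h.lower_spec]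
  linarith

theorem outerTime_upper_le (h : LinkedSystem f k₁ k₂ A B D) (hq : q ∈ innerArc f k₂ D) :
    2 * outerTime f k₁ k₂ (xUpper f k₁ B) q ≤ tauStar₁ f k₁ k₂ A B := by
  have hp := h.upper_mem_outerArc
  have i := h.intervalIntegrable_outer hp (h.adm.a_mem.1.trans h.lower_lt_upper)
  have := timeMap_mono (h.saddle_lt_crossX hp hq).le (h.crossX_lt hp hq).le le_rfl i
  rw [h.upper_spec] at this
  refine le_trans ?_ (le_max_right _ _)
  rw [tauU, outerTime, h.upper_spec]
  linarith

/-- Every crossing lies left of `b`, which gives a bound independent of `p`. -/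
theorem innerTime_le (h : LinkedSystem f k₁ k₂ A B D) (hp : p ∈ outerArc f k₁ A B) :
    innerTime f k₁ k₂ p (xMinus f k₂ D) ≤ tauO f k₂ D (xUpper f k₁ B) := by
  have hq := h.minus_mem_innerArc
  have hlt := h.potential_lt_level ⟨h.adm.d_mem.2.trans h.lower_lt_upper, h.adm.b_mem.2⟩
  have i := (h.isTurning_inner hq (h.adm.d_mem.2.trans h.lower_lt_upper)
    (by rwa [h.minus_spec.2])).intervalIntegrable h.hyp.continuous
  have := timeMap_mono le_rfl (h.lt_crossX hp hq).le (h.crossX_lt_upper hp hq).le i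
  rw [h.minus_spec.2] at this
  rwa [tauO, innerTime, h.minus_spec.2]

theorem innerTime_add_le (h : LinkedSystem f k₁ k₂ A B D) (hp : p ∈ outerArc f k₁ A B)
    (hp' : p' ∈ outerArc f k₁ A B) {j m : ℕ} (hj : j < m) :
    innerTime f k₁ k₂ p (xMinus f k₂ D) + innerTime f k₁ k₂ p' (xMinus f k₂ D)
      + j * (2 * halfPeriod f k₂ (xMinus f k₂ D)) ≤ tauStar₂ f k₁ k₂ B D m := by
  have h1 := h.innerTime_le hp
  have h2 := h.innerTime_le hp'
  have h3 := (h.reaches_halfPeriod h.minus_mem_innerArc).1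
  have h4 : periodO f k₂ D = 2 * halfPeriod f k₂ (xMinus f k₂ D) := by
    rw [periodO, tauO, halfPeriod, h.minus_spec.2]
  have h5 : (j : ℝ) ≤ m - 1 := by
    have : ((j + 1 : ℕ) : ℝ) ≤ m := by exact_mod_cast hj
    push_cast at this
    linarith
  rw [tauStar₂, h4]
  have := mul_le_mul_of_nonneg_right h5 (by linarith : 0 ≤ 2 * halfPeriod f k₂ (xMinus f k₂ D))
  linarith

theorem outerTime_blowup (h : LinkedSystem f k₁ k₂ A B D) (τ : ℝ) :
    (∃ p ∈ Ioo (xLower f k₁ A) (xSaddle f k₁), ∀ q ∈ innerArc f k₂ D,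
      τ < outerTime f k₁ k₂ p q) ∧
    ∃ p ∈ Ioo (xHom f k₁) (xUpper f k₁ B), ∀ q ∈ innerArc f k₂ D,
      τ < outerTime f k₁ k₂ p q := by
  -- The segment from `x₁` to `x₂`, ending close to the saddle, is part of every arc considered.
  -- Among the crossings of a fixed line `p` the rightmost is the one with the orbit of energy `D`,
  -- which makes the estimate uniform in `q`.
  obtain ⟨x₁, hx₁, hx₁'⟩ := exists_between h.crossX_saddle_lt
  obtain ⟨x₂, hx₂, hax₂, ε, hε, H⟩ := exists_lt_timeMap_left h.hyp.locallyLipschitz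
    (h.hyp.xSaddle_spec h.pos).2 hx₁' h.adm.a_mem.2 τ
  have key : ∀ p ∈ outerArc f k₁ A B, x₂ < p →
      potential f k₁ p ≤ potential f k₁ (xSaddle f k₁) + ε →
      crossX f k₁ k₂ p (xMinus f k₂ D) ≤ x₁ → ∀ q ∈ innerArc f k₂ D,
      τ < outerTime f k₁ k₂ p q := by
    intro p hp hxp hpε hpx q hq
    refine (H _ hpε fun s hs => h.potential_lt hp (hs.2.trans_lt hxp)).trans_le ?_
    refine timeMap_mono (le_trans (h.crossX_le le_rfl ?_) hpx) hx₂.1.le hxp.le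
      (h.intervalIntegrable_outer hp (h.crossX_lt hp hq))
    rw [h.minus_spec.2]
    exact (h.inner_level_mem hq).1
  constructor
  · obtain ⟨p, hp⟩ := exists_between hx₂.2
    have hle : potential f k₁ p ≤ potential f k₁ (xSaddle f k₁) :=
      (h.hyp.strictMonoOn_potential_Iic h.pos (mem_Iic.2 hp.2.le) (mem_Iic.2 le_rfl) hp.2).le
    refine ⟨p, ⟨hax₂.trans hp.1, hp.2⟩, key p (Or.inl ⟨(hax₂.trans hp.1).le, hp.2⟩) hp.1
      (by linarith) ((h.crossX_le hle le_rfl).trans hx₁.le)⟩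
  · have hΦ := continuous_potential h.hyp.continuous k₁
    have hhe := (h.hyp.xHom_spec h.pos).2
    have h1 : ∀ᶠ p in 𝓝 (xHom f k₁), potential f k₁ p < potential f k₁ (xSaddle f k₁) + ε :=
      hΦ.continuousAt.eventually_lt_const (by rw [hhe]; linarith)
    -- `x_h(k₁)` and the saddle have the same level, hence the same crossings; continuity extends
    -- the bound to nearby `p`.
    have h2 : ∀ᶠ p in 𝓝 (xHom f k₁), crossX f k₁ k₂ p (xMinus f k₂ D) < x₁ := by
      have hc : Continuous fun p => crossX f k₁ k₂ p (xMinus f k₂ D) :=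
        h.continuous_crossX.comp (Continuous.prodMk_left (xMinus f k₂ D))
      refine hc.continuousAt.eventually_lt_const ?_
      simpa only [crossX, hhe] using hx₁
    have h3 : ∀ᶠ p in 𝓝[>] xHom f k₁, p ∈ Ioo (xHom f k₁) (xUpper f k₁ B) :=
      Ioo_mem_nhdsGT h.adm.b_mem.1
    obtain ⟨p, ⟨hp1, hp2⟩, hp3⟩ := (((h1.and h2).filter_mono nhdsWithin_le_nhds).and h3).exists
    exact ⟨p, hp3, key p (Or.inr ⟨hp3.1, hp3.2.le⟩) (hx₂.2.trans (h.saddle_lt_hom.trans hp3.1))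
      hp1.le hp2.le⟩

/-- The leftmost conceivable crossing, that of level `A` with the homoclinic orbit, is still right
of the saddle of `k₂`, so the slow passage near this saddle is part of every arc, uniformly in `p`.
-/
theorem innerTime_blowup (h : LinkedSystem f k₁ k₂ A B D) (τ : ℝ) :
    ∃ q ∈ Ioo (xSaddle f k₂) (xMinus f k₂ D), ∀ p ∈ outerArc f k₁ A B,
      τ < innerTime f k₁ k₂ p q := by
  obtain ⟨x₂, hx₂, hx₂d, H⟩ := exists_lt_timeMap_right h.hyp.locallyLipschitz
    (h.hyp.xSaddle_spec h.pos₂).2 h.saddle_lt_crossX_lower h.adm.d_mem.1 τ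
  obtain ⟨q, hq⟩ := exists_between hx₂.1
  have hqm : q ∈ innerArc f k₂ D := ⟨hq.1, (hq.2.trans hx₂d).le⟩
  refine ⟨q, ⟨hq.1, hq.2.trans hx₂d⟩, fun p hp => ?_⟩
  have hle := h.crossX_lower_le hp hqm
  refine (H _ (h.inner_level_mem hqm).2.le fun s hs => ?_).trans_le ?_
  · exact h.potential_lt_inner hqm (h.potential_crossX_lt' hp hqm) s
      ⟨hq.2.trans_le hs.1, hs.2.trans hle⟩
  · exact timeMap_mono hq.2.le hx₂.2.le hle
      ((h.isTurning_inner_crossX hp hqm).intervalIntegrable h.hyp.continuous)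

end LinkedSystem

/-! ### Periodic itineraries and the proof of the theorem -/

/-- The Poincaré-Miranda theorem for a cyclic chain of equations. -/
theorem exists_cyclic_solution {l : ℕ} [NeZero l] {lo hi : ZMod l → ℝ} (hlh : ∀ i, lo i ≤ hi i)
    {c d : ℝ} (hcd : c ≤ d) {G H : ZMod l → ℝ × ℝ × ℝ → ℝ}
    (hG : ∀ i, ContinuousOn (G i) (Icc (lo i) (hi i) ×ˢ Icc c d ×ˢ Icc c d))
    (hG₀ : ∀ i, ∀ q ∈ Icc c d, ∀ q' ∈ Icc c d, G i (lo i, q, q') ≤ 0)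
    (hG₁ : ∀ i, ∀ q ∈ Icc c d, ∀ q' ∈ Icc c d, 0 ≤ G i (hi i, q, q'))
    (hH : ∀ i, ContinuousOn (H i)
      (Icc c d ×ˢ Icc (lo i) (hi i) ×ˢ Icc (lo (i + 1)) (hi (i + 1))))
    (hH₀ : ∀ i, ∀ p ∈ Icc (lo i) (hi i), ∀ p' ∈ Icc (lo (i + 1)) (hi (i + 1)), H i (c, p, p') ≤ 0)
    (hH₁ : ∀ i, ∀ p ∈ Icc (lo i) (hi i), ∀ p' ∈ Icc (lo (i + 1)) (hi (i + 1)),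
      0 ≤ H i (d, p, p')) :
    ∃ P Q : ZMod l → ℝ, ∀ i, P i ∈ Icc (lo i) (hi i) ∧ Q i ∈ Icc c d ∧
      G i (P i, Q i, Q (i + 1)) = 0 ∧ H i (Q (i + 1), P i, P (i + 1)) = 0 := by
  set L : ZMod l ⊕ ZMod l → ℝ := Sum.elim lo fun _ => c
  set U : ZMod l ⊕ ZMod l → ℝ := Sum.elim hi fun _ => d
  -- the coordinate `inr i` is `Q (i + 1)`
  set F : (ZMod l ⊕ ZMod l → ℝ) → ZMod l ⊕ ZMod l → ℝ := fun z => Sum.elim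
    (fun i => G i (z (.inl i), z (.inr (i - 1)), z (.inr i)))
    (fun i => H i (z (.inr i), z (.inl i), z (.inl (i + 1))))
  have hP : ∀ z ∈ Icc L U, ∀ i, z (.inl i) ∈ Icc (lo i) (hi i) := fun z hz i =>
    ⟨hz.1 (.inl i), hz.2 (.inl i)⟩
  have hQ : ∀ z ∈ Icc L U, ∀ i, z (.inr i) ∈ Icc c d := fun z hz i =>
    ⟨hz.1 (.inr i), hz.2 (.inr i)⟩
  have hF : ContinuousOn F (Icc L U) := by
    refine continuousOn_pi.2 ?_
    rintro (i | i)
    · exact (hG i).comp (f := fun z : ZMod l ⊕ ZMod l → ℝ =>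
        (z (.inl i), z (.inr (i - 1)), z (.inr i))) (by fun_prop)
        fun z hz => ⟨hP z hz i, hQ z hz _, hQ z hz _⟩
    · exact (hH i).comp (f := fun z : ZMod l ⊕ ZMod l → ℝ =>
        (z (.inr i), z (.inl i), z (.inl (i + 1)))) (by fun_prop)
        fun z hz => ⟨hQ z hz _, hP z hz _, hP z hz _⟩
  obtain ⟨z, hz, hz0⟩ := exists_eq_zero_of_box (l := L) (u := U)
    (by rintro (i | i); exacts [hlh i, hcd]) hF
    (by
      rintro z hz (i | i) hi
      · change G i (z (.inl i), _, _) ≤ 0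
        rw [hi]; exact hG₀ i _ (hQ z hz _) _ (hQ z hz _)
      · change H i (z (.inr i), _, _) ≤ 0
        rw [hi]; exact hH₀ i _ (hP z hz _) _ (hP z hz _))
    (by
      rintro z hz (i | i) hi
      · change 0 ≤ G i (z (.inl i), _, _)
        rw [hi]; exact hG₁ i _ (hQ z hz _) _ (hQ z hz _)
      · change 0 ≤ H i (z (.inr i), _, _)
        rw [hi]; exact hH₁ i _ (hP z hz _) _ (hP z hz _))
  refine ⟨fun i => z (.inl i), fun i => z (.inr (i - 1)), fun i => ⟨hP z hz i, hQ z hz _, ?_, ?_⟩⟩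
  · have : G i (z (.inl i), z (.inr (i - 1)), z (.inr i)) = 0 := congrFun hz0 (.inl i)
    simpa only [add_sub_cancel_right] using this
  · have : H i (z (.inr i), z (.inl i), z (.inl (i + 1))) = 0 := congrFun hz0 (.inr i)
    simpa only [add_sub_cancel_right] using this

/-- The time between the crossing points of the level line of `k₁` with turning point `p`, as a
function of `(p, q, q')`. -/
def outerTravel (f : ℝ → ℝ) (k₁ k₂ : ℝ) (v : ℝ × ℝ × ℝ) : ℝ :=
  outerTime f k₁ k₂ v.1 v.2.1 + outerTime f k₁ k₂ v.1 v.2.2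

/-- The time between the crossing points of the level line of `k₂` with turning point `q`, with `j`
additional turns, as a function of `(q, p, p')`. -/
def innerTravel (f : ℝ → ℝ) (k₁ k₂ : ℝ) (j : ℕ) (v : ℝ × ℝ × ℝ) : ℝ :=
  innerTime f k₁ k₂ v.2.1 v.1 + innerTime f k₁ k₂ v.2.2 v.1 + j * (2 * halfPeriod f k₂ v.1)

namespace LinkedSystem

variable {f : ℝ → ℝ} {k₁ k₂ A B D : ℝ}

theorem continuousOn_outerTravel (h : LinkedSystem f k₁ k₂ A B D) :
    ContinuousOn (outerTravel f k₁ k₂)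
      (outerArc f k₁ A B ×ˢ innerArc f k₂ D ×ˢ innerArc f k₂ D) :=
  (h.continuousOn_outerTime.comp (f := fun v : ℝ × ℝ × ℝ => (v.1, v.2.1)) (by fun_prop)
    fun _ hv => ⟨hv.1, hv.2.1⟩).add
  (h.continuousOn_outerTime.comp (f := fun v : ℝ × ℝ × ℝ => (v.1, v.2.2)) (by fun_prop)
    fun _ hv => ⟨hv.1, hv.2.2⟩)

theorem continuousOn_innerTravel (h : LinkedSystem f k₁ k₂ A B D) (j : ℕ) :
    ContinuousOn (innerTravel f k₁ k₂ j)
      (innerArc f k₂ D ×ˢ outerArc f k₁ A B ×ˢ outerArc f k₁ A B) :=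
  ((h.continuousOn_innerTime.comp (f := fun v : ℝ × ℝ × ℝ => (v.2.1, v.1)) (by fun_prop)
    fun _ hv => ⟨hv.2.1, hv.1⟩).add
  (h.continuousOn_innerTime.comp (f := fun v : ℝ × ℝ × ℝ => (v.2.2, v.1)) (by fun_prop)
    fun _ hv => ⟨hv.2.2, hv.1⟩)).add
  (((h.continuousOn_halfPeriod.comp (f := fun v : ℝ × ℝ × ℝ => v.1) (by fun_prop)
    fun _ hv => hv.1).const_mul 2).const_mul (j : ℝ))

/-- Every point of the annulus in the lower half-plane has a forward orbit under the second system
up to any given time. -/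
theorem exists_reaches_of_mem_annulus (h : LinkedSystem f k₁ k₂ A B D) {z : ℝ × ℝ}
    (hz : z ∈ annulus f k₂ D) (hz' : z.2 < 0) {t : ℝ} (ht : 0 ≤ t) : ∃ w, Reaches f k₂ z w t := by
  obtain ⟨hD, hu, hx⟩ := hz
  have hc := h.hyp.continuous
  set ρ := energy f k₂ z
  have hρ : ρ = z.2 ^ 2 / 2 + potential f k₂ z.1 := rfl
  have hlt : potential f k₂ z.1 < ρ := by nlinarith
  have hsq : √(2 * (ρ - potential f k₂ z.1)) = -z.2 := by
    rw [show 2 * (ρ - potential f k₂ z.1) = (-z.2) ^ 2 by rw [hρ]; ring,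
      Real.sqrt_sq (by linarith)]
  suffices ∃ w, ∃ τ ≥ t, Reaches f k₂ z w τ by
    obtain ⟨w, τ, hτ, hr⟩ := this
    exact hr.restrict ht hτ
  have hanti := h.hyp.strictAntiOn_potential h.pos₂
  -- On a closed orbit, enough full turns exceed the time `t`. On the homoclinic orbit the point
  -- moves towards the saddle, and the approach takes arbitrarily long.
  rcases hu.lt_or_eq with hu | hu
  · obtain ⟨hq, hqρ⟩ := h.hyp.xMinus_spec h.pos₂ ⟨h.adm.D_mem.1.trans_le hD, hu⟩
    set q := xMinus f k₂ ρ
    have hqm : q ∈ innerArc f k₂ D := by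
      refine ⟨hq.1, ?_⟩
      rw [← hanti.le_iff_ge (Ioo_subset_Icc_self (h.innerArc_subset h.minus_mem_innerArc))
        (Ioo_subset_Icc_self hq), h.minus_spec.2, hqρ]
      exact hD
    have hqx : q < z.1 := by
      by_contra! hle
      have := hanti.antitoneOn ⟨hx, hle.trans hq.2.le⟩ (Ioo_subset_Icc_self hq) hle
      linarith
    have h1 := (reaches_of_level hc hqx
      (fun s hs => h.potential_lt_inner hqm (hqρ.symm ▸ hlt) s ⟨hs.1, hs.2.le⟩)
      ((h.isTurning_inner hqm hqx (hqρ.symm ▸ hlt)).intervalIntegrable hc)).2.reverse hc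
    simp only [sub_self, mul_zero, Real.sqrt_zero, neg_zero, hqρ, hsq, neg_neg] at h1
    obtain ⟨hpos, h2⟩ := h.reaches_halfPeriod hqm
    have h3 := h2.reverse hc
    simp only [neg_zero] at h3
    obtain ⟨n, hn⟩ := exists_nat_ge (t / (halfPeriod f k₂ q + halfPeriod f k₂ q))
    rw [div_le_iff₀ (by positivity)] at hn
    refine ⟨_, _, ?_, h1.trans hc ((h2.trans hc h3).iterate hc n)⟩
    linarith [h1.1]
  · have hux : xSaddle f k₂ < z.1 := lt_of_le_of_ne hx fun e => by
      rw [← e, ← hu] at hlt; exact hlt.false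
    have hlts : ∀ s ∈ Ioc (xSaddle f k₂) z.1, potential f k₂ s < ρ := fun s hs => by
      rcases le_total s (xCenter f k₂) with hsc | hsc
      · rw [hu]
        exact hanti (left_mem_Icc.2 (hs.1.le.trans hsc)) ⟨hs.1.le, hsc⟩ hs.1
      · exact ((h.hyp.strictMonoOn_potential_Ici h.pos₂).monotoneOn (mem_Ici.2 hsc)
          (mem_Ici.2 (hsc.trans hs.2)) hs.2).trans_lt hlt
    obtain ⟨x₂, hx₂, -, H⟩ := exists_lt_timeMap_right h.hyp.locallyLipschitz
      (h.hyp.xSaddle_spec h.pos₂).2 hux hux t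
    have hlts' : ∀ s ∈ Icc x₂ z.1, potential f k₂ s < ρ := fun s hs =>
      hlts s ⟨hx₂.1.trans_le hs.1, hs.2⟩
    have h1 := (reaches_of_level hc hx₂.2 (fun s hs => hlts' s (Ioo_subset_Icc_self hs))
      (intervalIntegrable_of_lt hc hx₂.2.le hlts')).2.reverse hc
    simp only [hsq, neg_neg] at h1
    exact ⟨_, _, (H ρ hu.le hlts').le, h1⟩

end LinkedSystem

/-! ### Timed orbit segments and their coding -/

/-- Compact arcs of turning points at whose ends the travel times lie on different sides of `t₁` and
`t₂`. -/
structure TimedArcs (f : ℝ → ℝ) (k₁ k₂ A B D t₁ t₂ : ℝ) (m : ℕ) (lo hi : Fin 2 → ℝ) (c d : ℝ) :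
    Prop extends LinkedSystem f k₁ k₂ A B D where
  lo_le : ∀ i, lo i ≤ hi i
  c_le : c ≤ d
  subset_outer : ∀ i, Icc (lo i) (hi i) ⊆ outerArc f k₁ A B
  subset_inner : Icc c d ⊆ innerArc f k₂ D
  hi_zero : hi 0 < xSaddle f k₁
  lo_one : xHom f k₁ < lo 1
  outer_lo : ∀ q ∈ Icc c d, ∀ q' ∈ Icc c d, outerTravel f k₁ k₂ (lo 0, q, q') ≤ t₁ ∧
    t₁ ≤ outerTravel f k₁ k₂ (lo 1, q, q')
  outer_hi : ∀ q ∈ Icc c d, ∀ q' ∈ Icc c d, t₁ ≤ outerTravel f k₁ k₂ (hi 0, q, q') ∧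
    outerTravel f k₁ k₂ (hi 1, q, q') ≤ t₁
  inner : ∀ p ∈ outerArc f k₁ A B, ∀ p' ∈ outerArc f k₁ A B, ∀ j < m,
    t₂ ≤ innerTravel f k₁ k₂ j (c, p, p') ∧ innerTravel f k₁ k₂ j (d, p, p') ≤ t₂

theorem LinkedSystem.exists_timedArcs {f : ℝ → ℝ} {k₁ k₂ A B D t₁ t₂ : ℝ} {m : ℕ}
    (h : LinkedSystem f k₁ k₂ A B D) (ht₁ : tauStar₁ f k₁ k₂ A B < t₁)
    (ht₂ : tauStar₂ f k₁ k₂ B D m < t₂) :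
    ∃ lo hi c d, TimedArcs f k₁ k₂ A B D t₁ t₂ m lo hi c d := by
  -- Halves, because a travel time is the sum of two such times. The slow ends are `pL`, `pR` and
  -- `c`; the fast ends are `a`, `b` and `d`.
  obtain ⟨⟨pL, hpL, HL⟩, pR, hpR, HR⟩ := h.outerTime_blowup (t₁ / 2)
  obtain ⟨c, hc, Hc⟩ := h.innerTime_blowup (t₂ / 2)
  have hsub : Icc c (xMinus f k₂ D) ⊆ innerArc f k₂ D := fun q hq => ⟨hc.1.trans_le hq.1, hq.2⟩
  refine ⟨![xLower f k₁ A, pR], ![pL, xUpper f k₁ B], c, xMinus f k₂ D,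
    { toLinkedSystem := h
      lo_le := ?_, c_le := hc.2.le, subset_outer := ?_, subset_inner := hsub
      hi_zero := hpL.2, lo_one := hpR.1, outer_lo := ?_, outer_hi := ?_, inner := ?_ }⟩
  · exact Fin.forall_fin_two.2 ⟨hpL.1.le, hpR.2.le⟩
  · exact Fin.forall_fin_two.2 ⟨fun p hp => Or.inl ⟨hp.1, hp.2.trans_lt hpL.2⟩,
      fun p hp => Or.inr ⟨hpR.1.trans_le hp.1, hp.2⟩⟩
  · intro q hq q' hq'
    have h1 := h.outerTime_lower_le (hsub hq)
    have h2 := h.outerTime_lower_le (hsub hq')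
    have h3 := HR q (hsub hq)
    have h4 := HR q' (hsub hq')
    simp only [outerTravel, Matrix.cons_val_zero, Matrix.cons_val_one]
    constructor <;> linarith
  · intro q hq q' hq'
    have h1 := h.outerTime_upper_le (hsub hq)
    have h2 := h.outerTime_upper_le (hsub hq')
    have h3 := HL q (hsub hq)
    have h4 := HL q' (hsub hq')
    simp only [outerTravel, Matrix.cons_val_zero, Matrix.cons_val_one]
    constructor <;> linarith
  · intro p hp p' hp' j hj
    have h1 := Hc p hp
    have h2 := Hc p' hp'
    have h3 := (h.reaches_halfPeriod (hsub (left_mem_Icc.2 hc.2.le))).1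
    have h4 : 0 ≤ (j : ℝ) * (2 * halfPeriod f k₂ c) := by positivity
    refine ⟨?_, (h.innerTime_add_le hp hp' hj).trans ht₂.le⟩
    simp only [innerTravel]
    linarith

namespace TimedArcs

variable {f : ℝ → ℝ} {k₁ k₂ A B D t₁ t₂ : ℝ} {m : ℕ} {lo hi : Fin 2 → ℝ} {c d : ℝ}

/-- The parameters `(p, q, q', p')` of the orbit segments that start on the `i`-th arc and make `j`
additional turns. -/
def segments (f : ℝ → ℝ) (k₁ k₂ t₁ t₂ : ℝ) (lo hi : Fin 2 → ℝ) (c d : ℝ) (i : Fin 2) (j : ℕ) :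
    Set (ℝ × ℝ × ℝ × ℝ) :=
  {v | v ∈ Icc (lo i) (hi i) ×ˢ Icc c d ×ˢ Icc c d ×ˢ (⋃ i', Icc (lo i') (hi i')) ∧
    outerTravel f k₁ k₂ (v.1, v.2.1, v.2.2.1) = t₁ ∧
    innerTravel f k₁ k₂ j (v.2.2.1, v.1, v.2.2.2) = t₂}

/-- The initial point of an orbit segment. -/
def source (f : ℝ → ℝ) (k₁ k₂ : ℝ) (v : ℝ × ℝ × ℝ × ℝ) : ℝ × ℝ := crossPt f k₁ k₂ v.1 v.2.1

/-- The end point of an orbit segment. -/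
def target (f : ℝ → ℝ) (k₁ k₂ : ℝ) (v : ℝ × ℝ × ℝ × ℝ) : ℝ × ℝ :=
  crossPt f k₁ k₂ v.2.2.2 v.2.2.1

/-- The point of an orbit segment at the switching time. -/
def middle (f : ℝ → ℝ) (k₁ k₂ : ℝ) (v : ℝ × ℝ × ℝ × ℝ) : ℝ × ℝ :=
  ((crossPt f k₁ k₂ v.1 v.2.2.1).1, -(crossPt f k₁ k₂ v.1 v.2.2.1).2)

theorem mem_arcs (h : TimedArcs f k₁ k₂ A B D t₁ t₂ m lo hi c d) {i : Fin 2} {j : ℕ}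
    {v : ℝ × ℝ × ℝ × ℝ} (hv : v ∈ segments f k₁ k₂ t₁ t₂ lo hi c d i j) :
    v.1 ∈ outerArc f k₁ A B ∧ v.2.1 ∈ innerArc f k₂ D ∧ v.2.2.1 ∈ innerArc f k₂ D ∧
      v.2.2.2 ∈ outerArc f k₁ A B := by
  obtain ⟨⟨h1, h2, h3, h4⟩, -⟩ := hv
  obtain ⟨i', hi'⟩ := mem_iUnion.1 h4
  exact ⟨h.subset_outer i h1, h.subset_inner h2, h.subset_inner h3, h.subset_outer i' hi'⟩

theorem reaches_middle (h : TimedArcs f k₁ k₂ A B D t₁ t₂ m lo hi c d) {i : Fin 2} {j : ℕ}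
    {v : ℝ × ℝ × ℝ × ℝ} (hv : v ∈ segments f k₁ k₂ t₁ t₂ lo hi c d i j) :
    Reaches f k₁ (source f k₁ k₂ v) (middle f k₁ k₂ v) t₁ := by
  obtain ⟨h1, h2, h3, -⟩ := h.mem_arcs hv
  have := h.reaches_upper_lower h1 h2 h3
  rwa [← hv.2.1]

theorem reaches_target (h : TimedArcs f k₁ k₂ A B D t₁ t₂ m lo hi c d) {i : Fin 2} {j : ℕ}
    {v : ℝ × ℝ × ℝ × ℝ} (hv : v ∈ segments f k₁ k₂ t₁ t₂ lo hi c d i j) :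
    Reaches f k₂ (middle f k₁ k₂ v) (target f k₁ k₂ v) t₂ := by
  obtain ⟨h1, -, h3, h4⟩ := h.mem_arcs hv
  have := h.reaches_lower_upper h1 h4 h3 j
  rwa [← hv.2.2]

theorem isCompact_segments (h : TimedArcs f k₁ k₂ A B D t₁ t₂ m lo hi c d) (i : Fin 2) (j : ℕ) :
    IsCompact (segments f k₁ k₂ t₁ t₂ lo hi c d i j) := by
  have hbox : IsCompact
      (Icc (lo i) (hi i) ×ˢ Icc c d ×ˢ Icc c d ×ˢ (⋃ i', Icc (lo i') (hi i'))) :=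
    isCompact_Icc.prod (isCompact_Icc.prod (isCompact_Icc.prod
      (isCompact_iUnion fun _ => isCompact_Icc)))
  have h1 := h.continuousOn_outerTravel.comp (f := fun v : ℝ × ℝ × ℝ × ℝ => (v.1, v.2.1, v.2.2.1))
    (s := Icc (lo i) (hi i) ×ˢ Icc c d ×ˢ Icc c d ×ˢ (⋃ i', Icc (lo i') (hi i'))) (by fun_prop)
    fun v hv => ⟨h.subset_outer i hv.1, h.subset_inner hv.2.1, h.subset_inner hv.2.2.1⟩
  have h2 := (h.continuousOn_innerTravel j).comp
    (f := fun v : ℝ × ℝ × ℝ × ℝ => (v.2.2.1, v.1, v.2.2.2))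
    (s := Icc (lo i) (hi i) ×ˢ Icc c d ×ˢ Icc c d ×ˢ (⋃ i', Icc (lo i') (hi i'))) (by fun_prop)
    fun v hv => by
      obtain ⟨i', hi'⟩ := mem_iUnion.1 hv.2.2.2
      exact ⟨h.subset_inner hv.2.2.1, h.subset_outer i hv.1, h.subset_outer i' hi'⟩
  have hcl := (h1.prodMk h2).preimage_isClosed_of_isClosed hbox.isClosed
    (isClosed_singleton (x := (t₁, t₂)))
  refine hbox.of_isClosed_subset ?_ fun v hv => hv.1
  convert hcl using 1
  ext v
  simp [segments]

/-- The `k₁`-energy of the starting point lies below or above the saddle level and reveals `i`. By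
uniqueness the whole segment is determined, including `q'` and both crossing abscissas of the second
phase; the equation for `t₂` then fixes `j`, as the period is positive. -/
theorem eq_of_source_eq (h : TimedArcs f k₁ k₂ A B D t₁ t₂ m lo hi c d) {i i' : Fin 2} {j j' : ℕ}
    {v v' : ℝ × ℝ × ℝ × ℝ} (hv : v ∈ segments f k₁ k₂ t₁ t₂ lo hi c d i j)
    (hv' : v' ∈ segments f k₁ k₂ t₁ t₂ lo hi c d i' j')
    (e : source f k₁ k₂ v = source f k₁ k₂ v') : i = i' ∧ j = j' := by
  obtain ⟨h1, h2, h3, h4⟩ := h.mem_arcs hv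
  obtain ⟨h1', h2', h3', h4'⟩ := h.mem_arcs hv'
  have hf := h.hyp.locallyLipschitz
  constructor
  · have hlevel : ∀ i, ∀ p ∈ Icc (lo i) (hi i),
        (i = 0 ∧ potential f k₁ p < potential f k₁ (xSaddle f k₁)) ∨
        (i = 1 ∧ potential f k₁ (xSaddle f k₁) < potential f k₁ p) := by
      refine Fin.forall_fin_two.2 ⟨fun p hp => Or.inl ⟨rfl, ?_⟩, fun p hp => Or.inr ⟨rfl, ?_⟩⟩
      · have := hp.2.trans_lt h.hi_zero
        exact h.hyp.strictMonoOn_potential_Iic h.pos (mem_Iic.2 this.le) (mem_Iic.2 le_rfl) this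
      · exact h.potential_lt (h.subset_outer 1 hp)
          (h.saddle_lt_hom.trans (h.lo_one.trans_le hp.1))
    have he : potential f k₁ v.1 = potential f k₁ v'.1 := by
      rw [← (h.energy_crossPt h1 h2).1, ← (h.energy_crossPt h1' h2').1]
      exact congrArg _ e
    rcases hlevel i _ hv.1.1 with ⟨rfl, hlt⟩ | ⟨rfl, hlt⟩ <;>
      rcases hlevel i' _ hv'.1.1 with ⟨rfl, hlt'⟩ | ⟨rfl, hlt'⟩ <;>
      first | rfl | linarith
  · have em : middle f k₁ k₂ v = middle f k₁ k₂ v' :=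
      (h.reaches_middle hv).right_unique hf (e ▸ h.reaches_middle hv')
    have et : target f k₁ k₂ v = target f k₁ k₂ v' :=
      (h.reaches_target hv).right_unique hf (em ▸ h.reaches_target hv')
    have hq : v.2.2.1 = v'.2.2.1 := by
      refine (h.hyp.strictAntiOn_potential h.pos₂).injOn
        (Ioo_subset_Icc_self (h.innerArc_subset h3))
        (Ioo_subset_Icc_self (h.innerArc_subset h3')) ?_
      rw [← (h.energy_crossPt h4 h3).2, ← (h.energy_crossPt h4' h3').2]
      exact congrArg _ et
    have em1 : crossX f k₁ k₂ v.1 v.2.2.1 = crossX f k₁ k₂ v'.1 v'.2.2.1 := congrArg Prod.fst em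
    have et1 : crossX f k₁ k₂ v.2.2.2 v.2.2.1 = crossX f k₁ k₂ v'.2.2.2 v'.2.2.1 :=
      congrArg Prod.fst et
    have e1 := hv.2.2
    have e2 := hv'.2.2
    have hpos := (h.reaches_halfPeriod h3').1
    simp only [innerTravel, innerTime, em1, et1] at e1 e2
    rw [hq] at e1
    have e3 := mul_right_cancel₀ (mul_pos two_pos hpos).ne' (add_left_cancel (e1.trans e2.symm))
    exact_mod_cast e3

theorem exists_periodic_segments (h : TimedArcs f k₁ k₂ A B D t₁ t₂ m lo hi c d)
    {l : ℕ} [NeZero l] (br : ZMod l → Fin 2) (turns : ZMod l → ℕ) (hturns : ∀ i, turns i < m) :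
    ∃ P Q : ZMod l → ℝ, ∀ i,
      (P i, Q i, Q (i + 1), P (i + 1)) ∈ segments f k₁ k₂ t₁ t₂ lo hi c d (br i) (turns i) := by
  -- The fast end is the left one on arc `0` and the right one on arc `1`; the sign gives both arcs
  -- the orientation required by the cyclic system.
  set σ : Fin 2 → ℝ := ![1, -1]
  have hσ : ∀ i, σ i ≠ 0 := Fin.forall_fin_two.2 ⟨by simp [σ], by simp [σ]⟩
  obtain ⟨P, Q, hPQ⟩ := exists_cyclic_solution (l := l) (lo := fun i => lo (br i))
    (hi := fun i => hi (br i)) (fun i => h.lo_le _) h.c_le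
    (G := fun i v => σ (br i) * (outerTravel f k₁ k₂ v - t₁))
    (H := fun i v => t₂ - innerTravel f k₁ k₂ (turns i) v)
    (fun i => continuousOn_const.mul ((h.continuousOn_outerTravel.mono (prod_mono
      (h.subset_outer _) (prod_mono h.subset_inner h.subset_inner))).sub continuousOn_const))
    (fun i q hq q' hq' => by
      have := h.outer_lo q hq q' hq'
      generalize br i = b
      revert b
      exact Fin.forall_fin_two.2 ⟨by simp [σ]; exact this.1, by simp [σ]; exact this.2⟩)
    (fun i q hq q' hq' => by
      have := h.outer_hi q hq q' hq'
      generalize br i = b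
      revert b
      exact Fin.forall_fin_two.2 ⟨by simp [σ]; exact this.1, by simp [σ]; exact this.2⟩)
    (fun i => continuousOn_const.sub ((h.continuousOn_innerTravel _).mono (prod_mono
      h.subset_inner (prod_mono (h.subset_outer _) (h.subset_outer _)))))
    (fun i p hp p' hp' => sub_nonpos.2
      (h.inner p (h.subset_outer _ hp) p' (h.subset_outer _ hp') _ (hturns i)).1)
    (fun i p hp p' hp' => sub_nonneg.2
      (h.inner p (h.subset_outer _ hp) p' (h.subset_outer _ hp') _ (hturns i)).2)
  refine ⟨P, Q, fun i => ?_⟩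
  obtain ⟨h1, h2, h3, h4⟩ := hPQ i
  obtain ⟨h1', h2', -, -⟩ := hPQ (i + 1)
  refine ⟨⟨h1, h2, h2', mem_iUnion.2 ⟨_, h1'⟩⟩, ?_, ?_⟩
  · exact sub_eq_zero.1 ((mul_eq_zero.1 h3).resolve_left (hσ _))
  · exact (sub_eq_zero.1 h4).symm

/-- Each `K n`, and the graph of the Poincaré map over it, is a continuous image of a compact set of
segments, via `source` and `target`. -/
theorem horseshoe (h : TimedArcs f k₁ k₂ A B D t₁ t₂ m lo hi c d) (hm : 1 ≤ m) {p : ℝ → ℝ}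
    (hp₁ : ∀ t ∈ Ico 0 t₁, p t = k₁) (hp₂ : ∀ t ∈ Ico t₁ (t₁ + t₂), p t = k₂) :
    HasTopologicalHorseshoe (poincareDom f p (t₁ + t₂)) (poincareMap f p (t₁ + t₂)) (2 * m) ∧
    InducesChaos (poincareDom f p (t₁ + t₂)) (poincareMap f p (t₁ + t₂)) (2 * m)
      (rectM f k₁ k₂ A B D ∩ {z | z ∈ poincareDom f (fun _ => k₁) t₁ ∧
        poincareMap f (fun _ => k₁) t₁ z ∈ rectN f k₁ k₂ A B D}) := by
  set φ := poincareMap f p (t₁ + t₂)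
  set dom := poincareDom f p (t₁ + t₂)
  set 𝓓 := rectM f k₁ k₂ A B D ∩ {z | z ∈ poincareDom f (fun _ => k₁) t₁ ∧
    poincareMap f (fun _ => k₁) t₁ z ∈ rectN f k₁ k₂ A B D}
  have hf := h.hyp.locallyLipschitz
  set seg := segments f k₁ k₂ t₁ t₂ lo hi c d
  set src := source f k₁ k₂
  set tgt := target f k₁ k₂
  have hφ : ∀ {i j v}, v ∈ seg i j → src v ∈ dom ∧ φ (src v) = tgt v := fun hv =>
    Reaches.switch hf hp₁ hp₂ (h.reaches_middle hv) (h.reaches_target hv)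
  have hsrc : Continuous src := h.continuous_crossPt.comp
    (f := fun v : ℝ × ℝ × ℝ × ℝ => (v.1, v.2.1)) (by fun_prop)
  have htgt : Continuous tgt := h.continuous_crossPt.comp
    (f := fun v : ℝ × ℝ × ℝ × ℝ => (v.2.2.2, v.2.2.1)) (by fun_prop)
  set sym : Fin (2 * m) → Fin 2 × Fin m := fun n => finProdFinEquiv.symm n
  set K : Fin (2 * m) → Set (ℝ × ℝ) := fun n => src '' seg (sym n).1 (sym n).2
  have hKc : ∀ n, IsCompact (K n) := fun n => (h.isCompact_segments _ _).image hsrc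
  have hKdisj : ∀ n n', n ≠ n' → Disjoint (K n) (K n') := fun n n' hne => by
    refine disjoint_left.2 ?_
    rintro _ ⟨v, hv, rfl⟩ ⟨v', hv', e⟩
    obtain ⟨e1, e2⟩ := h.eq_of_source_eq hv hv' e.symm
    exact hne (finProdFinEquiv.symm.injective (Prod.ext e1 (Fin.ext e2)))
  have hG : ∀ n, IsCompact ((fun z => (z, φ z)) '' K n) := fun n => by
    have : (fun z => (z, φ z)) '' K n = (fun v => (src v, tgt v)) '' seg (sym n).1 (sym n).2 := by
      rw [image_image]
      exact image_congr fun v hv => by rw [(hφ hv).2]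
    rw [this]
    exact (h.isCompact_segments _ _).image (hsrc.prodMk htgt)
  have hinj : InjOn φ (⋃ n, K n) := by
    intro z hz z' hz' e
    obtain ⟨n, v, hv, rfl⟩ := mem_iUnion.1 hz
    obtain ⟨n', v', hv', rfl⟩ := mem_iUnion.1 hz'
    rw [(hφ hv).2, (hφ hv').2] at e
    have h1 := h.reaches_target hv
    change Reaches f k₂ _ (tgt v) t₂ at h1
    rw [e] at h1
    have h2 := h.reaches_middle hv
    rw [h1.left_unique hf (h.reaches_target hv')] at h2
    exact h2.left_unique hf (h.reaches_middle hv')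
  have hK𝓓 : ∀ n, K n ⊆ 𝓓 := by
    rintro n _ ⟨v, hv, rfl⟩
    obtain ⟨a1, a2, a3, -⟩ := h.mem_arcs hv
    have h1 := h.reaches_middle hv
    refine ⟨h.crossPt_mem_rectM a1 a2, h1.mem_poincareDom, ?_⟩
    have := h1.poincareMap_eq hf
    change poincareMap f (fun _ => k₁) t₁ (source f k₁ k₂ v) ∈ _
    rw [this]
    exact h.crossPt_mem_rectN a1 a3
  have hper : ∀ s : ℤ → Fin (2 * m), ∀ l : ℕ, 1 ≤ l → (∀ i, s (i + l) = s i) →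
      ∃ w : ℤ → ℝ × ℝ, (∀ i, w i ∈ K (s i) ∧ w (i + 1) = φ (w i)) ∧ ∀ i, w (i + l) = w i := by
    intro s l hl hs
    have : NeZero l := ⟨by omega⟩
    -- An `l`-periodic sequence is a function on `ZMod l`, the index set of the cyclic system.
    have hsval : ∀ i : ℤ, s ((i : ZMod l).val) = s i := fun i => by
      have hs' : Function.Periodic s (l : ℤ) := hs
      rw [ZMod.val_intCast]
      conv_rhs => rw [← Int.emod_add_mul_ediv i l, mul_comm]
      exact (hs'.int_mul (i / l) _).symm
    obtain ⟨P, Q, hPQ⟩ := h.exists_periodic_segments (l := l)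
      (fun i => (sym (s i.val)).1) (fun i => (sym (s i.val)).2) fun i => Fin.is_lt _
    have hmem : ∀ i : ℤ, (P i, Q i, Q (i + 1), P (i + 1)) ∈ seg (sym (s i)).1 (sym (s i)).2 :=
      fun i => by simpa only [hsval] using hPQ (i : ZMod l)
    refine ⟨fun i => crossPt f k₁ k₂ (P i) (Q i), fun i => ⟨⟨_, hmem i, rfl⟩, ?_⟩, fun i => ?_⟩
    · have := (hφ (hmem i)).2
      simp only [Int.cast_add, Int.cast_one]
      exact this.symm
    · simp
  obtain ⟨hgen, Λ, π, hΛ, hΛK, hshoe⟩ :=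
    exists_horseshoe_of_periodic (by omega) hKc hKdisj hG hinj hper
  have hKne : ∀ n, (K n).Nonempty := fun n => by
    obtain ⟨w, hw⟩ := hgen fun _ => n
    exact ⟨w 0, (hw 0).1⟩
  have hKdom : ∀ n, K n ⊆ dom := by
    rintro n _ ⟨v, hv, rfl⟩
    exact (hφ hv).1
  refine ⟨⟨by omega, Λ, π, hΛ, hΛK.trans (iUnion_subset hKdom), hshoe⟩, by omega, ?_, ?_, K,
    fun n => ⟨hKne n, hKc n, hK𝓓 n⟩, hKdisj, hgen, hper⟩
  · exact (hKne ⟨0, by omega⟩).mono (hK𝓓 _)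
  -- `𝓓` may be larger than the union of the `K n`, so the second phase is continued by
  -- `exists_reaches_of_mem_annulus`. The segment `v` only provides `0 ≤ t₁` and `0 ≤ t₂`.
  · obtain ⟨_, v, hv, rfl⟩ := hKne ⟨0, by omega⟩
    rintro z ⟨-, hzd, hzN⟩
    have h1 := Reaches.of_mem_poincareDom hf (h.reaches_middle hv).1 hzd
    obtain ⟨w, h2⟩ := h.exists_reaches_of_mem_annulus hzN.1.1 hzN.2 (h.reaches_target hv).1
    exact (Reaches.switch hf hp₁ hp₂ h1 h2).1

end TimedArcs

end

theorem theorem3p5 (f : ℝ → ℝ) (hf : HypH0 f) (k₁ k₂ : ℝ) (hk₁ : 0 < k₁) (hk : k₁ < k₂) :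
    (∃ A B D : ℝ, AdmissibleLevels f k₁ k₂ A B D) ∧
    ∀ A B D : ℝ, AdmissibleLevels f k₁ k₂ A B D →
    ∀ m : ℕ, 1 ≤ m →
    ∀ t₁ t₂ : ℝ, tauStar₁ f k₁ k₂ A B < t₁ → tauStar₂ f k₁ k₂ B D m < t₂ →
    ∀ p : ℝ → ℝ, Function.Periodic p (t₁ + t₂) →
      (∀ t ∈ Set.Ico 0 t₁, p t = k₁) → (∀ t ∈ Set.Ico t₁ (t₁ + t₂), p t = k₂) →
      HasTopologicalHorseshoe (poincareDom f p (t₁ + t₂)) (poincareMap f p (t₁ + t₂)) (2 * m) ∧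
      InducesChaos (poincareDom f p (t₁ + t₂)) (poincareMap f p (t₁ + t₂)) (2 * m)
        (rectM f k₁ k₂ A B D ∩
          {z | z ∈ poincareDom f (fun _ => k₁) t₁ ∧
            poincareMap f (fun _ => k₁) t₁ z ∈ rectN f k₁ k₂ A B D}) := by
  refine ⟨exists_admissibleLevels hf hk₁ hk, fun A B D hadm m hm t₁ t₂ ht₁ ht₂ p _ hp₁ hp₂ => ?_⟩
  obtain ⟨lo, hi, c, d, h⟩ := LinkedSystem.exists_timedArcs ⟨hf, hk₁, hk, hadm⟩ ht₁ ht₂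
  exact h.horseshoe hm hp₁ hp₂
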